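/- **Setting.** Let $\Gamma$ be a countable set. For a nonzero finite-dimensional complex Hilbert space $\mathcal H$ let $\mathfrak A_\Gamma(\mathcal H)=\operatorname{colim}_{\Lambda\Subset\Gamma}\bigotimes_{v\in\Lambda}\mathcal B(\mathcal H)$ be the quasi-local $C^*$-algebra and $\mathscr P_\Gamma(\mathcal H)$ its space of pure states with the weak$^*$ topology. A linear isometry $f\colon\mathcal H\to\mathcal K$ induces $\mathscr P_\Gamma(f)\colon\mathscr P_\Gamma(\mathcal H)\to\mathscr P_\Gamma(\mathcal K)$, $\omega\mapsto\omega\circ\mathfrak A_\Gamma(f)$, where $\mathfrak A_\Gamma(f)(\bigotimes_{v\in\Lambda}A_v)=\bigotimes_{v\in\Lambda}f^*A_vf$, and states can be stacked, $(\omega_1,\omega_2)\mapsto\omega_1\otimes\omega_2\in\mathscr P_\Gamma(\mathcal H_1\otimes\mathcal H_2)$. A *quantum state type* $\mathscr Q_\Gamma$ assigns to each $\mathcal H$ a subspace $\mathscr Q_\Gamma(\mathcal H)\subseteq\mathscr P_\Gamma(\mathcal H)$ containing all completely factorized states $\bigotimes_{v\in\Gamma}\psi_v$, such that every $\mathscr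 P_\Gamma(f)$ restricts to a closed embedding $\mathscr Q_\Gamma(f)\colon\mathscr Q_\Gamma(\mathcal H)\to\mathscr Q_\Gamma(\mathcal K)$, and such that $\omega_1\otimes\omega_2\in\mathscr Q_\Gamma(\mathcal H_1\otimes\mathcal H_2)$ whenever $\omega_i\in\mathscr Q_\Gamma(\mathcal H_i)$. Let $\dim\mathcal H\ge 2$ and let $u\in\mathcal H$ be a unit vector with pure state $\psi$; write $\psi_i\in\mathscr Q_\Gamma(\mathcal H^{\otimes i})$ for the factorized state with vector $u^{\otimes i}$ at every site, and let $\Phi_i\colon\mathcal H^{\otimes i}\to\mathcal H^{\otimes(i+1)}$, $x\mapsto x\otimes u$, so that $\mathscr Q_\Gamma(\Phi_i)(\omega)=\omega\otimes\psi$. Put $$\mathscr Q^\sqcup_\Gamma(\mathcal H)=\coprod_{i\ge0}\mathscr Q_\Gamma(\mathcal H^{\otimes i}),\qquad \mathscr Q_\Gamma(\mathcal H^{\otimes\infty})=\operatorname{colim}_{i,\,\mathscr Q_\Gamma(\Phi_i)}\mathscr Q_\Gamma(\mathcal H^{\otimes i}),$$ $$\psi^{-1}\mathscr Q^\sqcup_\Gamma(\mathcal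 H)=\operatorname{colim}\bigl(\mathscr Q^\sqcup_\Gamma(\mathcal H)\xrightarrow{\otimes\psi}\mathscr Q^\sqcup_\Gamma(\mathcal H)\xrightarrow{\otimes\psi}\cdots\bigr),$$ with $\iota_k\colon\mathscr Q^\sqcup_\Gamma(\mathcal H)\to\psi^{-1}\mathscr Q^\sqcup_\Gamma(\mathcal H)$ the inclusion of the $k$-th term ($k\ge 0$) and $\jmath\colon\mathscr Q^\sqcup_\Gamma(\mathcal H)\to\mathscr Q_\Gamma(\mathcal H^{\otimes\infty})$ the canonical map. Let $\psi^{-1}\jmath\colon\psi^{-1}\mathscr Q^\sqcup_\Gamma(\mathcal H)\to\mathscr Q_\Gamma(\mathcal H^{\otimes\infty})$ and $\psi^{-1}c\colon\psi^{-1}\mathscr Q^\sqcup_\Gamma(\mathcal H)\to\mathbb Z$ be the maps with $\psi^{-1}\jmath\circ\iota_\ell=\jmath$ and $\psi^{-1}c(\iota_\ell(\omega))=k-\ell$ for $\omega\in\mathscr Q_\Gamma(\mathcal H^{\otimes k})$. Stacking makes $\mathscr Q^\sqcup_\Gamma(\mathcal H)$ a homotopy commutative topological monoid with unit $\psi_0$;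 $\mathscr Q_\Gamma(\mathcal H^{\otimes\infty})$, based at the class of $\psi_0$, is a homotopy associative and commutative $H$-space under $(\omega,\tau)\mapsto\mathscr Q_\Gamma(\varphi)(\omega\otimes\tau)$, where $\varphi\colon\mathcal H^{\otimes\infty}\otimes\mathcal H^{\otimes\infty}\to\mathcal H^{\otimes\infty}$ is the interleaving isometry $(v_1\otimes v_2\otimes\cdots)\otimes(w_1\otimes w_2\otimes\cdots)\mapsto v_1\otimes w_1\otimes v_2\otimes w_2\otimes\cdots$. For a space $X$, $[X,Y]$ denotes the set of free homotopy classes of continuous maps, with the pointwise operation when $Y$ is $\mathscr Q^\sqcup_\Gamma(\mathcal H)$, $\mathscr Q_\Gamma(\mathcal H^{\otimes\infty})$ or the discrete group $\mathbb Z$. $\mathscr Q_\Gamma$ is *invertible* if the monoid $\pi_0\mathscr Q_\Gamma(\mathcal H^{\otimes\infty})$ is a group for all $(\mathcal H,\psi)$ with $\dim\mathcal H\ge 2$. **Theorem.** Let $\mathscr Q_\Gamma$ be an invertible quantum state type, let $(\mathcal H,\psi)$ be as above, and let $X$ be a compact Hausdorff space homotopy equivalent to a CW complex. Then $[X,\mathscr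 Q^\sqcup_\Gamma(\mathcal H)]$ is a commutative monoid and $[X,\mathscr Q_\Gamma(\mathcal H^{\otimes\infty})]$ an abelian group under the above operations. The maps $[X,\iota_k]$ identify $[X,\psi^{-1}\mathscr Q^\sqcup_\Gamma(\mathcal H)]$ with the localization $\operatorname{colim}\bigl([X,\mathscr Q^\sqcup_\Gamma(\mathcal H)]\xrightarrow{\otimes\psi}[X,\mathscr Q^\sqcup_\Gamma(\mathcal H)]\xrightarrow{\otimes\psi}\cdots\bigr)$ of the monoid $[X,\mathscr Q^\sqcup_\Gamma(\mathcal H)]$ at the constant map $\psi$, and with the resulting operation $[X,\psi^{-1}\mathscr Q^\sqcup_\Gamma(\mathcal H)]$ is an abelian group. Moreover $$[X,\iota_0]\colon[X,\mathscr Q^\sqcup_\Gamma(\mathcal H)]\to[X,\psi^{-1}\mathscr Q^\sqcup_\Gamma(\mathcal H)]$$ is the Grothendieck group completion (the universal homomorphism to an abelian group), and $[X,\psi^{-1}\jmath]\times[X,\psi^{-1}c]$ is an isomorphism of groups, so that there are isomorphisms $$K_0\bigl([X,\mathscr Q^\sqcup_\Gamma(\mathcal H)]\bigr)\;\cong\;[X,\psi^{-1}\mathscr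 Q^\sqcup_\Gamma(\mathcal H)]\;\xrightarrow{\ \cong\ }\;[X,\mathscr Q_\Gamma(\mathcal H^{\otimes\infty})]\times[X,\mathbb Z]$$ whose composite sends the class of $a\in[X,\mathscr Q^\sqcup_\Gamma(\mathcal H)]$ to $\bigl([X,\psi^{-1}\jmath]([X,\iota_0]a),\,[X,\psi^{-1}c]([X,\iota_0]a)\bigr)$. -/

import Mathlib

open scoped TensorProduct ComplexOrder InnerProductSpace

universe v

noncomputable section

/-! ### Finite-dimensional Hilbert spaces -/

/-- Objects of `Hilb_fin`: nonzero finite-dimensional complex Hilbert spaces.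
Morphisms are linear isometries `H →ₗᵢ[ℂ] K`. -/
structure FinHilb where
  carrier : Type
  [normed : NormedAddCommGroup carrier]
  [inner : InnerProductSpace ℂ carrier]
  [finite : FiniteDimensional ℂ carrier]
  [nontrivial : Nontrivial carrier]

namespace FinHilb

instance : CoeSort FinHilb Type := ⟨FinHilb.carrier⟩

attribute [instance] FinHilb.normed FinHilb.inner FinHilb.finite FinHilb.nontrivial

/-- The monoidal unit `ℂ`. -/
def unit : FinHilb where
  carrier := ℂ

/-- The tensor product of Hilbert spaces. -/
def tensor (H K : FinHilb) : FinHilb where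
  carrier := H ⊗[ℂ] K
  nontrivial := by
    have h : 0 < Module.finrank ℂ (H ⊗[ℂ] K) := by
      rw [Module.finrank_tensorProduct]
      exact Nat.mul_pos Module.finrank_pos Module.finrank_pos
    exact Module.nontrivial_of_finrank_pos h

/-- The tensor powers `H^{⊗ i}`, with `H^{⊗ 0} = ℂ` and `H^{⊗ (i+1)} = H^{⊗ i} ⊗ H`. -/
def tpow (H : FinHilb) : ℕ → FinHilb
  | 0 => unit
  | i + 1 => tensor (tpow H i) H

/-- The canonical unitary `H^{⊗ i} ⊗ H^{⊗ j} ≅ H^{⊗ (i+j)}` (concatenation). -/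
def concat (H : FinHilb) (i : ℕ) : (j : ℕ) → (tensor (tpow H i) (tpow H j) →ₗᵢ[ℂ] tpow H (i + j))
  | 0 => (TensorProduct.ridIsometry ℂ (tpow H i)).toLinearIsometry
  | j + 1 =>
    ((concat H i j).rTensor H).comp
      (TensorProduct.assocIsometry ℂ (tpow H i) (tpow H j) H).symm.toLinearIsometry

/-- The shuffle `(a ⊗ b) ⊗ (c ⊗ d) ↦ ((a ⊗ c) ⊗ b) ⊗ d`. -/
def shuffle (V H : FinHilb) :
    tensor (tensor V H) (tensor V H) →ₗᵢ[ℂ] tensor (tensor (tensor V V) H) H :=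
  let α := (TensorProduct.assocIsometry ℂ V H (V ⊗[ℂ] H)).toLinearIsometry
  let β := ((TensorProduct.assocIsometry ℂ H V H).symm.toLinearIsometry).lTensor V
  let γ := (((TensorProduct.commIsometry ℂ H V).toLinearIsometry).rTensor H).lTensor V
  let δ := ((TensorProduct.assocIsometry ℂ V H H).toLinearIsometry).lTensor V
  let ε := (TensorProduct.assocIsometry ℂ V V (H ⊗[ℂ] H)).symm.toLinearIsometry
  let ζ := (TensorProduct.assocIsometry ℂ (V ⊗[ℂ] V) H H).symm.toLinearIsometry
  ζ.comp (ε.comp (δ.comp (γ.comp (β.comp α))))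

/-- The interleaving isometry `H^{⊗ n} ⊗ H^{⊗ n} → H^{⊗ 2n}`,
`(v₁ ⊗ ⋯ ⊗ vₙ) ⊗ (w₁ ⊗ ⋯ ⊗ wₙ) ↦ v₁ ⊗ w₁ ⊗ ⋯ ⊗ vₙ ⊗ wₙ`. -/
def interleave (H : FinHilb) : (n : ℕ) → (tensor (tpow H n) (tpow H n) →ₗᵢ[ℂ] tpow H (2 * n))
  | 0 => (TensorProduct.lidIsometry ℂ ℂ).toLinearIsometry
  | n + 1 => (((interleave H n).rTensor H).rTensor H).comp (shuffle (tpow H n) H)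

end FinHilb

/-! ### The quasi-local algebra -/

section QuasiLocal

variable (Γ : Type*) (H : FinHilb)

/-- Index set of a fixed orthonormal basis of `H`. -/
abbrev SpinIndex : Type := Fin (Module.finrank ℂ H)

/-- Spin configurations on the lattice. -/
abbrev Config := Γ → SpinIndex H

/-- The Hilbert space `ℓ²(Config)` on which the quasi-local algebra is faithfully represented. -/
abbrev ConfigSpace := lp (fun _ : Config Γ H => ℂ) 2

variable {Γ H}

/-- Overwrite the configuration `s` by `t` inside the finite region `Λ`. -/
def overwrite (Λ : Finset Γ) (s : Config Γ H) (t : Λ → SpinIndex H) : Config Γ H := by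
  classical exact fun v => if h : v ∈ Λ then t ⟨v, h⟩ else s v

/-- The restriction of a configuration to `Λ`. -/
def restrictConfig (Λ : Finset Γ) (s : Config Γ H) : Λ → SpinIndex H := fun v => s v

theorem overwrite_injOn (Λ : Finset Γ) (r t : Λ → SpinIndex H) :
    Set.InjOn (fun s : Config Γ H => overwrite Λ s t) {s | restrictConfig Λ s = r} := by
  classical
  intro s hs s' hs' h
  funext v
  by_cases hv : v ∈ Λ
  · have h1 := congrFun hs ⟨v, hv⟩
    have h2 := congrFun hs' ⟨v, hv⟩
    exact h1.trans h2.symm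
  · have := congrFun h v
    simpa [overwrite, hv] using this

open Classical in
/-- The function underlying the action of a matrix unit. -/
def matrixUnitFun (Λ : Finset Γ) (r t : Λ → SpinIndex H) (ξ : Config Γ H → ℂ) :
    Config Γ H → ℂ :=
  fun s => if restrictConfig Λ s = r then ξ (overwrite Λ s t) else 0

theorem matrixUnitFun_sum_le (Λ : Finset Γ) (r t : Λ → SpinIndex H) (ξ : ConfigSpace Γ H)
    (S : Finset (Config Γ H)) :
    ∑ s ∈ S, ‖matrixUnitFun Λ r t ξ s‖ ^ (2 : ENNReal).toReal
      ≤ ‖ξ‖ ^ (2 : ENNReal).toReal := by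
  classical
  have hp : 0 < (2 : ENNReal).toReal := by norm_num
  have h1 : ∑ s ∈ S, ‖matrixUnitFun Λ r t ξ s‖ ^ (2 : ENNReal).toReal
      = ∑ s ∈ S.filter (fun s => restrictConfig Λ s = r),
          ‖ξ (overwrite Λ s t)‖ ^ (2 : ENNReal).toReal := by
    rw [Finset.sum_filter]
    refine Finset.sum_congr rfl fun s _ => ?_
    by_cases h : restrictConfig Λ s = r
    · simp [matrixUnitFun, h]
    · simp [matrixUnitFun, h]
  have hinj : Set.InjOn (fun s : Config Γ H => overwrite Λ s t)
      (S.filter (fun s => restrictConfig Λ s = r) : Finset (Config Γ H)) :=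
    (overwrite_injOn Λ r t).mono fun s hs => (Finset.mem_filter.1 hs).2
  rw [h1, ← Finset.sum_image (f := fun s => ‖ξ s‖ ^ (2 : ENNReal).toReal) hinj]
  exact lp.sum_rpow_le_norm_rpow hp ξ _

/-- The matrix unit `|r⟩⟨t|` of the region `Λ`, tensored with the identity outside `Λ`, as a
bounded operator on `ℓ²(Config)`. -/
def matrixUnitOp (Λ : Finset Γ) (r t : Λ → SpinIndex H) :
    ConfigSpace Γ H →L[ℂ] ConfigSpace Γ H :=
  LinearMap.mkContinuous
    { toFun := fun ξ => ⟨matrixUnitFun Λ r t ξ,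
        memℓp_gen' (C := ‖ξ‖ ^ (2 : ENNReal).toReal) (matrixUnitFun_sum_le Λ r t ξ)⟩
      map_add' := fun ξ ζ => by
        ext s
        change matrixUnitFun Λ r t (⇑ξ + ⇑ζ) s = matrixUnitFun Λ r t ξ s + matrixUnitFun Λ r t ζ s
        by_cases h : restrictConfig Λ s = r
        · simp [matrixUnitFun, h]
        · simp [matrixUnitFun, h]
      map_smul' := fun c ξ => by
        ext s
        by_cases h : restrictConfig Λ s = r
        · simp [matrixUnitFun, h]
        · simp [matrixUnitFun, h] }
    1 (fun ξ => by
      rw [one_mul]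
      exact lp.norm_le_of_forall_sum_le (by norm_num) (norm_nonneg _)
        (matrixUnitFun_sum_le Λ r t ξ))

/-- The elementary tensor `⨂_{v ∈ Λ} A v` of single-site observables, tensored with the identity
outside `Λ`. In the orthonormal basis of `H` its matrix entries are
`∏_{v ∈ Λ} ⟪b (r v), A v (b (t v))⟫`. -/
def elementaryOp (Λ : Finset Γ) (A : Γ → (H →ₗ[ℂ] H)) :
    ConfigSpace Γ H →L[ℂ] ConfigSpace Γ H := by
  classical exact
    ∑ r : Λ → SpinIndex H, ∑ t : Λ → SpinIndex H,
      (∏ v : Λ, ⟪stdOrthonormalBasis ℂ H (r v), A v (stdOrthonormalBasis ℂ H (t v))⟫_ℂ) •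
        matrixUnitOp Λ r t

variable (Γ H)

/-- The quasi-local algebra `𝔄_Γ(H)`, i.e. the colimit over finite regions `Λ` of the algebras
`⨂_{v ∈ Λ} B(H)`: the norm closure, on `ℓ²(Config)`, of the `*`-algebra of local observables, which
is generated by the elementary tensors. -/
def QuasiLocalAlgebra : StarSubalgebra ℂ (ConfigSpace Γ H →L[ℂ] ConfigSpace Γ H) :=
  (StarAlgebra.adjoin ℂ
    {T | ∃ (Λ : Finset Γ) (A : Γ → (H →ₗ[ℂ] H)), T = elementaryOp Λ A}).topologicalClosure

variable {Γ H}

/-- Elementary tensors as elements of the quasi-local algebra. -/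
def elementary (Λ : Finset Γ) (A : Γ → (H →ₗ[ℂ] H)) : QuasiLocalAlgebra Γ H :=
  ⟨elementaryOp Λ A, StarSubalgebra.le_topologicalClosure _
    (StarAlgebra.subset_adjoin ℂ _ ⟨Λ, A, rfl⟩)⟩

variable (Γ H)

/-- The states: normalized positive linear functionals, with the weak-* topology. -/
def stateSet : Set (WeakDual ℂ (QuasiLocalAlgebra Γ H)) :=
  {ω | ω 1 = 1 ∧ ∀ a, 0 ≤ ω (star a * a)}

/-- The space `𝒫_Γ(H)` of pure states (extreme points of the state space), with the weak-*
topology. -/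
abbrev PureState : Type _ :=
  {ω : WeakDual ℂ (QuasiLocalAlgebra Γ H) // ω ∈ (stateSet Γ H).extremePoints ℝ}

variable {Γ H}

/-- `ω` is the completely factorized state `⨂_v ψ v`. -/
def IsFactorized (ψ : Γ → H) (ω : PureState Γ H) : Prop :=
  ∀ (Λ : Finset Γ) (A : Γ → (H →ₗ[ℂ] H)),
    ω.1 (elementary Λ A) = ∏ v ∈ Λ, ⟪ψ v, A v (ψ v)⟫_ℂ

/-- `ω' = 𝒫_Γ(f)(ω) = ω ∘ 𝔄_Γ(f)`, where `𝔄_Γ(f)` is the bounded linear map given on observables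
of a finite region `Λ` by `Ad(f_Λ^*)`, i.e. on elementary tensors by
`⨂ A v ↦ ⨂ f^* (A v) f`. -/
def IsPush {H K : FinHilb} (f : H →ₗᵢ[ℂ] K) (ω : PureState Γ H) (ω' : PureState Γ K) : Prop :=
  ∀ (Λ : Finset Γ) (A : Γ → (K →ₗ[ℂ] K)),
    ω'.1 (elementary Λ A) =
      ω.1 (elementary Λ fun v => LinearMap.adjoint f.toLinearMap ∘ₗ A v ∘ₗ f.toLinearMap)

/-- `σ = ω ⊗ τ = η(ω, τ)`, the product state on
`𝔄_Γ(H ⊗ K) ≅ 𝔄_Γ(H) ⊗ 𝔄_Γ(K)`. -/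
def IsTensor {H K : FinHilb} (ω : PureState Γ H) (τ : PureState Γ K)
    (σ : PureState Γ (H.tensor K)) : Prop :=
  ∀ (Λ : Finset Γ) (A : Γ → (H →ₗ[ℂ] H)) (B : Γ → (K →ₗ[ℂ] K)),
    σ.1 (elementary (H := H.tensor K) Λ fun v => TensorProduct.map (A v) (B v)) =
      ω.1 (elementary Λ A) * τ.1 (elementary Λ B)

end QuasiLocal

/-! ### Quantum state types -/

/-- A quantum state type on the lattice `Γ`: a subfunctor of `𝒫_Γ` containing all completely
factorized states, sending isometries to closed embeddings and closed under stacking. -/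
structure QuantumStateType (Γ : Type*) where
  /-- `𝒬_Γ(H) ⊆ 𝒫_Γ(H)` -/
  carrier (H : FinHilb) : Set (PureState Γ H)
  exists_factorized (H : FinHilb) (ψ : Γ → H) (hψ : ∀ v, ‖ψ v‖ = 1) :
    ∃ ω ∈ carrier H, IsFactorized ψ ω
  exists_push {H K : FinHilb} (f : H →ₗᵢ[ℂ] K) :
    ∃ F : carrier H → carrier K,
      (∀ ω : carrier H, IsPush f (ω : PureState Γ H) (F ω : PureState Γ K)) ∧ Topology.IsClosedEmbedding F
  exists_tensor {H K : FinHilb} (ω : carrier H) (τ : carrier K) :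
    ∃ σ ∈ carrier (H.tensor K), IsTensor (ω : PureState Γ H) (τ : PureState Γ K) σ

/-- A pair `(H, ψ)`: a Hilbert space of dimension at least two and a pure state of `H`,
represented by a unit vector. -/
structure VacuumModel where
  H : FinHilb
  two_le_finrank : 2 ≤ Module.finrank ℂ H
  u : H
  norm_u : ‖u‖ = 1

namespace VacuumModel

variable (m : VacuumModel)

/-- `u^{⊗ i}` -/
def vec : (i : ℕ) → m.H.tpow i
  | 0 => (1 : ℂ)
  | i + 1 => (vec i ⊗ₜ[ℂ] m.u : m.H.tpow i ⊗[ℂ] m.H)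

theorem norm_vec : ∀ i, ‖m.vec i‖ = 1
  | 0 => norm_one (α := ℂ)
  | i + 1 => by
    have h : ‖m.vec (i + 1)‖ = ‖m.vec i‖ * ‖m.u‖ :=
      TensorProduct.norm_tmul (𝕜 := ℂ) (m.vec i) m.u
    rw [h, norm_vec i, m.norm_u, one_mul]

/-- The isometry `Φ_i : H^{⊗ i} → H^{⊗ (i+1)}`, `x ↦ x ⊗ u`. -/
def Φ (i : ℕ) : m.H.tpow i →ₗᵢ[ℂ] m.H.tpow (i + 1) where
  toLinearMap := (TensorProduct.mk ℂ (m.H.tpow i) m.H).flip m.u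
  norm_map' x := by
    have h : ‖(x ⊗ₜ[ℂ] m.u : m.H.tpow i ⊗[ℂ] m.H)‖ = ‖x‖ * ‖m.u‖ :=
      TensorProduct.norm_tmul (𝕜 := ℂ) x m.u
    rw [m.norm_u, mul_one] at h
    exact h

end VacuumModel

namespace QuantumStateType

variable {Γ : Type*} (Q : QuantumStateType Γ) (m : VacuumModel)

/-- The space `𝒬_Γ^⊔(H) = ∐_i 𝒬_Γ(H^{⊗ i})`. -/
abbrev Systems : Type _ := Σ i : ℕ, Q.carrier (m.H.tpow i)

/-- The trivial system `ψ_i`: the completely factorized state with vector `u^{⊗ i}` at each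
site. -/
def trivialSystem (i : ℕ) : Q.Systems m :=
  ⟨i, (Q.exists_factorized (m.H.tpow i) (fun _ => m.vec i) (fun _ => m.norm_vec i)).choose,
    (Q.exists_factorized (m.H.tpow i) (fun _ => m.vec i) (fun _ => m.norm_vec i)).choose_spec.1⟩

/-- `y = x ⊗ ψ`, i.e. `y = 𝒬_Γ(Φ_i)(x)` for `x ∈ 𝒬_Γ(H^{⊗ i})`. -/
inductive Step : Q.Systems m → Q.Systems m → Prop
  | mk (i : ℕ) (ω : Q.carrier (m.H.tpow i)) (ω' : Q.carrier (m.H.tpow (i + 1)))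
      (h : IsPush (m.Φ i) (ω : PureState Γ (m.H.tpow i))
        (ω' : PureState Γ (m.H.tpow (i + 1)))) :
      Step ⟨i, ω⟩ ⟨i + 1, ω'⟩

/-- `z = x ⊗ y` in `𝒬_Γ^⊔(H)` (stacking), using `H^{⊗ i} ⊗ H^{⊗ j} ≅ H^{⊗ (i+j)}`. -/
inductive Stack : Q.Systems m → Q.Systems m → Q.Systems m → Prop
  | mk (i j : ℕ) (ω : Q.carrier (m.H.tpow i)) (τ : Q.carrier (m.H.tpow j))
      (σ : PureState Γ ((m.H.tpow i).tensor (m.H.tpow j)))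
      (ρ : Q.carrier (m.H.tpow (i + j)))
      (h₁ : IsTensor (ω : PureState Γ (m.H.tpow i)) (τ : PureState Γ (m.H.tpow j)) σ)
      (h₂ : IsPush (m.H.concat i j) σ (ρ : PureState Γ (m.H.tpow (i + j)))) :
      Stack ⟨i, ω⟩ ⟨j, τ⟩ ⟨i + j, ρ⟩

/-- The space `𝒬_Γ(H^{⊗ ∞}) = colim_i 𝒬_Γ(H^{⊗ i})` along the maps `𝒬_Γ(Φ_i)`, with the
colimit topology. -/
def Stable : Type _ := Quot (Q.Step m)

instance : TopologicalSpace (Q.Stable m) :=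
  inferInstanceAs (TopologicalSpace (Quot (Q.Step m)))

/-- The map `ȷ : 𝒬_Γ^⊔(H) → 𝒬_Γ(H^{⊗ ∞})`. -/
def j : C(Q.Systems m, Q.Stable m) := ⟨Quot.mk _, continuous_quot_mk⟩

/-- The product of the `H`-space `𝒬_Γ(H^{⊗ ∞})`: `z = 𝒬_Γ(φ)(x ⊗ y)`, where
`φ : H^{⊗ ∞} ⊗ H^{⊗ ∞} → H^{⊗ ∞}` is the interleaving isometry. -/
inductive StableMul : Q.Stable m → Q.Stable m → Q.Stable m → Prop
  | mk (n : ℕ) (ω τ : Q.carrier (m.H.tpow n))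
      (σ : PureState Γ ((m.H.tpow n).tensor (m.H.tpow n)))
      (ρ : Q.carrier (m.H.tpow (2 * n)))
      (h₁ : IsTensor (ω : PureState Γ (m.H.tpow n)) (τ : PureState Γ (m.H.tpow n)) σ)
      (h₂ : IsPush (m.H.interleave n) σ (ρ : PureState Γ (m.H.tpow (2 * n)))) :
      StableMul (Q.j m ⟨n, ω⟩) (Q.j m ⟨n, τ⟩) (Q.j m ⟨2 * n, ρ⟩)

/-- The base point of `𝒬_Γ(H^{⊗ ∞})`. -/
def stableBase : Q.Stable m := Q.j m (Q.trivialSystem m 0)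

/-- A quantum state type is invertible if, for every choice of `(H, ψ)`, the monoid
`π₀ 𝒬_Γ(H^{⊗ ∞})` is a group. -/
def Invertible : Prop :=
  ∀ m : VacuumModel, ∀ x : Q.Stable m, ∃ y z z' : Q.Stable m,
    Q.StableMul m x y z ∧ Joined z (Q.stableBase m) ∧
    Q.StableMul m y x z' ∧ Joined z' (Q.stableBase m)

/-- One step of the diagram `𝒬_Γ^⊔(H) → 𝒬_Γ^⊔(H) → ⋯` with all maps `x ↦ x ⊗ ψ`. -/
inductive LocStep : (Σ _ : ℕ, Q.Systems m) → (Σ _ : ℕ, Q.Systems m) → Prop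
  | mk (k : ℕ) (x y : Q.Systems m) (h : Q.Step m x y) : LocStep ⟨k, x⟩ ⟨k + 1, y⟩

/-- The localization `ψ⁻¹𝒬_Γ^⊔(H)`: the colimit of
`𝒬_Γ^⊔(H) → 𝒬_Γ^⊔(H) → 𝒬_Γ^⊔(H) → ⋯` along `x ↦ x ⊗ ψ`. -/
def Localized : Type _ := Quot (Q.LocStep m)

instance : TopologicalSpace (Q.Localized m) :=
  inferInstanceAs (TopologicalSpace (Quot (Q.LocStep m)))

/-- The inclusion `ι_k` of the `k`-th term of the diagram. -/
def ι (k : ℕ) : C(Q.Systems m, Q.Localized m) :=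
  ⟨fun x => Quot.mk _ ⟨k, x⟩, continuous_quot_mk.comp continuous_sigmaMk⟩

/-- The map `ψ⁻¹ȷ : ψ⁻¹𝒬_Γ^⊔(H) → 𝒬_Γ(H^{⊗ ∞})`, with `ψ⁻¹ȷ ∘ ι_ℓ = ȷ`. -/
def locJ : C(Q.Localized m, Q.Stable m) where
  toFun := Quot.lift (fun p => Q.j m p.2) (by
    rintro _ _ ⟨k, x, y, h⟩
    exact Quot.sound h)
  continuous_toFun := continuous_quot_lift _
    (continuous_sigma fun _ => (Q.j m).continuous)

/-- The map `ψ⁻¹c : ψ⁻¹𝒬_Γ^⊔(H) → ℤ`, with `ψ⁻¹c (ι_ℓ ω) = k - ℓ` for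
`ω ∈ 𝒬_Γ(H^{⊗ k})`. -/
def locC : C(Q.Localized m, ℤ) where
  toFun := Quot.lift (fun p => (p.2.1 : ℤ) - (p.1 : ℤ)) (by
    rintro _ _ ⟨k, x, y, ⟨i, ω, ω', h⟩⟩
    push_cast
    ring)
  continuous_toFun := continuous_quot_lift _
    (continuous_sigma fun k => continuous_sigma fun i =>
      (continuous_const : Continuous fun _ : Q.carrier (m.H.tpow i) => (i : ℤ) - (k : ℤ)))

end QuantumStateType

/-! ### Parameter spaces and homotopy classes -/

/-- A parameter space: a compact Hausdorff space homotopy equivalent to a CW complex. -/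
def IsParameterSpace.{p} (X : Type p) [TopologicalSpace X] : Prop :=
  CompactSpace X ∧ T2Space X ∧
    ∃ (Z : Type p) (_ : TopologicalSpace Z) (_ : T2Space Z)
      (_ : Topology.CWComplex (Set.univ : Set Z)),
      Nonempty (ContinuousMap.HomotopyEquiv X Z)

section HomotopyClasses

variable (X : Type*) [TopologicalSpace X]

/-- The setoid of (free) homotopy of maps `X → Y`. -/
def homotopySetoid (Y : Type*) [TopologicalSpace Y] : Setoid C(X, Y) :=
  ⟨ContinuousMap.Homotopic, ContinuousMap.Homotopic.equivalence⟩

/-- The set `[X, Y]` of (free) homotopy classes of maps. -/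
def HtpyClasses (Y : Type*) [TopologicalSpace Y] : Type _ := Quotient (homotopySetoid X Y)

variable {X}
variable {Y Z : Type*} [TopologicalSpace Y] [TopologicalSpace Z]

/-- The homotopy class of a map. -/
def HtpyClasses.mk (f : C(X, Y)) : HtpyClasses X Y := Quotient.mk (homotopySetoid X Y) f

/-- `[X, g] : [X, Y] → [X, Z]`. -/
def HtpyClasses.map (g : C(Y, Z)) : HtpyClasses X Y → HtpyClasses X Z :=
  Quotient.lift (fun f => HtpyClasses.mk (g.comp f)) fun _ _ h =>
    Quotient.sound (ContinuousMap.Homotopic.comp (ContinuousMap.Homotopic.refl g) h)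

/-- The monoid structure on `[X, Y]` is the one induced by pointwise multiplication, where
`R a b c` says that `c` is the product of `a` and `b` in `Y`, and `e` is the unit of `Y`. -/
def IsPointwise (R : Y → Y → Y → Prop) (e : Y) (i : AddCommMonoid (HtpyClasses X Y)) : Prop :=
  (∀ f g : C(X, Y), ∃ h : C(X, Y), (∀ x, R (f x) (g x) (h x)) ∧
      i.add (HtpyClasses.mk f) (HtpyClasses.mk g) = HtpyClasses.mk h) ∧
    i.zero = HtpyClasses.mk (ContinuousMap.const X e)

end HomotopyClasses

/-- `g : M → L` is the Grothendieck group completion of the commutative monoid `M`: every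
morphism from `M` to an abelian group factors uniquely through `g`. -/
def IsGroupCompletion.{p, a, b} {M : Type a} {L : Type b} [AddCommMonoid M] [AddCommGroup L]
    (g : M →+ L) : Prop :=
  ∀ (A : Type p) [AddCommGroup A] (φ : M →+ A), ∃! Φ : L →+ A, Φ.comp g = φ

/-- The structure on `[X, ψ⁻¹𝒬_Γ^⊔(H)]` is that of the localization
`ψ⁻¹[X, 𝒬_Γ^⊔(H)] = colim ([X, 𝒬_Γ^⊔(H)] → [X, 𝒬_Γ^⊔(H)] → ⋯)` (all maps being addition of the
class of the constant map `ψ`), under the bijection induced by the maps `[X, ι_k]`. -/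
def QuantumStateType.IsLocalizationStructure {Γ : Type*} (Q : QuantumStateType Γ)
    (m : VacuumModel) (X : Type*) [TopologicalSpace X]
    [AddCommMonoid (HtpyClasses X (Q.Systems m))]
    [AddCommGroup (HtpyClasses X (Q.Localized m))] : Prop :=
  let ψ : HtpyClasses X (Q.Systems m) :=
    HtpyClasses.mk (ContinuousMap.const X (Q.trivialSystem m 1))
  (∀ z : HtpyClasses X (Q.Localized m), ∃ k a, HtpyClasses.map (Q.ι m k) a = z) ∧
  (∀ (k l : ℕ) (a b : HtpyClasses X (Q.Systems m)),
    HtpyClasses.map (Q.ι m k) a = HtpyClasses.map (Q.ι m l) b ↔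
      ∃ n : ℕ, a + (l + n) • ψ = b + (k + n) • ψ) ∧
  (∀ (k l : ℕ) (a b : HtpyClasses X (Q.Systems m)),
    HtpyClasses.map (Q.ι m k) a + HtpyClasses.map (Q.ι m l) b =
      HtpyClasses.map (Q.ι m (k + l)) (a + b))

end

/-! The geometric input is that the map of states induced by an isometry depends, up to homotopy,
only on source and target. Two isometries f, g into a finite-dimensional space K satisfy u f = g for
a unitary u. Multiplying u by a phase, invisible to states, moves −1 off its finite spectrum; then u
has a logarithm, and f is joined to a multiple of g by a path of isometries
(`LinearIsometry.exists_path`). A vector on which f and g agree moves only by phases, so its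
factorized state stays fixed (`exists_homotopy_push`). Elementary tensors span a dense subspace of
the quasi-local algebra and states have norm at most one, so equality and continuity of states are
tested on elementary tensors. Hence stacking is continuous, and each monoid law compares the pushes
of one stacked state along two isometries.

The second input is compactness. In a sequential colimit of T1 spaces along closed embeddings, a map
from a compact space factors through a finite stage (`exists_lift_quot_of_compact`), and so does a
homotopy. Sums in [X, 𝒬(H^∞)] can therefore be computed at any stage and through any isometry
(`stackVia_homotopic`), and equality in [X, ψ⁻¹𝒬^⊔] is equality after finitely many stackings with ψ
(`ι_homotopic_iff`).

The third input is the existence of inverses in [X, 𝒬(H^∞)]. For a point this is invertibility of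
π₀. A compact X homotopy equivalent to a CW complex is dominated by a finite subcomplex, so one
inducts on cells: attaching a cell covers the space by a part deforming into the old subcomplex and
a contractible part, overlapping in a collar. Inverses of α over the two parts are homotopic on the
collar, being unique there, and glue to a class z (`exists_glue_of_homotopic`). Then α + z is
trivial on both parts, so it comes from a family of based loops over the collar
(`exists_homotopic_isLoopMap`), and such a class is inverted by reversing the loops
(`loopMap_mul_symm_homotopic`).

Finally, a point of ψ⁻¹𝒬^⊔ is determined by its stable class and its integer, and over compact X
every pair of a stable family and an integer function is realized. So [X, ψ⁻¹ȷ] × [X, ψ⁻¹c] is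
bijective (`bijective_locMap`). It is additive on the classes coming from the ι_k, so the group
structure of the product transports to the localization. A localization at ψ that is a group is
formally the group completion. -/

noncomputable section

/-! ### Elementary tensors: matrix entries, products, adjoints and density of their span. -/

section ElementaryOperators

variable {Γ : Type*} {H : FinHilb}

theorem overwrite_apply_mem (Λ : Finset Γ) (s : Config Γ H) (t : Λ → SpinIndex H) {v : Γ}
    (hv : v ∈ Λ) : overwrite Λ s t v = t ⟨v, hv⟩ := by
  simp [overwrite, hv]

theorem overwrite_apply_notMem (Λ : Finset Γ) (s : Config Γ H) (t : Λ → SpinIndex H) {v : Γ}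
    (hv : v ∉ Λ) : overwrite Λ s t v = s v := by
  simp [overwrite, hv]

theorem restrictConfig_overwrite (Λ : Finset Γ) (s : Config Γ H) (t : Λ → SpinIndex H) :
    restrictConfig Λ (overwrite Λ s t) = t := by
  funext v
  exact overwrite_apply_mem Λ s t v.2

theorem overwrite_overwrite (Λ : Finset Γ) (s : Config Γ H) (t t' : Λ → SpinIndex H) :
    overwrite Λ (overwrite Λ s t) t' = overwrite Λ s t' := by
  funext v
  by_cases hv : v ∈ Λ
  · simp [overwrite_apply_mem, hv]
  · simp [overwrite_apply_notMem, hv]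

theorem overwrite_restrictConfig (Λ : Finset Γ) (s : Config Γ H) :
    overwrite Λ s (restrictConfig Λ s) = s := by
  funext v
  by_cases hv : v ∈ Λ
  · simp [overwrite_apply_mem, hv, restrictConfig]
  · simp [overwrite_apply_notMem, hv]

open Classical in
theorem matrixUnitOp_apply (Λ : Finset Γ) (r t : Λ → SpinIndex H) (ξ : ConfigSpace Γ H)
    (s : Config Γ H) :
    matrixUnitOp Λ r t ξ s = if restrictConfig Λ s = r then ξ (overwrite Λ s t) else 0 := rfl

theorem lp_two_sum_apply {ι κ : Type*} (S : Finset ι) (f : ι → lp (fun _ : κ => ℂ) 2) (s : κ) :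
    (∑ i ∈ S, f i) s = ∑ i ∈ S, f i s := by
  rw [lp.coeFn_sum, Finset.sum_apply]

open Classical in
theorem elementaryOp_eq (Λ : Finset Γ) (A : Γ → (H →ₗ[ℂ] H)) :
    elementaryOp Λ A = ∑ r : Λ → SpinIndex H, ∑ t : Λ → SpinIndex H,
      (∏ v : Λ, ⟪stdOrthonormalBasis ℂ H (r v), A v (stdOrthonormalBasis ℂ H (t v))⟫_ℂ) •
        matrixUnitOp Λ r t := rfl

open Classical in
theorem elementaryOp_apply (Λ : Finset Γ) (A : Γ → (H →ₗ[ℂ] H)) (ξ : ConfigSpace Γ H)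
    (s : Config Γ H) :
    elementaryOp Λ A ξ s = ∑ t : Λ → SpinIndex H,
      (∏ v : Λ, ⟪stdOrthonormalBasis ℂ H (s v), A v (stdOrthonormalBasis ℂ H (t v))⟫_ℂ) *
        ξ (overwrite Λ s t) := by
  rw [elementaryOp_eq]
  simp only [sum_apply, smul_apply, lp_two_sum_apply,
    lp.coeFn_smul, Pi.smul_apply, matrixUnitOp_apply, smul_eq_mul, mul_ite, mul_zero]
  rw [Finset.sum_comm]
  refine Finset.sum_congr rfl fun t _ => ?_
  rw [Finset.sum_ite_eq]
  simp [restrictConfig]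

theorem elementaryOp_congr {Λ : Finset Γ} {A B : Γ → (H →ₗ[ℂ] H)} (h : ∀ v ∈ Λ, A v = B v) :
    elementaryOp Λ A = elementaryOp Λ B := by
  classical
  rw [elementaryOp_eq, elementaryOp_eq]
  refine Finset.sum_congr rfl fun r _ => Finset.sum_congr rfl fun t _ => ?_
  congr 1
  exact Finset.prod_congr rfl fun v _ => by rw [h v v.2]

theorem sum_inner_mul_inner_basis (A B : H →ₗ[ℂ] H) (x y : H) :
    ∑ k, ⟪x, A (stdOrthonormalBasis ℂ H k)⟫_ℂ * ⟪stdOrthonormalBasis ℂ H k, B y⟫_ℂ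
      = ⟪x, A (B y)⟫_ℂ := by
  have h := (stdOrthonormalBasis ℂ H).sum_inner_mul_inner (LinearMap.adjoint A x) (B y)
  rw [LinearMap.adjoint_inner_left] at h
  rw [← h]
  exact Finset.sum_congr rfl fun k _ => by rw [LinearMap.adjoint_inner_left]

/-- Insert a resolution of the identity at each site; the resulting product over sites of sums over
the basis expands to a sum over configurations of `Λ`. -/
theorem elementaryOp_mul (Λ : Finset Γ) (A B : Γ → (H →ₗ[ℂ] H)) :
    elementaryOp Λ A * elementaryOp Λ B = elementaryOp Λ fun v => A v ∘ₗ B v := by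
  classical
  refine ContinuousLinearMap.ext fun ξ => lp.ext (funext fun s => ?_)
  rw [mul_apply_eq_comp, elementaryOp_apply]
  simp only [elementaryOp_apply, overwrite_overwrite, Finset.mul_sum]
  rw [Finset.sum_comm]
  refine Finset.sum_congr rfl fun t' _ => ?_
  simp only [← mul_assoc]
  rw [← Finset.sum_mul]
  congr 1
  have h : ∀ v : Λ, ⟪stdOrthonormalBasis ℂ H (s v),
      (A v ∘ₗ B v) (stdOrthonormalBasis ℂ H (t' v))⟫_ℂ =
      ∑ k, ⟪stdOrthonormalBasis ℂ H (s v), A v (stdOrthonormalBasis ℂ H k)⟫_ℂ *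
        ⟪stdOrthonormalBasis ℂ H k, B v (stdOrthonormalBasis ℂ H (t' v))⟫_ℂ := fun v => by
    rw [sum_inner_mul_inner_basis]; rfl
  simp only [h]
  rw [Finset.prod_univ_sum, Fintype.piFinset_univ]
  refine Finset.sum_congr rfl fun t _ => ?_
  rw [← Finset.prod_mul_distrib]
  refine Finset.prod_congr rfl fun v _ => ?_
  rw [overwrite_apply_mem Λ s t v.2]

/-- At a site of `Λ'` outside `Λ` the identity contributes a Kronecker delta, so the only surviving
configurations of `Λ'` agree with `s` off `Λ`, and these are indexed by the configurations of `Λ`.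
-/
theorem elementaryOp_subset {Λ Λ' : Finset Γ} (hΛ : Λ ⊆ Λ') (A : Γ → (H →ₗ[ℂ] H))
    (hA : ∀ v ∈ Λ', v ∉ Λ → A v = LinearMap.id) : elementaryOp Λ A = elementaryOp Λ' A := by
  classical
  refine ContinuousLinearMap.ext fun ξ => lp.ext (funext fun s => ?_)
  rw [elementaryOp_apply, elementaryOp_apply]
  refine Finset.sum_of_injOn (fun t => restrictConfig Λ' (overwrite Λ s t)) ?_
    (fun _ _ => Finset.mem_coe.2 (Finset.mem_univ _)) ?_ ?_
  · intro t _ t' _ h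
    funext v
    have := congrFun h ⟨v, hΛ v.2⟩
    simpa [restrictConfig, overwrite_apply_mem] using this
  · intro t' _ ht'
    by_contra hne
    apply ht'
    refine ⟨fun v => t' ⟨v, hΛ v.2⟩, Finset.mem_coe.2 (Finset.mem_univ _), ?_⟩
    funext v
    by_cases hv : (v : Γ) ∈ Λ
    · simp [restrictConfig, overwrite_apply_mem, hv]
    · simp only [restrictConfig, overwrite_apply_notMem _ _ _ hv]
      by_contra hne'
      apply hne
      rw [Finset.prod_eq_zero (Finset.mem_univ v), zero_mul]
      rw [hA v v.2 hv, LinearMap.id_apply, (stdOrthonormalBasis ℂ H).inner_eq_zero hne']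
  · intro t _
    have h1 : overwrite Λ' s (restrictConfig Λ' (overwrite Λ s t)) = overwrite Λ s t := by
      funext v
      by_cases hv : v ∈ Λ'
      · rw [overwrite_apply_mem _ _ _ hv]; rfl
      · rw [overwrite_apply_notMem _ _ _ hv, overwrite_apply_notMem _ _ _ fun h => hv (hΛ h)]
    rw [h1]
    congr 1
    set F : Γ → ℂ := fun v => ⟪stdOrthonormalBasis ℂ H (s v),
      A v (stdOrthonormalBasis ℂ H (overwrite Λ s t v))⟫_ℂ with hF
    have h2 : ∏ v : Λ, ⟪stdOrthonormalBasis ℂ H (s v),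
        A v (stdOrthonormalBasis ℂ H (t v))⟫_ℂ = ∏ v : Λ, F v :=
      Finset.prod_congr rfl fun v _ => by rw [hF]; simp only [overwrite_apply_mem Λ s t v.2]
    rw [h2, Finset.prod_coe_sort Λ F]
    refine (Finset.prod_subset hΛ fun v hv hv' => ?_).trans (Finset.prod_coe_sort Λ' F).symm
    rw [hF]
    simp only [hA v hv hv', overwrite_apply_notMem _ _ _ hv', LinearMap.id_apply]
    rw [inner_self_eq_norm_sq_to_K, (stdOrthonormalBasis ℂ H).norm_eq_one]
    simp

open Classical in
/-- Exchange the configurations `r` and `t` inside the region `Λ`. -/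
def swapConfig (Λ : Finset Γ) (r t : Λ → SpinIndex H) (s : Config Γ H) : Config Γ H :=
  if restrictConfig Λ s = r then overwrite Λ s t
  else if restrictConfig Λ s = t then overwrite Λ s r else s

theorem swapConfig_involutive (Λ : Finset Γ) (r t : Λ → SpinIndex H) :
    Function.Involutive (swapConfig Λ r t) := by
  intro s
  unfold swapConfig
  by_cases h1 : restrictConfig Λ s = r
  · subst h1
    simp only [if_true, restrictConfig_overwrite, overwrite_overwrite, overwrite_restrictConfig]
    split_ifs with h
    · rw [h, overwrite_restrictConfig]
    · rfl
  · by_cases h2 : restrictConfig Λ s = t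
    · subst h2
      simp only [h1, if_false, if_true, restrictConfig_overwrite, overwrite_overwrite,
        overwrite_restrictConfig]
    · simp [h1, h2]

/-- One inner product is supported where `s` restricts to `t`, the other where it restricts to `r`.
The involution `swapConfig` exchanges the two supports, and after reindexing by it the sums agree
term by term. -/
theorem star_matrixUnitOp (Λ : Finset Γ) (r t : Λ → SpinIndex H) :
    star (matrixUnitOp (Γ := Γ) Λ r t) = matrixUnitOp Λ t r := by
  classical
  rw [ContinuousLinearMap.star_eq_adjoint]
  refine ((ContinuousLinearMap.eq_adjoint_iff _ _).2 fun ξ ζ => ?_).symm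
  rw [lp.inner_eq_tsum, lp.inner_eq_tsum,
    ← (swapConfig_involutive Λ r t).toPerm.tsum_eq]
  refine tsum_congr fun s => ?_
  simp only [Function.Involutive.coe_toPerm, matrixUnitOp_apply]
  by_cases h1 : restrictConfig Λ s = r
  · have : swapConfig Λ r t s = overwrite Λ s t := by simp [swapConfig, h1]
    rw [this]
    subst h1
    simp [restrictConfig_overwrite, overwrite_overwrite, overwrite_restrictConfig]
  · have : restrictConfig Λ (swapConfig Λ r t s) ≠ t := by
      unfold swapConfig
      by_cases h2 : restrictConfig Λ s = t
      · subst h2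
        simp only [h1, if_false, if_true, restrictConfig_overwrite]
        exact fun h => h1 h.symm
      · simp [h1, h2]
    simp [this, h1]

theorem star_elementaryOp (Λ : Finset Γ) (A : Γ → (H →ₗ[ℂ] H)) :
    star (elementaryOp Λ A) = elementaryOp Λ fun v => LinearMap.adjoint (A v) := by
  classical
  rw [elementaryOp_eq, elementaryOp_eq, star_sum]
  simp only [star_sum, star_smul, star_matrixUnitOp]
  rw [Finset.sum_comm]
  refine Finset.sum_congr rfl fun r _ => Finset.sum_congr rfl fun t _ => ?_
  congr 1
  rw [star_prod]
  refine Finset.prod_congr rfl fun v _ => ?_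
  rw [LinearMap.adjoint_inner_right, ← starRingEnd_apply, inner_conj_symm]

theorem elementaryOp_empty (A : Γ → (H →ₗ[ℂ] H)) : elementaryOp (∅ : Finset Γ) A = 1 := by
  classical
  refine ContinuousLinearMap.ext fun ξ => lp.ext (funext fun s => ?_)
  rw [elementaryOp_apply]
  have : ∀ t, overwrite (∅ : Finset Γ) s t = s := fun t =>
    funext fun v => overwrite_apply_notMem _ _ _ (Finset.notMem_empty v)
  simp [this]

theorem exists_elementaryOp_mul (Λ Λ' : Finset Γ) (A B : Γ → (H →ₗ[ℂ] H)) :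
    ∃ (Λ'' : Finset Γ) (C : Γ → (H →ₗ[ℂ] H)),
      elementaryOp Λ A * elementaryOp Λ' B = elementaryOp Λ'' C := by
  classical
  let A' : Γ → (H →ₗ[ℂ] H) := fun v => if v ∈ Λ then A v else LinearMap.id
  let B' : Γ → (H →ₗ[ℂ] H) := fun v => if v ∈ Λ' then B v else LinearMap.id
  refine ⟨Λ ∪ Λ', fun v => A' v ∘ₗ B' v, ?_⟩
  rw [← elementaryOp_mul,
    elementaryOp_congr (B := A') (fun v hv => by simp [A', hv]),
    elementaryOp_congr (A := B) (B := B') (fun v hv => by simp [B', hv]),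
    elementaryOp_subset Finset.subset_union_left A' (fun v _ hv => by simp [A', hv]),
    elementaryOp_subset Finset.subset_union_right B' (fun v _ hv => by simp [B', hv])]

/-- Products and adjoints of elementary tensors are again elementary tensors, and the unit is the
one over the empty region. The linear span is therefore already closed under the star-algebra
operations. -/
theorem adjoin_elementaryOp_le_span (T : ConfigSpace Γ H →L[ℂ] ConfigSpace Γ H)
    (hT : T ∈ StarAlgebra.adjoin ℂ
      {T | ∃ (Λ : Finset Γ) (A : Γ → (H →ₗ[ℂ] H)), T = elementaryOp Λ A}) :
    T ∈ Submodule.span ℂ {T : ConfigSpace Γ H →L[ℂ] ConfigSpace Γ H |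
      ∃ (Λ : Finset Γ) (A : Γ → (H →ₗ[ℂ] H)), T = elementaryOp Λ A} := by
  set S := {T : ConfigSpace Γ H →L[ℂ] ConfigSpace Γ H |
      ∃ (Λ : Finset Γ) (A : Γ → (H →ₗ[ℂ] H)), T = elementaryOp Λ A} with hS
  have hmul : ∀ x ∈ Submodule.span ℂ S, ∀ y ∈ Submodule.span ℂ S,
      x * y ∈ Submodule.span ℂ S := by
    intro x hx y hy
    refine Submodule.span_induction (p := fun x _ => x * y ∈ Submodule.span ℂ S) ?_ ?_ ?_ ?_ hx
    · rintro _ ⟨Λ, A, rfl⟩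
      refine Submodule.span_induction
        (p := fun y _ => elementaryOp Λ A * y ∈ Submodule.span ℂ S) ?_ ?_ ?_ ?_ hy
      · rintro _ ⟨Λ', B, rfl⟩
        obtain ⟨Λ'', C, h⟩ := exists_elementaryOp_mul Λ Λ' A B
        exact Submodule.subset_span ⟨Λ'', C, h⟩
      · simp
      · intro a b _ _ ha hb
        rw [mul_add]
        exact add_mem ha hb
      · intro c a _ ha
        rw [mul_smul_comm]
        exact Submodule.smul_mem _ _ ha
    · simp
    · intro a b _ _ ha hb
      rw [add_mul]
      exact add_mem ha hb
    · intro c a _ ha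
      rw [smul_mul_assoc]
      exact Submodule.smul_mem _ _ ha
  have hone : (1 : ConfigSpace Γ H →L[ℂ] ConfigSpace Γ H) ∈ Submodule.span ℂ S :=
    Submodule.subset_span ⟨∅, fun _ => LinearMap.id, (elementaryOp_empty _).symm⟩
  refine StarAlgebra.adjoin_induction (p := fun x _ => x ∈ Submodule.span ℂ S)
    (fun x hx => Submodule.subset_span hx) (fun r => ?_)
    (fun x y _ _ hx hy => add_mem hx hy) (fun x y _ _ hx hy => hmul x hx y hy)
    (fun x _ hx => ?_) hT
  · rw [Algebra.algebraMap_eq_smul_one]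
    exact Submodule.smul_mem _ _ hone
  · refine Submodule.span_induction (p := fun x _ => star x ∈ Submodule.span ℂ S) ?_ ?_ ?_ ?_ hx
    · rintro _ ⟨Λ, A, rfl⟩
      exact Submodule.subset_span ⟨Λ, _, star_elementaryOp Λ A⟩
    · simp
    · intro a b _ _ ha hb
      rw [star_add]
      exact add_mem ha hb
    · intro c a _ ha
      rw [star_smul]
      exact Submodule.smul_mem _ _ ha

theorem dense_span_elementary :
    Dense (Submodule.span ℂ {a : QuasiLocalAlgebra Γ H |
      ∃ (Λ : Finset Γ) (A : Γ → (H →ₗ[ℂ] H)), a = elementary Λ A} : Set (QuasiLocalAlgebra Γ H)) := by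
  intro a
  rw [Topology.IsEmbedding.subtypeVal.closure_eq_preimage_closure_image, Set.mem_preimage]
  have ha : (a : ConfigSpace Γ H →L[ℂ] ConfigSpace Γ H) ∈ closure
      (StarAlgebra.adjoin ℂ {T | ∃ (Λ : Finset Γ) (A : Γ → (H →ₗ[ℂ] H)), T = elementaryOp Λ A} :
        Set (ConfigSpace Γ H →L[ℂ] ConfigSpace Γ H)) := a.2
  refine closure_mono ?_ ha
  intro T hT
  have h := adjoin_elementaryOp_le_span T hT
  refine Submodule.span_induction (p := fun x _ => x ∈ Subtype.val '' (Submodule.span ℂ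
    {a : QuasiLocalAlgebra Γ H | ∃ (Λ : Finset Γ) (A : Γ → (H →ₗ[ℂ] H)), a = elementary Λ A} :
      Set (QuasiLocalAlgebra Γ H))) ?_ ?_ ?_ ?_ h
  · rintro _ ⟨Λ, A, rfl⟩
    exact ⟨elementary Λ A, Submodule.subset_span ⟨Λ, A, rfl⟩, rfl⟩
  · exact ⟨0, zero_mem _, rfl⟩
  · rintro _ _ _ _ ⟨x, hx, rfl⟩ ⟨y, hy, rfl⟩
    exact ⟨x + y, add_mem hx hy, rfl⟩
  · rintro c _ _ ⟨x, hx, rfl⟩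
    exact ⟨c • x, Submodule.smul_mem _ _ hx, rfl⟩

end ElementaryOperators

/-! ### Norm bound for states; testing equality and continuity on elementary tensors. -/

section StateBounds

open scoped CStarAlgebra in
-- Cauchy–Schwarz for the GNS inner product of `f`, applied to `1` and `a`, together with f(a*a) ≤
-- ‖a*a‖ = ‖a‖².
theorem norm_apply_le_of_positive {A : Type*} [CStarAlgebra A] (f : A →ₗ[ℂ] ℂ) (h1 : f 1 = 1)
    (hf : ∀ a, 0 ≤ f (star a * a)) (a : A) : ‖f a‖ ≤ ‖a‖ := by
  let _ := CStarAlgebra.spectralOrder A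
  have _ := CStarAlgebra.spectralOrderedRing A
  let g : A →ₚ[ℂ] ℂ := PositiveLinearMap.mk₀ f fun x hx => by
    obtain ⟨b, rfl⟩ := CStarAlgebra.nonneg_iff_eq_star_mul_self.1 hx
    exact hf b
  have hg : ∀ x, g x = f x := fun _ => rfl
  have h2 := norm_inner_le_norm (𝕜 := ℂ) (g.toPreGNS 1) (g.toPreGNS a)
  rw [PositiveLinearMap.preGNS_inner_def] at h2
  simp only [PositiveLinearMap.ofPreGNS_toPreGNS, star_one, one_mul, hg] at h2
  have h3 : ‖g.toPreGNS 1‖ = 1 := by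
    rw [PositiveLinearMap.preGNS_norm_def]
    simp [hg, h1]
  have h4 : ‖g.toPreGNS a‖ ≤ ‖a‖ := by
    rw [PositiveLinearMap.preGNS_norm_def]
    simp only [PositiveLinearMap.ofPreGNS_toPreGNS]
    refine Real.sqrt_le_iff.2 ⟨norm_nonneg _, ?_⟩
    have h5 := PositiveLinearMap.norm_apply_le_of_nonneg g (star a * a) (star_mul_self_nonneg a)
    rw [hg 1, h1, norm_one, one_mul, CStarRing.norm_star_mul_self, ← sq] at h5
    exact (Complex.re_le_norm _).trans h5
  rw [h3, one_mul] at h2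
  exact h2.trans h4

variable {Γ : Type*} {H K : FinHilb}

theorem PureState.norm_apply_le (ω : PureState Γ H) (a : QuasiLocalAlgebra Γ H) :
    ‖ω.1 a‖ ≤ ‖a‖ :=
  @norm_apply_le_of_positive (QuasiLocalAlgebra Γ H)
    (StarSubalgebra.cstarAlgebra (h_closed := StarSubalgebra.isClosed_topologicalClosure _) _)
    (ω.1 : _ →L[ℂ] ℂ).toLinearMap ω.2.1.1 ω.2.1.2 a

theorem PureState.map_add (ω : PureState Γ H) (a b : QuasiLocalAlgebra Γ H) :
    ω.1 (a + b) = ω.1 a + ω.1 b :=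
  (ω.1 : _ →L[ℂ] ℂ).toLinearMap.map_add a b

theorem PureState.map_smul (ω : PureState Γ H) (c : ℂ) (a : QuasiLocalAlgebra Γ H) :
    ω.1 (c • a) = c * ω.1 a :=
  (ω.1 : _ →L[ℂ] ℂ).toLinearMap.map_smul c a

theorem PureState.map_zero (ω : PureState Γ H) : ω.1 (0 : QuasiLocalAlgebra Γ H) = 0 :=
  (ω.1 : _ →L[ℂ] ℂ).toLinearMap.map_zero

theorem PureState.map_sum (ω : PureState Γ H) {ι : Type*} (s : Finset ι)
    (a : ι → QuasiLocalAlgebra Γ H) : ω.1 (∑ i ∈ s, a i) = ∑ i ∈ s, ω.1 (a i) :=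
  _root_.map_sum (ω.1 : _ →L[ℂ] ℂ).toLinearMap a s

theorem PureState.ext_elementary {ω τ : PureState Γ H}
    (h : ∀ (Λ : Finset Γ) (A : Γ → (H →ₗ[ℂ] H)), ω.1 (elementary Λ A) = τ.1 (elementary Λ A)) :
    ω = τ := by
  refine Subtype.ext (DFunLike.ext _ _ fun a => ?_)
  have hc : IsClosed {a : QuasiLocalAlgebra Γ H | ω.1 a = τ.1 a} :=
    isClosed_eq (ω.1 : _ →L[ℂ] ℂ).continuous (τ.1 : _ →L[ℂ] ℂ).continuous
  refine hc.closure_subset_iff.2 ?_ (dense_span_elementary a)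
  intro b hb
  refine Submodule.span_induction (p := fun b _ => ω.1 b = τ.1 b) ?_ ?_ ?_ ?_ hb
  · rintro _ ⟨Λ, A, rfl⟩
    exact h Λ A
  · rw [PureState.map_zero, PureState.map_zero]
  · intro x y _ _ hx hy
    exact (ω.map_add x y).trans ((congrArg₂ (· + ·) hx hy).trans (τ.map_add x y).symm)
  · intro c x _ hx
    exact (ω.map_smul c x).trans ((congrArg (c * ·) hx).trans (τ.map_smul c x).symm)

/-- States have norm at most one, so evaluation at an arbitrary `a` is a limit, uniform in the
parameter, of evaluations at elements of the dense span. -/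
theorem PureState.continuous_of_elementary {X : Type*} [TopologicalSpace X]
    {f : X → PureState Γ H}
    (h : ∀ (Λ : Finset Γ) (A : Γ → (H →ₗ[ℂ] H)),
      Continuous fun x => (f x).1 (elementary Λ A)) : Continuous f := by
  refine Continuous.subtype_mk (WeakDual.continuous_of_continuous_eval fun a => ?_) _
  have hspan : ∀ b ∈ Submodule.span ℂ {a : QuasiLocalAlgebra Γ H |
      ∃ (Λ : Finset Γ) (A : Γ → (H →ₗ[ℂ] H)), a = elementary Λ A},
      Continuous fun x => (f x).1 b := by
    intro b hb
    refine Submodule.span_induction (p := fun b _ => Continuous fun x => (f x).1 b) ?_ ?_ ?_ ?_ hb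
    · rintro _ ⟨Λ, A, rfl⟩
      exact h Λ A
    · simp only [PureState.map_zero]
      exact continuous_const
    · intro y z _ _ hy hz
      simp only [PureState.map_add]
      exact hy.add hz
    · intro c y _ hy
      simp only [PureState.map_smul]
      exact continuous_const.mul hy
  refine continuous_of_uniform_approx_of_continuous fun u hu => ?_
  obtain ⟨ε, hε, hεu⟩ := Metric.mem_uniformity_dist.1 hu
  obtain ⟨b, hb, hab⟩ := Metric.mem_closure_iff.1 (dense_span_elementary a) ε hε
  refine ⟨_, hspan b hb, fun x => hεu ?_⟩
  rw [dist_eq_norm, ← _root_.map_sub ((f x).1 : _ →L[ℂ] ℂ) a b]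
  exact ((f x).norm_apply_le _).trans_lt (by rwa [← dist_eq_norm])

/-- The matrix unit `|r⟩⟨t|` at every site. -/
def siteMatrixUnit (Λ : Finset Γ) (r t : Λ → SpinIndex H) (v : Γ) : H →ₗ[ℂ] H := by
  classical exact
    if hv : v ∈ Λ then
      LinearMap.toSpanSingleton ℂ H (stdOrthonormalBasis ℂ H (r ⟨v, hv⟩)) ∘ₗ
        (innerₛₗ ℂ (stdOrthonormalBasis ℂ H (t ⟨v, hv⟩)))
    else 0

theorem elementaryOp_siteMatrixUnit (Λ : Finset Γ) (r t : Λ → SpinIndex H) :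
    elementaryOp Λ (siteMatrixUnit Λ r t) = matrixUnitOp Λ r t := by
  classical
  have h : ∀ r' t' : Λ → SpinIndex H, (∏ v : Λ, ⟪stdOrthonormalBasis ℂ H (r' v),
      siteMatrixUnit Λ r t v (stdOrthonormalBasis ℂ H (t' v))⟫_ℂ) =
      if r' = r ∧ t' = t then 1 else 0 := by
    intro r' t'
    have h1 : ∀ v : Λ, ⟪stdOrthonormalBasis ℂ H (r' v),
        siteMatrixUnit Λ r t v (stdOrthonormalBasis ℂ H (t' v))⟫_ℂ =
        if r' v = r v ∧ t' v = t v then 1 else 0 := by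
      intro v
      simp only [siteMatrixUnit, v.2, dif_pos, LinearMap.comp_apply, innerₛₗ_apply_apply,
        LinearMap.toSpanSingleton_apply, inner_smul_right,
        orthonormal_iff_ite.1 (stdOrthonormalBasis ℂ H).orthonormal]
      by_cases h1 : r' v = r v <;> by_cases h2 : t' v = t v <;> simp [h1, h2, eq_comm]
      · intro h; exact absurd h.symm h2
    simp only [h1]
    by_cases h2 : r' = r ∧ t' = t
    · obtain ⟨rfl, rfl⟩ := h2
      simp
    · rw [if_neg h2]
      by_cases h3 : r' = r
      · have h4 : t' ≠ t := fun h => h2 ⟨h3, h⟩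
        obtain ⟨v, hv⟩ := Function.ne_iff.1 h4
        exact Finset.prod_eq_zero (Finset.mem_univ v) (if_neg fun h => hv h.2)
      · obtain ⟨v, hv⟩ := Function.ne_iff.1 h3
        exact Finset.prod_eq_zero (Finset.mem_univ v) (if_neg fun h => hv h.1)
  rw [elementaryOp_eq]
  simp only [h, ite_smul, one_smul, zero_smul]
  rw [Finset.sum_eq_single r]
  · simp
  · intro b _ hb
    simp [hb]
  · simp

open Classical in
-- The elements on the right depend only on `Λ`, and the observables enter only through scalar
-- coefficients. This is what allows observables to vary with a parameter, and gives linearity in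
-- each site.
theorem elementary_eq_sum (Λ : Finset Γ) (A : Γ → (H →ₗ[ℂ] H)) :
    elementary Λ A = ∑ r : Λ → SpinIndex H, ∑ t : Λ → SpinIndex H,
      (∏ v : Λ, ⟪stdOrthonormalBasis ℂ H (r v), A v (stdOrthonormalBasis ℂ H (t v))⟫_ℂ) •
        elementary Λ (siteMatrixUnit Λ r t) := by
  apply Subtype.ext
  simp only [AddSubmonoidClass.coe_finsetSum]
  refine (elementaryOp_eq Λ A).trans ?_
  refine Finset.sum_congr rfl fun r _ => Finset.sum_congr rfl fun t _ => ?_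
  rw [← elementaryOp_siteMatrixUnit]
  rfl

/-- Joint continuity in state and observable costs nothing because `Λ` is finite: only finitely many
fixed evaluations occur, with coefficients that are products of matrix entries. -/
theorem PureState.continuous_apply_elementary {X : Type*} [TopologicalSpace X]
    {ω : X → PureState Γ H} (hω : Continuous ω) (Λ : Finset Γ) {A : X → Γ → (H →ₗ[ℂ] H)}
    (hA : ∀ v w z, Continuous fun x => ⟪w, A x v z⟫_ℂ) :
    Continuous fun x => (ω x).1 (elementary Λ (A x)) := by
  classical
  have h : ∀ a, Continuous fun x => (ω x).1 a := fun a =>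
    (WeakDual.eval_continuous a).comp (continuous_subtype_val.comp hω)
  simp only [elementary_eq_sum Λ (A _), PureState.map_sum, PureState.map_smul]
  refine continuous_finsetSum _ fun r _ => continuous_finsetSum _ fun t _ => ?_
  refine (continuous_finsetProd (M := ℂ) _ fun v _ => ?_).mul (h _)
  exact hA _ _ _

theorem elementary_congr {Λ : Finset Γ} {A B : Γ → (H →ₗ[ℂ] H)} (h : ∀ v ∈ Λ, A v = B v) :
    elementary Λ A = elementary Λ B :=
  Subtype.ext (elementaryOp_congr h)

open Classical in
/-- An elementary tensor as a linear function of the observable at one site. -/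
def elementarySlot {Λ : Finset Γ} {w : Γ} (hw : w ∈ Λ) (A : Γ → (H →ₗ[ℂ] H)) :
    (H →ₗ[ℂ] H) →ₗ[ℂ] QuasiLocalAlgebra Γ H :=
  ∑ r : Λ → SpinIndex H, ∑ t : Λ → SpinIndex H,
    LinearMap.toSpanSingleton ℂ _ (elementary Λ (siteMatrixUnit Λ r t)) ∘ₗ
      ((∏ v ∈ Finset.univ.erase (⟨w, hw⟩ : Λ),
        ⟪stdOrthonormalBasis ℂ H (r v), A v (stdOrthonormalBasis ℂ H (t v))⟫_ℂ) •
      (innerₛₗ ℂ (stdOrthonormalBasis ℂ H (r ⟨w, hw⟩)) ∘ₗ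
        LinearMap.applyₗ (stdOrthonormalBasis ℂ H (t ⟨w, hw⟩))))

open Classical in
theorem elementarySlot_apply {Λ : Finset Γ} {w : Γ} (hw : w ∈ Λ) (A : Γ → (H →ₗ[ℂ] H))
    (X : H →ₗ[ℂ] H) : elementarySlot hw A X = elementary Λ (Function.update A w X) := by
  rw [elementary_eq_sum, elementarySlot]
  rw [LinearMap.sum_apply]
  refine Finset.sum_congr rfl fun r _ => ?_
  rw [LinearMap.sum_apply]
  refine Finset.sum_congr rfl fun t _ => ?_
  rw [LinearMap.comp_apply, LinearMap.toSpanSingleton_apply]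
  congr 1
  rw [← Finset.mul_prod_erase _ _ (Finset.mem_univ (⟨w, hw⟩ : Λ)), mul_comm]
  simp only [LinearMap.smul_apply, LinearMap.comp_apply, LinearMap.applyₗ_apply_apply,
    innerₛₗ_apply_apply, Function.update_self, smul_eq_mul]
  congr 1
  refine Finset.prod_congr rfl fun v hv => ?_
  rw [Function.update_of_ne]
  rintro rfl
  exact (Finset.mem_erase.1 hv).1 rfl

/-- By linearity at each site, the observables can be replaced by elements of `S` one site at a
time; `T` is the set of sites not yet treated. -/
theorem elementary_mem_span {Λ : Finset Γ} (S : Set (H →ₗ[ℂ] H)) (hS : Submodule.span ℂ S = ⊤)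
    (A : Γ → (H →ₗ[ℂ] H)) :
    elementary Λ A ∈ Submodule.span ℂ {a : QuasiLocalAlgebra Γ H |
      ∃ B : Γ → (H →ₗ[ℂ] H), (∀ v ∈ Λ, B v ∈ S) ∧ a = elementary Λ B} := by
  classical
  suffices h : ∀ T : Finset Γ, T ⊆ Λ → ∀ A : Γ → (H →ₗ[ℂ] H), (∀ v ∈ Λ, v ∉ T → A v ∈ S) →
      elementary Λ A ∈ Submodule.span ℂ {a : QuasiLocalAlgebra Γ H |
      ∃ B : Γ → (H →ₗ[ℂ] H), (∀ v ∈ Λ, B v ∈ S) ∧ a = elementary Λ B} from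
    h Λ subset_rfl A fun v h h' => absurd h h'
  intro T
  induction T using Finset.induction_on with
  | empty =>
    intro _ A hA
    exact Submodule.subset_span ⟨A, fun v hv => hA v hv (Finset.notMem_empty v), rfl⟩
  | insert w T hwT ih =>
    intro hT A hA
    have hw : w ∈ Λ := hT (Finset.mem_insert_self _ _)
    rw [← Function.update_eq_self w A, ← elementarySlot_apply hw]
    have hmem : A w ∈ Submodule.span ℂ S := by rw [hS]; trivial
    refine Submodule.span_induction (p := fun X _ => elementarySlot hw A X ∈ _)
      ?_ ?_ ?_ ?_ hmem
    · intro X hX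
      rw [elementarySlot_apply]
      refine ih (fun v hv => hT (Finset.mem_insert_of_mem hv)) _ fun v hv hvT => ?_
      by_cases h : v = w
      · subst h
        simpa using hX
      · rw [Function.update_of_ne h]
        exact hA v hv (by simp [h, hvT])
    · simp
    · intro X Y _ _ hX hY
      rw [map_add]
      exact add_mem hX hY
    · intro c X _ hX
      rw [map_smul]
      exact Submodule.smul_mem _ _ hX

/-- In finite dimension End(H) ⊗ End(K) = End(H ⊗ K). Hence a state on the stacked system is
determined by its values on tensors of the form A ⊗ B, the only ones `IsTensor` prescribes. -/
theorem span_map_eq_top (H K : FinHilb) :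
    Submodule.span ℂ {T : H.tensor K →ₗ[ℂ] H.tensor K |
      ∃ (A : H →ₗ[ℂ] H) (B : K →ₗ[ℂ] K), T = TensorProduct.map A B} = ⊤ := by
  rw [eq_top_iff]
  intro T _
  obtain ⟨z, rfl⟩ := (homTensorHomEquiv ℂ H K H K).surjective T
  induction z using TensorProduct.induction_on with
  | zero => rw [map_zero]; exact zero_mem _
  | tmul A B =>
    rw [homTensorHomEquiv_apply, TensorProduct.homTensorHomMap_apply]
    exact Submodule.subset_span ⟨A, B, rfl⟩
  | add x y hx hy => rw [map_add]; exact add_mem (hx trivial) (hy trivial)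

theorem PureState.ext_of_span (S : Set (H →ₗ[ℂ] H)) (hS : Submodule.span ℂ S = ⊤)
    {ω τ : PureState Γ H}
    (h : ∀ (Λ : Finset Γ) (A : Γ → (H →ₗ[ℂ] H)), (∀ v ∈ Λ, A v ∈ S) →
      ω.1 (elementary Λ A) = τ.1 (elementary Λ A)) : ω = τ := by
  refine PureState.ext_elementary fun Λ A => ?_
  refine Submodule.span_induction (p := fun b _ => ω.1 b = τ.1 b) ?_ ?_ ?_ ?_
    (elementary_mem_span S hS A)
  · rintro _ ⟨B, hB, rfl⟩
    exact h Λ B hB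
  · rw [PureState.map_zero, PureState.map_zero]
  · intro x y _ _ hx hy
    exact (ω.map_add x y).trans ((congrArg₂ (· + ·) hx hy).trans (τ.map_add x y).symm)
  · intro c x _ hx
    exact (ω.map_smul c x).trans ((congrArg (c * ·) hx).trans (τ.map_smul c x).symm)

theorem PureState.continuous_of_span {X : Type*} [TopologicalSpace X]
    (S : Set (H →ₗ[ℂ] H)) (hS : Submodule.span ℂ S = ⊤) {f : X → PureState Γ H}
    (h : ∀ (Λ : Finset Γ) (A : Γ → (H →ₗ[ℂ] H)), (∀ v ∈ Λ, A v ∈ S) →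
      Continuous fun x => (f x).1 (elementary Λ A)) : Continuous f := by
  refine PureState.continuous_of_elementary fun Λ A => ?_
  refine Submodule.span_induction (p := fun b _ => Continuous fun x => (f x).1 b) ?_ ?_ ?_ ?_
    (elementary_mem_span S hS A)
  · rintro _ ⟨B, hB, rfl⟩
    exact h Λ B hB
  · simp only [PureState.map_zero]
    exact continuous_const
  · intro y z _ _ hy hz
    simp only [PureState.map_add]
    exact hy.add hz
  · intro c y _ hy
    simp only [PureState.map_smul]
    exact continuous_const.mul hy

theorem exists_map_of_mem {Λ : Finset Γ} {C : Γ → (H.tensor K →ₗ[ℂ] H.tensor K)}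
    (h : ∀ v ∈ Λ, C v ∈ {T : H.tensor K →ₗ[ℂ] H.tensor K |
      ∃ (A : H →ₗ[ℂ] H) (B : K →ₗ[ℂ] K), T = TensorProduct.map A B}) :
    ∃ (A : Γ → (H →ₗ[ℂ] H)) (B : Γ → (K →ₗ[ℂ] K)),
      elementary Λ C = elementary Λ fun v => TensorProduct.map (A v) (B v) := by
  classical
  choose! A B hAB using h
  exact ⟨A, B, elementary_congr hAB⟩

theorem PureState.ext_tensor {ω τ : PureState Γ (H.tensor K)}
    (h : ∀ (Λ : Finset Γ) (A : Γ → (H →ₗ[ℂ] H)) (B : Γ → (K →ₗ[ℂ] K)),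
      ω.1 (elementary (H := H.tensor K) Λ fun v => TensorProduct.map (A v) (B v)) =
        τ.1 (elementary (H := H.tensor K) Λ fun v => TensorProduct.map (A v) (B v))) : ω = τ := by
  refine PureState.ext_of_span _ (span_map_eq_top H K) fun Λ C hC => ?_
  obtain ⟨A, B, hAB⟩ := exists_map_of_mem hC
  exact (congrArg ω.1 hAB).trans ((h Λ A B).trans (congrArg τ.1 hAB).symm)

theorem PureState.continuous_of_tensor {X : Type*} [TopologicalSpace X]
    {f : X → PureState Γ (H.tensor K)}
    (h : ∀ (Λ : Finset Γ) (A : Γ → (H →ₗ[ℂ] H)) (B : Γ → (K →ₗ[ℂ] K)),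
      Continuous fun x => (f x).1
        (elementary (H := H.tensor K) Λ fun v => TensorProduct.map (A v) (B v))) :
    Continuous f := by
  refine PureState.continuous_of_span _ (span_map_eq_top H K) fun Λ C hC => ?_
  obtain ⟨A, B, hAB⟩ := exists_map_of_mem hC
  rw [hAB]
  exact h Λ A B

end StateBounds

/-! ### Paths of isometries into a finite-dimensional Hilbert space. -/

section IsometryPaths

variable {V K : Type*} [NormedAddCommGroup V] [InnerProductSpace ℂ V]
  [NormedAddCommGroup K] [InnerProductSpace ℂ K]

theorem exists_unit_smul_of_mem_span {x y : K} (h : y ∈ Submodule.span ℂ {x}) (hn : ‖y‖ = ‖x‖) :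
    ∃ c : ℂ, ‖c‖ = 1 ∧ y = c • x := by
  obtain ⟨c, rfl⟩ := Submodule.mem_span_singleton.1 h
  by_cases hx : x = 0
  · exact ⟨1, norm_one, by simp [hx]⟩
  · refine ⟨c, ?_, rfl⟩
    rw [norm_smul] at hn
    exact mul_right_cancel₀ (norm_ne_zero_iff.2 hx) (hn.trans (one_mul _).symm)

variable [FiniteDimensional ℂ K]

/-- The `*`-algebra of operators having `x` as an eigenvector, together with their adjoints. -/
def eigenvectorStarSubalgebra (x : K) : StarSubalgebra ℂ (K →L[ℂ] K) where
  carrier := {T | T x ∈ Submodule.span ℂ {x} ∧ (star T) x ∈ Submodule.span ℂ {x}}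
  mul_mem' := by
    have h : ∀ S T : K →L[ℂ] K, S x ∈ Submodule.span ℂ {x} → T x ∈ Submodule.span ℂ {x} →
        (S * T) x ∈ Submodule.span ℂ {x} := by
      intro S T hS hT
      obtain ⟨a, ha⟩ := Submodule.mem_span_singleton.1 hT
      rw [mul_apply_eq_comp, ← ha, map_smul]
      exact Submodule.smul_mem _ _ hS
    intro S T hS hT
    exact ⟨h S T hS.1 hT.1, by rw [star_mul]; exact h _ _ hT.2 hS.2⟩
  add_mem' := by
    intro S T hS hT
    exact ⟨add_mem hS.1 hT.1, by rw [star_add]; exact add_mem hS.2 hT.2⟩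
  algebraMap_mem' r := by
    rw [Algebra.algebraMap_eq_smul_one]
    refine ⟨Submodule.smul_mem _ _ (Submodule.mem_span_singleton_self x), ?_⟩
    rw [star_smul, star_one]
    exact Submodule.smul_mem _ _ (Submodule.mem_span_singleton_self x)
  star_mem' := by
    intro T hT
    exact ⟨hT.2, by rw [star_star]; exact hT.1⟩

theorem isClosed_eigenvectorStarSubalgebra (x : K) :
    IsClosed (eigenvectorStarSubalgebra x : Set (K →L[ℂ] K)) := by
  have h : IsClosed (Submodule.span ℂ {x} : Set K) := Submodule.closed_of_finiteDimensional _
  exact (h.preimage (f := fun T : K →L[ℂ] K => T x) (by fun_prop)).inter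
    (h.preimage (f := fun T : K →L[ℂ] K => (star T) x) (by fun_prop))

/-- The spectrum is finite and the unit circle is not, so a rotation can move −1 off the spectrum;
for a unitary this means distance less than 2 from the identity, the range where the logarithm
exists. -/
theorem exists_phase_norm_sub_one_lt (u : K →L[ℂ] K) (hu : u ∈ unitary (K →L[ℂ] K)) :
    ∃ c : ℂ, ‖c‖ = 1 ∧ c • u ∈ unitary (K →L[ℂ] K) ∧ ‖c • u - 1‖ < 2 := by
  have hfin : (spectrum ℂ u).Finite := by
    rw [← AlgEquiv.spectrum_eq (Module.End.toContinuousLinearMap K (𝕜 := ℂ)).symm u]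
    exact Module.End.finite_spectrum _
  have hinf : (Metric.sphere (0 : ℂ) 1).Infinite :=
    (isPreconnected_sphere (by rw [Complex.rank_real_complex]; exact_mod_cast Nat.lt_succ_self 1)
      0 1).infinite_of_nontrivial
      ⟨1, by simp, -1, by simp, by norm_num⟩
  obtain ⟨z, hz, hzs⟩ := (hinf.sdiff hfin).nonempty
  have hz1 : ‖z‖ = 1 := by simpa using hz
  have hz0 : z ≠ 0 := by
    rintro rfl
    simp at hz1
  have hc : ‖-z⁻¹‖ = 1 := by rw [norm_neg, norm_inv, hz1, inv_one]
  have hcu : (-z⁻¹) • u ∈ unitary (K →L[ℂ] K) := by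
    have h1 : star (-z⁻¹) * (-z⁻¹) = (1 : ℂ) := by
      have := RCLike.conj_mul (-z⁻¹)
      rw [hc] at this
      simpa using this
    refine Unitary.mem_iff.2 ⟨?_, ?_⟩
    · rw [star_smul, smul_mul_smul_comm, h1, (Unitary.mem_iff.1 hu).1, one_smul]
    · rw [star_smul, smul_mul_smul_comm, mul_comm, h1, (Unitary.mem_iff.1 hu).2, one_smul]
  -- The phase −z⁻¹ carries `z` to −1; since `z` is not in the spectrum of `u`, −1 is not in the
  -- spectrum of the rotated unitary.
  refine ⟨-z⁻¹, hc, hcu, (Unitary.spectrum_subset_slitPlane_iff_norm_lt_two hcu).1 ?_⟩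
  intro w hw
  have hw1 : ‖w‖ = 1 := by simpa using spectrum.subset_circle_of_unitary hcu hw
  rw [Complex.mem_slitPlane_iff_not_le_zero]
  intro hle
  have hw2 : w = -1 := by
    have h2 : w.im = 0 := (Complex.le_def.1 hle).2
    have h3 : w.re ≤ 0 := (Complex.le_def.1 hle).1
    have h4 : w = (w.re : ℂ) := Complex.ext rfl (by simpa using h2)
    rw [h4, Complex.norm_real, Real.norm_eq_abs, abs_of_nonpos h3] at hw1
    rw [h4, show w.re = -1 by linarith]
    simp
  subst hw2
  apply hzs
  have h5 : (-z⁻¹ : ℂ) ≠ 0 := by simpa using hz0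
  have h6 : (-1 : ℂ) = Units.mk0 (-z⁻¹) h5 • z := by
    rw [Units.smul_mk0, smul_eq_mul, neg_mul, inv_mul_cancel₀ hz0]
  rw [h6] at hw
  exact spectrum.smul_mem_smul_iff.1 hw

/-- Extend the isometry g ∘ f⁻¹ from the range of `f` to all of `K`; in finite dimension an
isometric endomorphism is surjective, hence unitary. -/
theorem LinearIsometry.exists_unitary_comp_eq (f g : V →ₗᵢ[ℂ] K) :
    ∃ u ∈ unitary (K →L[ℂ] K), ∀ x, u (f x) = g x := by
  let L : LinearMap.range f.toLinearMap →ₗᵢ[ℂ] K := g.comp f.equivRange.symm.toLinearIsometry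
  refine ⟨L.extend.toContinuousLinearMap, ?_, fun x => ?_⟩
  · have h1 : star L.extend.toContinuousLinearMap * L.extend.toContinuousLinearMap = 1 :=
      (ContinuousLinearMap.norm_map_iff_adjoint_comp_self _).1 L.extend.norm_map
    refine Unitary.mem_iff.2 ⟨h1, ?_⟩
    have h2 : Function.Surjective L.extend.toContinuousLinearMap :=
      LinearMap.surjective_of_injective (f := L.extend.toLinearMap) L.extend.injective
    refine ContinuousLinearMap.ext fun y => ?_
    obtain ⟨x, rfl⟩ := h2 y
    have h3 := congrArg (fun T : K →L[ℂ] K => L.extend.toContinuousLinearMap (T x)) h1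
    exact h3
  · have : f x = ((f.equivRange x : LinearMap.range f.toLinearMap) : K) := rfl
    change L.extend (f x) = g x
    rw [this, LinearIsometry.extend_apply]
    simp [L]

/-- The composition of an isometry with a unitary operator. -/
def unitaryComp (u : unitary (K →L[ℂ] K)) (f : V →ₗᵢ[ℂ] K) : V →ₗᵢ[ℂ] K where
  toLinearMap := (u : K →L[ℂ] K).toLinearMap ∘ₗ f.toLinearMap
  norm_map' x := by
    have h := (ContinuousLinearMap.norm_map_iff_adjoint_comp_self (u : K →L[ℂ] K)).2
      (Unitary.mem_iff.1 u.2).1 (f x)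
    exact h.trans (f.norm_map x)

/-- Write the phase-corrected unitary as exp(ia) with `a` self-adjoint and move along exp(ita) ∘ f.
If f x = g x, then f x is an eigenvector of the unitary, hence of `a`, which lies in its functional
calculus, hence of each exp(ita). So f x changes only by a phase. -/
theorem LinearIsometry.exists_path (f g : V →ₗᵢ[ℂ] K) :
    ∃ F : unitInterval → (V →ₗᵢ[ℂ] K), (∀ x, Continuous fun t => F t x) ∧ F 0 = f ∧
      (∃ c : ℂ, ‖c‖ = 1 ∧ ∀ x, F 1 x = c • g x) ∧
      ∀ x, f x = g x → ∀ t, ∃ c : ℂ, ‖c‖ = 1 ∧ F t x = c • f x := by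
  obtain ⟨u, hu, hfg⟩ := f.exists_unitary_comp_eq g
  obtain ⟨c, hc, hcu, hlt⟩ := exists_phase_norm_sub_one_lt u hu
  let w : unitary (K →L[ℂ] K) := ⟨c • u, hcu⟩
  let P := selfAdjoint.expUnitaryPathToOne (Unitary.argSelfAdjoint w)
  refine ⟨fun t => unitaryComp (P t) f, fun x => ?_, ?_, ⟨c, hc, fun x => ?_⟩, fun x hx t => ?_⟩
  · have h1 : Continuous fun t => ((P t : unitary (K →L[ℂ] K)) : K →L[ℂ] K) :=
      continuous_subtype_val.comp P.continuous
    exact h1.clm_apply continuous_const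
  · ext x
    change ((P 0 : unitary (K →L[ℂ] K)) : K →L[ℂ] K) (f x) = f x
    rw [P.source]
    rfl
  · change ((P 1 : unitary (K →L[ℂ] K)) : K →L[ℂ] K) (f x) = _
    rw [P.target, expUnitary_argSelfAdjoint hlt]
    change (c • u) (f x) = _
    rw [← hfg]
    rfl
  · refine exists_unit_smul_of_mem_span ?_
      (((unitaryComp (P t) f).norm_map x).trans (f.norm_map x).symm)
    have hw : (w : K →L[ℂ] K) ∈ eigenvectorStarSubalgebra (f x) := by
      have h1 : u (f x) = f x := (hfg x).trans hx.symm
      have h2 : (star u) (f x) = f x := by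
        have h3 := congrArg (fun T : K →L[ℂ] K => T (f x)) (Unitary.mem_iff.1 hu).1
        have h4 : (star u) (u (f x)) = f x := h3
        rwa [h1] at h4
      refine ⟨?_, ?_⟩
      · change c • u (f x) ∈ _
        rw [h1]
        exact Submodule.smul_mem _ _ (Submodule.mem_span_singleton_self _)
      · change star (c • u) (f x) ∈ _
        rw [star_smul]
        change star c • (star u) (f x) ∈ _
        rw [h2]
        exact Submodule.smul_mem _ _ (Submodule.mem_span_singleton_self _)
    have hcl := isClosed_eigenvectorStarSubalgebra (f x)
    have ha : ((Unitary.argSelfAdjoint w : selfAdjoint (K →L[ℂ] K)) : K →L[ℂ] K) ∈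
        eigenvectorStarSubalgebra (f x) := by
      rw [Unitary.argSelfAdjoint_coe]
      exact cfc_mem (hs := hcl) _ hw
    have he : ((P t : unitary (K →L[ℂ] K)) : K →L[ℂ] K) ∈ eigenvectorStarSubalgebra (f x) := by
      simp only [P, selfAdjoint.expUnitaryPathToOne_apply, selfAdjoint.expUnitary_coe]
      let _ : Algebra ℚ (K →L[ℂ] K) := Algebra.compHom _ (algebraMap ℚ ℂ)
      have _ : IsScalarTower ℚ ℂ (K →L[ℂ] K) := IsScalarTower.of_algebraMap_eq fun _ => rfl
      refine NormedSpace.exp_mem (R := ℂ) (s := eigenvectorStarSubalgebra (f x)) hcl ?_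
      refine SMulMemClass.smul_mem _ ?_
      rw [selfAdjoint.val_smul, ← Complex.coe_smul]
      exact SMulMemClass.smul_mem _ ha
    exact he.1

end IsometryPaths

/-! ### Structural isometries of tensor products and conjugation of observables by them. -/

namespace FinHilb

variable {H H' K K' L : FinHilb}

/-- The tensor product of two isometries. -/
def mapIso (f : H →ₗᵢ[ℂ] H') (g : K →ₗᵢ[ℂ] K') : H.tensor K →ₗᵢ[ℂ] H'.tensor K' :=
  TensorProduct.mapIsometry f g

/-- The associativity isometry. -/
def assocIso (H K L : FinHilb) : (H.tensor K).tensor L →ₗᵢ[ℂ] H.tensor (K.tensor L) :=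
  (TensorProduct.assocIsometry ℂ H K L).toLinearIsometry

/-- The exchange isometry. -/
def commIso (H K : FinHilb) : H.tensor K →ₗᵢ[ℂ] K.tensor H :=
  (TensorProduct.commIsometry ℂ H K).toLinearIsometry

/-- The isometry `x ↦ u ⊗ x`. -/
def tmulLeft (u : H) (hu : ‖u‖ = 1) (K : FinHilb) : K →ₗᵢ[ℂ] H.tensor K where
  toLinearMap := TensorProduct.mk ℂ H K u
  norm_map' x := by
    have h : ‖(u ⊗ₜ[ℂ] x : H ⊗[ℂ] K)‖ = ‖u‖ * ‖x‖ := TensorProduct.norm_tmul (𝕜 := ℂ) u x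
    rw [hu, one_mul] at h
    exact h

/-- The isometry `x ↦ x ⊗ u`. -/
def tmulRight (u : H) (hu : ‖u‖ = 1) (K : FinHilb) : K →ₗᵢ[ℂ] K.tensor H where
  toLinearMap := (TensorProduct.mk ℂ K H).flip u
  norm_map' x := by
    have h : ‖(x ⊗ₜ[ℂ] u : K ⊗[ℂ] H)‖ = ‖x‖ * ‖u‖ := TensorProduct.norm_tmul (𝕜 := ℂ) x u
    rw [hu, mul_one] at h
    exact h

/-- Conjugation of an observable by an isometry. -/
def conj (f : H →ₗᵢ[ℂ] K) (A : K →ₗ[ℂ] K) : H →ₗ[ℂ] H :=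
  LinearMap.adjoint f.toLinearMap ∘ₗ A ∘ₗ f.toLinearMap

theorem inner_conj (f : H →ₗᵢ[ℂ] K) (A : K →ₗ[ℂ] K) (x y : H) :
    ⟪x, conj f A y⟫_ℂ = ⟪f x, A (f y)⟫_ℂ :=
  LinearMap.adjoint_inner_right f.toLinearMap x (A (f y))

theorem eq_conj {f : H →ₗᵢ[ℂ] K} {A : K →ₗ[ℂ] K} {B : H →ₗ[ℂ] H}
    (h : ∀ x y, ⟪x, B y⟫_ℂ = ⟪f x, A (f y)⟫_ℂ) : conj f A = B := by
  refine LinearMap.ext fun y => ext_inner_left ℂ fun x => ?_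
  rw [inner_conj, h]

theorem conj_eq_of_apply {f : H →ₗᵢ[ℂ] K} {A : K →ₗ[ℂ] K} {B : H →ₗ[ℂ] H}
    (h : ∀ y, A (f y) = f (B y)) : conj f A = B :=
  eq_conj fun x y => by rw [h, f.inner_map_map]

theorem conj_conj (g : K →ₗᵢ[ℂ] L) (f : H →ₗᵢ[ℂ] K) (A : L →ₗ[ℂ] L) :
    conj (g.comp f) A = conj f (conj g A) :=
  eq_conj fun x y => by rw [inner_conj, inner_conj]; rfl

theorem conj_id (A : H →ₗ[ℂ] H) : conj LinearIsometry.id A = A :=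
  eq_conj fun _ _ => rfl

/-- The phase cancels between the two slots of the inner product. For this reason a path of
isometries need only end at a scalar multiple of its target. -/
theorem conj_smul (f g : H →ₗᵢ[ℂ] K) {c : ℂ} (hc : ‖c‖ = 1) (h : ∀ x, f x = c • g x)
    (A : K →ₗ[ℂ] K) : conj f A = conj g A := by
  refine eq_conj fun x y => ?_
  rw [inner_conj, h, h, _root_.map_smul, inner_smul_left, inner_smul_right, ← mul_assoc,
    RCLike.conj_mul, hc]
  simp

/-- The tensor product of two observables. -/
def tmap (A : H →ₗ[ℂ] H) (B : K →ₗ[ℂ] K) : H.tensor K →ₗ[ℂ] H.tensor K :=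
  TensorProduct.map A B

theorem linearMap_ext_tensor {M : Type*} [AddCommMonoid M] [Module ℂ M]
    {S T : H.tensor K →ₗ[ℂ] M} (h : ∀ (x : H) (y : K),
      S (x ⊗ₜ[ℂ] y : H ⊗[ℂ] K) = T (x ⊗ₜ[ℂ] y : H ⊗[ℂ] K)) : S = T :=
  TensorProduct.ext' h

theorem conj_mapIso (f : H →ₗᵢ[ℂ] H') (g : K →ₗᵢ[ℂ] K') (A : H' →ₗ[ℂ] H') (B : K' →ₗ[ℂ] K') :
    conj (mapIso f g) (tmap A B) = tmap (conj f A) (conj g B) := by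
  unfold conj
  have h : LinearMap.adjoint (mapIso f g).toLinearMap =
      (TensorProduct.map (LinearMap.adjoint f.toLinearMap) (LinearMap.adjoint g.toLinearMap) :
        H' ⊗[ℂ] K' →ₗ[ℂ] H ⊗[ℂ] K) :=
    TensorProduct.adjoint_map f.toLinearMap g.toLinearMap
  rw [h]
  exact linearMap_ext_tensor fun _ _ => rfl

theorem conj_assocIso (A : H →ₗ[ℂ] H) (B : K →ₗ[ℂ] K) (C : L →ₗ[ℂ] L) :
    conj (assocIso H K L) (tmap A (tmap B C)) = tmap (tmap A B) C := by
  refine conj_eq_of_apply fun y => ?_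
  refine LinearMap.congr_fun (f := tmap A (tmap B C) ∘ₗ (assocIso H K L).toLinearMap)
    (g := (assocIso H K L).toLinearMap ∘ₗ tmap (tmap A B) C) ?_ y
  exact TensorProduct.ext_threefold fun _ _ _ => rfl

theorem conj_commIso (A : H →ₗ[ℂ] H) (B : K →ₗ[ℂ] K) :
    conj (commIso H K) (tmap B A) = tmap A B := by
  refine conj_eq_of_apply fun y => ?_
  refine LinearMap.congr_fun (f := tmap B A ∘ₗ (commIso H K).toLinearMap)
    (g := (commIso H K).toLinearMap ∘ₗ tmap A B) ?_ y
  exact linearMap_ext_tensor fun _ _ => rfl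

theorem inner_tmul_tmul (x x' : H) (y y' : K) :
    ⟪((x ⊗ₜ[ℂ] y : H ⊗[ℂ] K) : H.tensor K), ((x' ⊗ₜ[ℂ] y' : H ⊗[ℂ] K) : H.tensor K)⟫_ℂ =
      ⟪x, x'⟫_ℂ * ⟪y, y'⟫_ℂ :=
  TensorProduct.inner_tmul (𝕜 := ℂ) x x' y y'

theorem conj_tmulLeft (u : H) (hu : ‖u‖ = 1) (A : H →ₗ[ℂ] H) (B : K →ₗ[ℂ] K) :
    conj (tmulLeft u hu K) (tmap A B) = ⟪u, A u⟫_ℂ • B := by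
  refine eq_conj fun x y => ?_
  rw [LinearMap.smul_apply, inner_smul_right]
  exact (inner_tmul_tmul u (A u) x (B y)).symm

theorem conj_tmulRight (u : H) (hu : ‖u‖ = 1) (A : H →ₗ[ℂ] H) (B : K →ₗ[ℂ] K) :
    conj (tmulRight u hu K) (tmap B A) = ⟪u, A u⟫_ℂ • B := by
  refine eq_conj fun x y => ?_
  rw [LinearMap.smul_apply, inner_smul_right, mul_comm]
  exact (inner_tmul_tmul x (B y) u (A u)).symm

theorem span_tmap_tmap (H K L : FinHilb) :
    Submodule.span ℂ {T : H.tensor (K.tensor L) →ₗ[ℂ] H.tensor (K.tensor L) |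
      ∃ (A : H →ₗ[ℂ] H) (B : K →ₗ[ℂ] K) (C : L →ₗ[ℂ] L), T = tmap A (tmap B C)} = ⊤ := by
  rw [eq_top_iff, ← span_map_eq_top H (K.tensor L), Submodule.span_le]
  rintro _ ⟨A, D, rfl⟩
  have hD : D ∈ Submodule.span ℂ {T : K.tensor L →ₗ[ℂ] K.tensor L |
      ∃ (A : K →ₗ[ℂ] K) (B : L →ₗ[ℂ] L), T = TensorProduct.map A B} := by
    rw [span_map_eq_top]; trivial
  refine Submodule.span_induction (p := fun D _ => tmap A D ∈ Submodule.span ℂ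
    {T : H.tensor (K.tensor L) →ₗ[ℂ] H.tensor (K.tensor L) |
      ∃ (A : H →ₗ[ℂ] H) (B : K →ₗ[ℂ] K) (C : L →ₗ[ℂ] L), T = tmap A (tmap B C)}) ?_ ?_ ?_ ?_ hD
  · rintro _ ⟨B, C, rfl⟩
    exact Submodule.subset_span ⟨A, B, C, rfl⟩
  · rw [show tmap A (0 : K.tensor L →ₗ[ℂ] K.tensor L) = 0 from TensorProduct.map_zero_right A]
    exact zero_mem _
  · intro S T _ _ hS hT
    rw [show tmap A (S + T) = tmap A S + tmap A T from TensorProduct.map_add_right A S T]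
    exact add_mem hS hT
  · intro c T _ hT
    rw [show tmap A (c • T) = c • tmap A T from TensorProduct.map_smul_right c A T]
    exact Submodule.smul_mem _ _ hT

end FinHilb

open FinHilb

/-! ### Uniqueness of pushed and stacked states. -/

section PureStates

variable {Γ : Type*} {H K L : FinHilb}

/-- The value of a state on an elementary tensor. -/
def PureState.coord (ω : PureState Γ H) (Λ : Finset Γ) (A : Γ → (H →ₗ[ℂ] H)) : ℂ :=
  ω.1 (elementary Λ A)

theorem PureState.ext_coord {ω τ : PureState Γ H}
    (h : ∀ (Λ : Finset Γ) (A : Γ → (H →ₗ[ℂ] H)), ω.coord Λ A = τ.coord Λ A) : ω = τ :=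
  PureState.ext_elementary h

theorem PureState.continuous_of_coord {X : Type*} [TopologicalSpace X]
    {f : X → PureState Γ H}
    (h : ∀ (Λ : Finset Γ) (A : Γ → (H →ₗ[ℂ] H)), Continuous fun x => (f x).coord Λ A) :
    Continuous f :=
  PureState.continuous_of_elementary h

theorem PureState.continuous_coord {X : Type*} [TopologicalSpace X]
    {ω : X → PureState Γ H} (hω : Continuous ω) (Λ : Finset Γ) {A : X → Γ → (H →ₗ[ℂ] H)}
    (hA : ∀ v w z, Continuous fun x => ⟪w, A x v z⟫_ℂ) :
    Continuous fun x => (ω x).coord Λ (A x) :=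
  PureState.continuous_apply_elementary hω Λ hA

theorem elementary_smul (Λ : Finset Γ) (c : Γ → ℂ) (A : Γ → (H →ₗ[ℂ] H)) :
    elementary Λ (fun v => c v • A v) = (∏ v ∈ Λ, c v) • elementary Λ A := by
  classical
  rw [elementary_eq_sum Λ fun v => c v • A v, elementary_eq_sum Λ A, Finset.smul_sum]
  refine Finset.sum_congr rfl fun r _ => ?_
  rw [Finset.smul_sum]
  refine Finset.sum_congr rfl fun t _ => ?_
  rw [smul_smul]
  congr 1
  simp only [LinearMap.smul_apply, inner_smul_right]
  rw [Finset.prod_mul_distrib, Finset.prod_coe_sort Λ c]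

theorem PureState.coord_smul (ω : PureState Γ H) (Λ : Finset Γ) (c : Γ → ℂ)
    (A : Γ → (H →ₗ[ℂ] H)) :
    ω.coord Λ (fun v => c v • A v) = (∏ v ∈ Λ, c v) * ω.coord Λ A :=
  (congrArg ω.1 (elementary_smul Λ c A)).trans (ω.map_smul _ _)

theorem isPush_iff {f : H →ₗᵢ[ℂ] K} {ω : PureState Γ H} {ω' : PureState Γ K} :
    IsPush f ω ω' ↔ ∀ (Λ : Finset Γ) (A : Γ → (K →ₗ[ℂ] K)),
      ω'.coord Λ A = ω.coord Λ (fun v => conj f (A v)) := Iff.rfl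

theorem IsPush.unique {f : H →ₗᵢ[ℂ] K} {ω : PureState Γ H} {ω₁ ω₂ : PureState Γ K}
    (h₁ : IsPush f ω ω₁) (h₂ : IsPush f ω ω₂) : ω₁ = ω₂ :=
  PureState.ext_coord fun Λ A => (h₁ Λ A).trans (h₂ Λ A).symm

theorem ext_tmap {ω τ : PureState Γ (H.tensor K)}
    (h : ∀ (Λ : Finset Γ) (A : Γ → (H →ₗ[ℂ] H)) (B : Γ → (K →ₗ[ℂ] K)),
      ω.coord Λ (fun v => tmap (A v) (B v)) =
        τ.coord Λ (fun v => tmap (A v) (B v))) : ω = τ :=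
  PureState.ext_tensor h

theorem IsTensor.unique {ω : PureState Γ H} {τ : PureState Γ K}
    {σ₁ σ₂ : PureState Γ (H.tensor K)} (h₁ : IsTensor ω τ σ₁) (h₂ : IsTensor ω τ σ₂) : σ₁ = σ₂ :=
  ext_tmap fun Λ A B => (h₁ Λ A B).trans (h₂ Λ A B).symm

theorem ext_tmap_tmap {ω τ : PureState Γ (H.tensor (K.tensor L))}
    (h : ∀ (Λ : Finset Γ) (A : Γ → (H →ₗ[ℂ] H)) (B : Γ → (K →ₗ[ℂ] K)) (C : Γ → (L →ₗ[ℂ] L)),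
      ω.coord Λ (fun v => tmap (A v) (tmap (B v) (C v))) =
        τ.coord Λ (fun v => tmap (A v) (tmap (B v) (C v)))) : ω = τ := by
  classical
  refine PureState.ext_of_span _ (span_tmap_tmap H K L) fun Λ D hD => ?_
  choose! A B C hABC using hD
  have h1 := elementary_congr hABC
  exact (congrArg ω.1 h1).trans ((h Λ A B C).trans (congrArg τ.1 h1).symm)

end PureStates

/-- The topology of `𝒬_Γ(H)`, registered separately to speed up instance search. -/
@[reducible] def QuantumStateType.topologicalSpaceCarrier {Γ : Type*} (Q : QuantumStateType Γ)
    (H : FinHilb) : TopologicalSpace (Q.carrier H) :=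
  instTopologicalSpaceSubtype

attribute [local instance] QuantumStateType.topologicalSpaceCarrier

/-! ### Pushing along isometries, stacking and factorized states as continuous operations. -/

namespace QuantumStateType

variable {Γ : Type*} (Q : QuantumStateType Γ) {H H' K K' L : FinHilb}

/-- The map `𝒬_Γ(f)`. -/
def push (f : H →ₗᵢ[ℂ] K) : Q.carrier H → Q.carrier K := (Q.exists_push f).choose

theorem push_isPush (f : H →ₗᵢ[ℂ] K) (ω : Q.carrier H) :
    IsPush f (ω : PureState Γ H) (Q.push f ω : PureState Γ K) :=
  (Q.exists_push f).choose_spec.1 ω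

theorem push_apply (f : H →ₗᵢ[ℂ] K) (ω : Q.carrier H) (Λ : Finset Γ) (A : Γ → (K →ₗ[ℂ] K)) :
    (Q.push f ω : PureState Γ K).coord Λ A =
      (ω : PureState Γ H).coord Λ fun v => conj f (A v) :=
  Q.push_isPush f ω Λ A

theorem isClosedEmbedding_push (f : H →ₗᵢ[ℂ] K) : Topology.IsClosedEmbedding (Q.push f) :=
  (Q.exists_push f).choose_spec.2

theorem push_eq {f : H →ₗᵢ[ℂ] K} {ω : Q.carrier H} {ω' : Q.carrier K}
    (h : IsPush f (ω : PureState Γ H) (ω' : PureState Γ K)) : Q.push f ω = ω' :=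
  Subtype.ext ((Q.push_isPush f ω).unique h)

theorem push_comp (g : K →ₗᵢ[ℂ] L) (f : H →ₗᵢ[ℂ] K) (ω : Q.carrier H) :
    Q.push (g.comp f) ω = Q.push g (Q.push f ω) :=
  Q.push_eq <| isPush_iff.2 fun Λ A => by
    rw [push_apply, push_apply]
    exact congrArg (fun B => (ω : PureState Γ H).coord Λ B)
      (funext fun v => (conj_conj g f (A v)).symm)

theorem push_id (ω : Q.carrier H) : Q.push LinearIsometry.id ω = ω :=
  Q.push_eq <| isPush_iff.2 fun Λ A => congrArg (fun B => (ω : PureState Γ H).coord Λ B)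
      (funext fun v => (conj_id (A v)).symm)

theorem push_congr_phase {f g : H →ₗᵢ[ℂ] K} {c : ℂ} (hc : ‖c‖ = 1) (h : ∀ x, f x = c • g x)
    (ω : Q.carrier H) : Q.push f ω = Q.push g ω :=
  Q.push_eq <| isPush_iff.2 fun Λ A => by
    rw [push_apply]
    exact congrArg (fun B => (ω : PureState Γ H).coord Λ B)
      (funext fun v => (conj_smul f g hc h (A v)).symm)

theorem continuous_push_path {X : Type*} [TopologicalSpace X] {f : X → (H →ₗᵢ[ℂ] K)}
    (hf : ∀ w, Continuous fun x => f x w) {ω : X → Q.carrier H} (hω : Continuous ω) :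
    Continuous fun x => Q.push (f x) (ω x) := by
  refine Topology.IsInducing.subtypeVal.continuous_iff.2
    (PureState.continuous_of_coord fun Λ A => ?_)
  simp only [Function.comp_apply, push_apply]
  refine PureState.continuous_coord (continuous_subtype_val.comp hω) Λ fun v w z => ?_
  simp only [inner_conj]
  exact (hf w).inner ((LinearMap.continuous_of_finiteDimensional (A v)).comp (hf z))

/-- The stacked state `ω ⊗ τ`. -/
def tens (ω : Q.carrier H) (τ : Q.carrier K) : Q.carrier (H.tensor K) :=
  ⟨(Q.exists_tensor ω τ).choose, (Q.exists_tensor ω τ).choose_spec.1⟩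

theorem tens_isTensor (ω : Q.carrier H) (τ : Q.carrier K) :
    IsTensor (ω : PureState Γ H) (τ : PureState Γ K)
      (Q.tens ω τ : PureState Γ (H.tensor K)) :=
  (Q.exists_tensor ω τ).choose_spec.2

theorem tens_apply (ω : Q.carrier H) (τ : Q.carrier K) (Λ : Finset Γ) (A : Γ → (H →ₗ[ℂ] H))
    (B : Γ → (K →ₗ[ℂ] K)) :
    (Q.tens ω τ : PureState Γ (H.tensor K)).coord Λ (fun v => tmap (A v) (B v)) =
      (ω : PureState Γ H).coord Λ A * (τ : PureState Γ K).coord Λ B :=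
  Q.tens_isTensor ω τ Λ A B

theorem tens_eq {ω : Q.carrier H} {τ : Q.carrier K} {σ : PureState Γ (H.tensor K)}
    (h : IsTensor (ω : PureState Γ H) (τ : PureState Γ K) σ) :
    (Q.tens ω τ : PureState Γ (H.tensor K)) = σ :=
  (Q.tens_isTensor ω τ).unique h

theorem continuous_tens :
    Continuous fun p : Q.carrier H × Q.carrier K => Q.tens p.1 p.2 := by
  refine Continuous.subtype_mk (PureState.continuous_of_tensor fun Λ A B => ?_) _
  have h : ∀ p : Q.carrier H × Q.carrier K, _ := fun p => Q.tens_apply p.1 p.2 Λ A B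
  refine (continuous_congr h).2 ?_
  exact ((WeakDual.eval_continuous _).comp (continuous_subtype_val.comp
    (continuous_subtype_val.comp continuous_fst))).mul
    ((WeakDual.eval_continuous _).comp (continuous_subtype_val.comp
    (continuous_subtype_val.comp continuous_snd)))

theorem push_mapIso_tens (f : H →ₗᵢ[ℂ] H') (g : K →ₗᵢ[ℂ] K') (ω : Q.carrier H)
    (τ : Q.carrier K) :
    Q.push (mapIso f g) (Q.tens ω τ) = Q.tens (Q.push f ω) (Q.push g τ) := by
  refine Subtype.ext (ext_tmap fun Λ A B => ?_)
  rw [push_apply, tens_apply, push_apply, push_apply, ← tens_apply]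
  exact congrArg (fun B => (Q.tens ω τ : PureState Γ (H.tensor K)).coord Λ B)
      (funext fun v => conj_mapIso f g (A v) (B v))

theorem push_assocIso_tens (ω : Q.carrier H) (τ : Q.carrier K) (υ : Q.carrier L) :
    Q.push (assocIso H K L) (Q.tens (Q.tens ω τ) υ) = Q.tens ω (Q.tens τ υ) := by
  refine Subtype.ext (ext_tmap_tmap fun Λ A B C => ?_)
  rw [push_apply, Q.tens_apply ω (Q.tens τ υ) Λ A fun v => tmap (B v) (C v), tens_apply,
    ← mul_assoc, ← tens_apply, ← Q.tens_apply (Q.tens ω τ) υ]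
  exact congrArg (fun B => (Q.tens (Q.tens ω τ) υ : PureState Γ _).coord Λ B)
      (funext fun v => conj_assocIso (A v) (B v) (C v))

theorem push_commIso_tens (ω : Q.carrier H) (τ : Q.carrier K) :
    Q.push (commIso H K) (Q.tens ω τ) = Q.tens τ ω := by
  refine Subtype.ext (ext_tmap fun Λ B A => ?_)
  rw [push_apply, tens_apply, mul_comm, ← tens_apply]
  exact congrArg (fun B => (Q.tens ω τ : PureState Γ (H.tensor K)).coord Λ B)
      (funext fun v => conj_commIso (A v) (B v))

/-- The factorized state with the unit vector `u` at every site. -/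
def fact (u : H) (hu : ‖u‖ = 1) : Q.carrier H :=
  ⟨(Q.exists_factorized H (fun _ => u) fun _ => hu).choose,
    (Q.exists_factorized H (fun _ => u) fun _ => hu).choose_spec.1⟩

theorem fact_apply (u : H) (hu : ‖u‖ = 1) (Λ : Finset Γ) (A : Γ → (H →ₗ[ℂ] H)) :
    (Q.fact u hu : PureState Γ H).coord Λ A = ∏ v ∈ Λ, ⟪u, A v u⟫_ℂ :=
  (Q.exists_factorized H (fun _ => u) fun _ => hu).choose_spec.2 Λ A

theorem push_fact (f : H →ₗᵢ[ℂ] K) (u : H) (hu : ‖u‖ = 1) :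
    Q.push f (Q.fact u hu) = Q.fact (f u) ((f.norm_map u).trans hu) := by
  refine Subtype.ext (PureState.ext_coord fun Λ A => ?_)
  rw [push_apply, fact_apply, fact_apply]
  exact Finset.prod_congr rfl fun v _ => inner_conj f (A v) u u

theorem fact_smul {u u' : H} (hu : ‖u‖ = 1) (hu' : ‖u'‖ = 1) {c : ℂ} (hc : ‖c‖ = 1)
    (h : u' = c • u) : Q.fact u' hu' = Q.fact u hu := by
  refine Subtype.ext (PureState.ext_coord fun Λ A => ?_)
  rw [fact_apply, fact_apply]
  refine Finset.prod_congr rfl fun v _ => ?_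
  rw [h, _root_.map_smul, inner_smul_left, inner_smul_right, ← mul_assoc, RCLike.conj_mul, hc]
  simp

/-- Stacking with a factorized state is itself a push along an isometry. Unit laws thereby become
comparisons of isometries, which `exists_homotopy_push` settles. -/
theorem tens_fact_left (u : H) (hu : ‖u‖ = 1) (ω : Q.carrier K) :
    Q.tens (Q.fact u hu) ω = Q.push (tmulLeft u hu K) ω := by
  refine Subtype.ext (ext_tmap fun Λ A B => ?_)
  rw [push_apply, tens_apply, fact_apply]
  simp only [conj_tmulLeft]
  rw [PureState.coord_smul]

theorem tens_fact_right (u : H) (hu : ‖u‖ = 1) (ω : Q.carrier K) :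
    Q.tens ω (Q.fact u hu) = Q.push (tmulRight u hu K) ω := by
  refine Subtype.ext (ext_tmap fun Λ A B => ?_)
  rw [push_apply, tens_apply, fact_apply]
  simp only [conj_tmulRight]
  rw [PureState.coord_smul, mul_comm]

/-- `𝒬_Γ(f)` as a continuous map. -/
def pushC (f : H →ₗᵢ[ℂ] K) : C(Q.carrier H, Q.carrier K) :=
  ⟨Q.push f, (Q.isClosedEmbedding_push f).continuous⟩

/-- Stacking as a continuous map. -/
def tensC (H K : FinHilb) : C(Q.carrier H × Q.carrier K, Q.carrier (H.tensor K)) :=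
  ⟨fun p => Q.tens p.1 p.2, Q.continuous_tens⟩

/-- The map induced by a path of isometries. -/
def pushPath {P : unitInterval → (H →ₗᵢ[ℂ] K)} (hP : ∀ x, Continuous fun t => P t x) :
    C(unitInterval × Q.carrier H, Q.carrier K) :=
  ⟨fun p => Q.push (P p.1) p.2,
    Q.continuous_push_path (fun w => (hP w).comp continuous_fst) continuous_snd⟩

/-- The maps induced by two isometries are homotopic, by a homotopy which is constant on the
factorized states of the vectors on which the isometries agree. -/
theorem exists_homotopy_push (f g : H →ₗᵢ[ℂ] K) :
    ∃ F : ContinuousMap.Homotopy (Q.pushC f) (Q.pushC g),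
      ∀ (u : H) (hu : ‖u‖ = 1), f u = g u →
        ∀ t, F (t, Q.fact u hu) = Q.push f (Q.fact u hu) := by
  refine (LinearIsometry.exists_path f g).elim fun P hP' => ?_
  have hP := hP'.1
  have hP0 := hP'.2.1
  have hPfix := hP'.2.2.2
  refine hP'.2.2.1.elim fun c hc' => ?_
  have hc := hc'.1
  have hP1 := hc'.2
  have h0 : ∀ ω, Q.pushPath hP (0, ω) = Q.pushC f ω := fun ω =>
    congrArg (fun f => Q.push f ω) hP0
  have h1 : ∀ ω, Q.pushPath hP (1, ω) = Q.pushC g ω := fun ω => Q.push_congr_phase hc hP1 ω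
  refine ⟨⟨Q.pushPath hP, h0, h1⟩, fun u hu hfg t => ?_⟩
  refine (hPfix u hfg t).elim fun c h => ?_
  have h2 : Q.push (P t) (Q.fact u hu) = Q.push f (Q.fact u hu) := by
    rw [push_fact, push_fact]
    exact Q.fact_smul _ _ h.1 h.2
  exact h2

theorem pushC_homotopic (f g : H →ₗᵢ[ℂ] K) : (Q.pushC f).Homotopic (Q.pushC g) :=
  ⟨(Q.exists_homotopy_push f g).choose⟩

instance : T2Space (PureState Γ H) := inferInstance

end QuantumStateType

/-! ### Sequential colimits along a self-map -/

section Telescope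

open Function

variable {T : Type*} {S : T → T} {r : T → T → Prop} {d : T → ℕ}

theorem degree_iterate (hdS : ∀ x, d (S x) = d x + 1) (n : ℕ) (x : T) :
    d (S^[n] x) = d x + n := by
  induction n generalizing x with
  | zero => rfl
  | succ n ih => rw [iterate_succ_apply, ih, hdS]; omega

/-- As `r` is the graph of a map, the equivalence relation it generates is that forward orbits meet.
This is transitive because iterates of `S` commute. -/
theorem quot_mk_eq_iff_of_graph (hr : ∀ x y, r x y ↔ y = S x) {x y : T} :
    Quot.mk r x = Quot.mk r y ↔ ∃ m n : ℕ, S^[m] x = S^[n] y := by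
  have hmk : ∀ (n : ℕ) (x : T), Quot.mk r (S^[n] x) = Quot.mk r x := by
    intro n
    induction n with
    | zero => intro x; rfl
    | succ n ih =>
      intro x
      rw [iterate_succ_apply, ih]
      exact (Quot.sound ((hr _ _).2 rfl)).symm
  constructor
  · intro h
    have h' := Quot.eqvGen_exact h
    clear h
    induction h' with
    | rel x y h => exact ⟨1, 0, ((hr _ _).1 h).symm⟩
    | refl x => exact ⟨0, 0, rfl⟩
    | symm x y _ ih =>
      obtain ⟨m, n, h⟩ := ih
      exact ⟨n, m, h.symm⟩
    | trans x y z _ _ ih₁ ih₂ =>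
      obtain ⟨m, n, h⟩ := ih₁
      obtain ⟨m', n', h'⟩ := ih₂
      refine ⟨m' + m, n + n', ?_⟩
      rw [iterate_add_apply, h, ← iterate_add_apply, Nat.add_comm, iterate_add_apply, h',
        ← iterate_add_apply]
  · rintro ⟨m, n, h⟩
    rw [← hmk m x, ← hmk n y, h]

/-- The degree records the number of steps, so orbits that meet do so with step counts differing by
`k`; injectivity of `S` cancels the common iterate. -/
theorem quot_mk_eq_iff_of_degree_eq (hr : ∀ x y, r x y ↔ y = S x) (hS : Injective S)
    (hdS : ∀ x, d (S x) = d x + 1) {x y : T} (k : ℕ) (h : d y = d x + k) :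
    Quot.mk r x = Quot.mk r y ↔ S^[k] x = y := by
  rw [quot_mk_eq_iff_of_graph hr]
  constructor
  · rintro ⟨m, n, hmn⟩
    have h1 := congrArg d hmn
    rw [degree_iterate hdS, degree_iterate hdS] at h1
    have h2 : m = n + k := by omega
    rw [h2, iterate_add_apply] at hmn
    exact hS.iterate n hmn
  · intro h
    exact ⟨k, 0, h⟩

variable [TopologicalSpace T]

/-- The fibres of `d` form a locally finite cover by clopen sets. -/
theorem isClosed_of_degree (hd : Continuous d) {F : Set T}
    (h : ∀ n, IsClosed (F ∩ d ⁻¹' {n})) : IsClosed F := by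
  have h1 : F = ⋃ n, F ∩ d ⁻¹' {n} := by
    ext x
    simp
  rw [h1]
  refine LocallyFinite.isClosed_iUnion (fun x => ?_) h
  refine ⟨d ⁻¹' {d x}, hd.continuousAt.preimage_mem_nhds (by simp), ?_⟩
  refine (Set.finite_singleton (d x)).subset ?_
  rintro n ⟨y, ⟨_, hy⟩, hy'⟩
  exact hy.symm.trans hy'

/-- A set in the colimit is closed when its preimage is closed in each degree. For the image of `F`
in degree `n`, the preimage is S^k(F) in degree n + k, closed because `S` is a closed map, and the
inverse image of `F` under S^k in degree n − k. -/
theorem isClosedEmbedding_quot_mk (hr : ∀ x y, r x y ↔ y = S x)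
    (hS : Topology.IsClosedEmbedding S) (hd : Continuous d) (hdS : ∀ x, d (S x) = d x + 1)
    (n : ℕ) : Topology.IsClosedEmbedding fun x : {x : T // d x = n} => Quot.mk r x.1 := by
  refine Topology.IsClosedEmbedding.of_continuous_injective_isClosedMap
    (continuous_quot_mk.comp continuous_subtype_val) ?_ ?_
  · intro x y h
    exact Subtype.ext ((quot_mk_eq_iff_of_degree_eq hr hS.injective hdS 0
      (by rw [x.2, y.2]; rfl)).1 h)
  · intro F hF
    have hn : ∀ n, IsClosed (d ⁻¹' {n}) := fun n => (isClosed_discrete _).preimage hd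
    have hF' : IsClosed (Subtype.val '' F) := (hn n).isClosedEmbedding_subtypeVal.isClosedMap F hF
    have hSk : ∀ k, Topology.IsClosedEmbedding S^[k] := by
      intro k
      induction k with
      | zero => exact Topology.IsClosedEmbedding.id
      | succ k ih => exact ih.comp hS
    refine isClosed_coinduced.2 (isClosed_of_degree hd fun m => ?_)
    rcases le_total n m with hnm | hnm
    · obtain ⟨k, rfl⟩ := Nat.exists_eq_add_of_le hnm
      convert (hSk k).isClosedMap _ hF' using 1
      ext y
      constructor
      · rintro ⟨⟨x, hx, hxy⟩, hy⟩
        refine ⟨x, ⟨x, hx, rfl⟩, ?_⟩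
        exact (quot_mk_eq_iff_of_degree_eq hr hS.injective hdS k
          (by rw [x.2]; exact hy)).1 hxy
      · rintro ⟨_, ⟨x, hx, rfl⟩, rfl⟩
        have h1 : d (S^[k] x) = d x + k := degree_iterate hdS k _
        exact ⟨⟨x, hx, (quot_mk_eq_iff_of_degree_eq hr hS.injective hdS k h1).2 rfl⟩,
          h1.trans (by rw [x.2])⟩
    · obtain ⟨k, rfl⟩ := Nat.exists_eq_add_of_le hnm
      convert (hF'.preimage (hSk k).continuous).inter (hn m) using 1
      ext y
      refine and_congr_left fun hy => ?_
      have hy : d y = m := hy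
      constructor
      · rintro ⟨x, hx, hxy⟩
        refine ⟨x, hx, ?_⟩
        exact ((quot_mk_eq_iff_of_degree_eq hr hS.injective hdS k
          (by rw [x.2, hy])).1 hxy.symm).symm
      · rintro ⟨x, hx, hxy⟩
        exact ⟨x, hx, ((quot_mk_eq_iff_of_degree_eq hr hS.injective hdS k
          (by rw [x.2, hy])).2 hxy.symm).symm⟩

theorem exists_lift_of_isEmbedding {X A B : Type*} [TopologicalSpace X] [TopologicalSpace A]
    [TopologicalSpace B] {e : A → B} (he : Topology.IsEmbedding e) (f : C(X, B))
    (h : ∀ x, f x ∈ Set.range e) : ∃ g : C(X, A), ∀ x, e (g x) = f x := by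
  choose g hg using h
  refine ⟨⟨g, he.continuous_iff.2 ?_⟩, hg⟩
  have : e ∘ g = f := funext hg
  rw [this]
  exact f.continuous

/-- Otherwise each stage `n` misses some f(x n). Every tail of this sequence meets each stage in a
finite set, hence is closed, and compactness gives a point `p` whose image lies in all tails. But
f(p) lies in some stage, and equals f(x n) for an `n` beyond it, so f(x n) lies in stage `n` after
all. -/
theorem exists_lift_quot_of_compact [T1Space T] (hr : ∀ x y, r x y ↔ y = S x)
    (hS : Topology.IsClosedEmbedding S) (hd : Continuous d) (hdS : ∀ x, d (S x) = d x + 1)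
    {X : Type*} [TopologicalSpace X] [CompactSpace X] (f : C(X, Quot r)) :
    ∃ N : ℕ, ∀ n, N ≤ n → ∃ g : C(X, T), (∀ x, d (g x) = n) ∧ ∀ x, Quot.mk r (g x) = f x := by
  have hmono : ∀ m n, m ≤ n → ∀ y : T, d y = m → ∃ z : T, d z = n ∧ Quot.mk r z = Quot.mk r y := by
    intro m n hmn y hy
    obtain ⟨k, rfl⟩ := Nat.exists_eq_add_of_le hmn
    have h1 := degree_iterate hdS k y
    exact ⟨S^[k] y, by rw [h1, hy],
      ((quot_mk_eq_iff_of_degree_eq hr hS.injective hdS k h1).2 rfl).symm⟩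
  suffices h : ∃ N : ℕ, ∀ x, ∃ y : T, d y = N ∧ Quot.mk r y = f x by
    obtain ⟨N, hN⟩ := h
    refine ⟨N, fun n hn => ?_⟩
    obtain ⟨g, hg⟩ := exists_lift_of_isEmbedding
      (isClosedEmbedding_quot_mk hr hS hd hdS n).isEmbedding f fun x => by
        obtain ⟨y, hy, hyx⟩ := hN x
        obtain ⟨z, hz, hzy⟩ := hmono N n hn y hy
        exact ⟨⟨z, hz⟩, hzy.trans hyx⟩
    exact ⟨⟨fun x => (g x).1, continuous_subtype_val.comp g.continuous⟩, fun x => (g x).2, hg⟩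
  by_contra hne
  push Not at hne
  choose x hx using hne
  let A : ℕ → Set (Quot r) := fun k => (fun n => f (x n)) '' Set.Ici k
  have hA : ∀ k, IsClosed (A k) := by
    intro k
    refine isClosed_coinduced.2 (isClosed_of_degree hd fun m => Set.Finite.isClosed ?_)
    refine Set.Finite.of_finite_image (f := Quot.mk r) ?_ ?_
    · refine ((Set.finite_lt_nat m).image fun n => f (x n)).subset ?_
      rintro _ ⟨y, ⟨⟨n, hn, hny⟩, hy⟩, rfl⟩
      refine ⟨n, ?_, hny⟩
      by_contra hlt
      obtain ⟨z, hz, hzy⟩ := hmono m n (not_lt.1 hlt) y hy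
      exact hx n z hz (hzy.trans hny.symm)
    · rintro y ⟨_, hy⟩ z ⟨_, hz⟩ hyz
      have hy : d y = m := hy
      have hz : d z = m := hz
      exact (quot_mk_eq_iff_of_degree_eq hr hS.injective hdS 0 (by rw [hy, hz]; rfl)).1 hyz
  obtain ⟨p, hp⟩ := IsCompact.nonempty_iInter_of_sequence_nonempty_isCompact_isClosed
    (fun k => f ⁻¹' A k) (fun k => Set.preimage_mono (Set.image_mono (Set.Ici_subset_Ici.2
      (Nat.le_succ k)))) (fun k => ⟨x k, k, Set.mem_Ici.2 le_rfl, rfl⟩)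
    ((hA 0).preimage f.continuous).isCompact (fun k => (hA k).preimage f.continuous)
  obtain ⟨y, hy⟩ := Quot.exists_rep (f p)
  obtain ⟨n, hn, hnp⟩ := Set.mem_iInter.1 hp (d y)
  obtain ⟨z, hz, hzy⟩ := hmono (d y) n hn y rfl
  exact hx n z hz (hzy.trans (hy.trans hnp.symm))

end Telescope

/-! ### Homotopies on disjoint unions -/

section Sigma

variable {ι X Y : Type*} {Z : ι → Type*} [TopologicalSpace X] [TopologicalSpace Y]
  [∀ i, TopologicalSpace (Z i)]

theorem isHomeomorph_sigma_desc {e : ∀ i, Z i → X} (he : ∀ i, Topology.IsOpenEmbedding (e i))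
    (hb : Function.Bijective fun p : Σ i, Z i => e p.1 p.2) :
    IsHomeomorph fun p : Σ i, Z i => e p.1 p.2 :=
  ⟨continuous_sigma fun i => (he i).continuous, isOpenMap_sigma.2 fun i => (he i).isOpenMap, hb⟩

theorem continuous_of_sigma_cover {e : ∀ i, Z i → X} (he : ∀ i, Topology.IsOpenEmbedding (e i))
    (hs : ∀ x, ∃ i z, e i z = x) {f : X → Y} (hf : ∀ i, Continuous fun z => f (e i z)) :
    Continuous f := by
  refine continuous_iff_continuousAt.2 fun x => ?_
  obtain ⟨i, z, rfl⟩ := hs x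
  exact (he i).continuousAt_iff.1 (hf i).continuousAt

/-- Homotopies chosen independently on the pieces assemble, because the product with the interval
distributes over a disjoint union. -/
theorem homotopic_of_sigma_cover {e : ∀ i, Z i → X} (he : ∀ i, Topology.IsOpenEmbedding (e i))
    (hb : Function.Bijective fun p : Σ i, Z i => e p.1 p.2) {F G : C(X, Y)}
    (h : ∀ i, (F.comp ⟨e i, (he i).continuous⟩).Homotopic (G.comp ⟨e i, (he i).continuous⟩)) :
    F.Homotopic G := by
  let K := fun i => (h i).some
  let φ := (isHomeomorph_sigma_desc he hb).homeomorph
  let K' : C(unitInterval × X, Y) := ⟨fun p => K (φ.symm p.2).1 (p.1, (φ.symm p.2).2), by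
    have h1 : Continuous fun p : (Σ i, Z i) × unitInterval => K p.1.1 (p.2, p.1.2) := by
      refine (Homeomorph.sigmaProdDistrib (X := Z) (Y := unitInterval)).symm.comp_continuous_iff'.1 ?_
      exact continuous_sigma fun i => (K i).continuous.comp (continuous_snd.prodMk continuous_fst)
    exact h1.comp ((φ.symm.continuous.comp continuous_snd).prodMk continuous_fst)⟩
  have hφ : ∀ x, e (φ.symm x).1 (φ.symm x).2 = x := fun x => φ.apply_symm_apply x
  refine ⟨⟨K', fun x => ?_, fun x => ?_⟩⟩
  · change K (φ.symm x).1 (0, (φ.symm x).2) = F x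
    rw [(K _).apply_zero]
    exact congrArg F (hφ x)
  · change K (φ.symm x).1 (1, (φ.symm x).2) = G x
    rw [(K _).apply_one]
    exact congrArg G (hφ x)

end Sigma

/-! ### Gluing along a collar -/

section Collar

variable {Z Y : Type*} [TopologicalSpace Z] [TopologicalSpace Y]

theorem exists_paste₃ {P N R : Set Z} (hP : IsClosed P) (hN : IsClosed N) (hR : IsClosed R)
    (hcov : ∀ x, x ∈ P ∨ x ∈ N ∨ x ∈ R) (f : C(P, Y)) (g : C(N, Y)) (h : C(R, Y))
    (hfg : ∀ x (h₁ : x ∈ P) (h₂ : x ∈ N), f ⟨x, h₁⟩ = g ⟨x, h₂⟩)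
    (hfh : ∀ x (h₁ : x ∈ P) (h₂ : x ∈ R), f ⟨x, h₁⟩ = h ⟨x, h₂⟩)
    (hgh : ∀ x (h₁ : x ∈ N) (h₂ : x ∈ R), g ⟨x, h₁⟩ = h ⟨x, h₂⟩) :
    ∃ z : C(Z, Y), (∀ x (hx : x ∈ P), z x = f ⟨x, hx⟩) ∧ (∀ x (hx : x ∈ N), z x = g ⟨x, hx⟩) ∧
      ∀ x (hx : x ∈ R), z x = h ⟨x, hx⟩ := by
  have hex : ∀ x, ∃ y, (∀ hx : x ∈ P, y = f ⟨x, hx⟩) ∧ (∀ hx : x ∈ N, y = g ⟨x, hx⟩) ∧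
      ∀ hx : x ∈ R, y = h ⟨x, hx⟩ := by
    intro x
    rcases hcov x with hx | hx | hx
    · exact ⟨f ⟨x, hx⟩, fun _ => rfl, fun h' => hfg x hx h', fun h' => hfh x hx h'⟩
    · exact ⟨g ⟨x, hx⟩, fun h' => (hfg x h' hx).symm, fun _ => rfl, fun h' => hgh x hx h'⟩
    · exact ⟨h ⟨x, hx⟩, fun h' => (hfh x h' hx).symm, fun h' => (hgh x h' hx).symm, fun _ => rfl⟩
  choose z hz₁ hz₂ hz₃ using hex
  have hcont : Continuous z := by
    rw [← continuousOn_univ]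
    have huniv : (Set.univ : Set Z) = (P ∪ N) ∪ R := by
      ext x
      simpa [or_assoc] using hcov x
    rw [huniv]
    refine ContinuousOn.union_of_isClosed (ContinuousOn.union_of_isClosed ?_ ?_ hP hN) ?_
      (hP.union hN) hR
    · rw [continuousOn_iff_continuous_domRestrict]
      exact (continuous_congr fun x : P => hz₁ x x.2).2 f.continuous
    · rw [continuousOn_iff_continuous_domRestrict]
      exact (continuous_congr fun x : N => hz₂ x x.2).2 g.continuous
    · rw [continuousOn_iff_continuous_domRestrict]
      exact (continuous_congr fun x : R => hz₃ x x.2).2 h.continuous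
  exact ⟨⟨z, hcont⟩, hz₁, hz₂, hz₃⟩

theorem exists_paste₂ {P N : Set Z} (hP : IsClosed P) (hN : IsClosed N)
    (hcov : ∀ x, x ∈ P ∨ x ∈ N) (f : C(P, Y)) (g : C(N, Y))
    (hfg : ∀ x (h₁ : x ∈ P) (h₂ : x ∈ N), f ⟨x, h₁⟩ = g ⟨x, h₂⟩) :
    ∃ z : C(Z, Y), (∀ x (hx : x ∈ P), z x = f ⟨x, hx⟩) ∧ ∀ x (hx : x ∈ N), z x = g ⟨x, hx⟩ := by
  obtain ⟨z, h₁, h₂, _⟩ := exists_paste₃ hP hN hN (fun x => (hcov x).imp_right Or.inl) f g g hfg hfg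
    fun _ _ _ => rfl
  exact ⟨z, h₁, h₂⟩

/-- The retraction of the real line onto the unit interval. -/
def clampI : C(ℝ, unitInterval) := ⟨Set.projIcc 0 1 zero_le_one, continuous_projIcc⟩

theorem clampI_of_le_zero {t : ℝ} (h : t ≤ 0) : clampI t = 0 := Set.projIcc_of_le_left zero_le_one h

theorem clampI_of_one_le {t : ℝ} (h : 1 ≤ t) : clampI t = 1 := Set.projIcc_of_right_le zero_le_one h

variable (lam : C(Z, ℝ))

/-- The part `λ ≤ 1`. -/
def lowPart : Set Z := {x | lam x ≤ 1}

/-- The part `0 ≤ λ`. -/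
def highPart : Set Z := {x | 0 ≤ lam x}

/-- The collar `0 ≤ λ ≤ 1`. -/
def collar : Set Z := {x | 0 ≤ lam x ∧ lam x ≤ 1}

theorem isClosed_lowPart : IsClosed (lowPart lam) := isClosed_le lam.continuous continuous_const

theorem isClosed_highPart : IsClosed (highPart lam) := isClosed_le continuous_const lam.continuous

theorem isClosed_collar : IsClosed (collar lam) :=
  (isClosed_highPart lam).inter (isClosed_lowPart lam)

/-- The inclusion of a subspace. -/
def inclC (s : Set Z) : C(s, Z) := ⟨Subtype.val, continuous_subtype_val⟩

/-- The inclusion of the collar in the part `λ ≤ 1`. -/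
def collarLow : C(collar lam, lowPart lam) :=
  ⟨fun x => ⟨x, x.2.2⟩, continuous_subtype_val.subtype_mk _⟩

/-- The inclusion of the collar in the part `0 ≤ λ`. -/
def collarHigh : C(collar lam, highPart lam) :=
  ⟨fun x => ⟨x, x.2.1⟩, continuous_subtype_val.subtype_mk _⟩

/-- Use `a` below the collar, `b` above it, and on the collar the homotopy `K` at time λ. The result
deforms to `a` on the low part by rescaling the time to tλ, and to `b` on the high part by rescaling
it to 1 − t(1 − λ). -/
theorem exists_glue_of_homotopic (a : C(lowPart lam, Y)) (b : C(highPart lam, Y))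
    (h : (a.comp (collarLow lam)).Homotopic (b.comp (collarHigh lam))) :
    ∃ z : C(Z, Y), (z.comp (inclC (lowPart lam))).Homotopic a ∧
      (z.comp (inclC (highPart lam))).Homotopic b := by
  obtain ⟨K⟩ := h
  have hK0 : ∀ x hx, K (0, ⟨x, hx⟩) = a ⟨x, hx.2⟩ := fun x hx => K.apply_zero ⟨x, hx⟩
  have hK1 : ∀ x hx, K (1, ⟨x, hx⟩) = b ⟨x, hx.1⟩ := fun x hx => K.apply_one ⟨x, hx⟩
  have hK0' : ∀ (t : ℝ) (x : Z) (hx : x ∈ collar lam), t ≤ 0 →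
      K (clampI t, ⟨x, hx⟩) = a ⟨x, hx.2⟩ := fun t x hx ht => by
    rw [clampI_of_le_zero ht, hK0]
  have hK1' : ∀ (t : ℝ) (x : Z) (hx : x ∈ collar lam), 1 ≤ t →
      K (clampI t, ⟨x, hx⟩) = b ⟨x, hx.1⟩ := fun t x hx ht => by
    rw [clampI_of_one_le ht, hK1]
  obtain ⟨z, hz1, hz2, hz3⟩ := exists_paste₃ (Y := Y) (P := {x | lam x ≤ 0}) (N := {x | 1 ≤ lam x})
    (R := collar lam) (isClosed_le lam.continuous continuous_const)
    (isClosed_le continuous_const lam.continuous) (isClosed_collar lam)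
    (fun x => by
      rcases le_total (lam x) 0 with h | h
      · exact Or.inl h
      · rcases le_total (lam x) 1 with h' | h'
        · exact Or.inr (Or.inr ⟨h, h'⟩)
        · exact Or.inr (Or.inl h'))
    ⟨fun x => a ⟨x, le_trans (show lam x ≤ 0 from x.2) zero_le_one⟩,
      a.continuous.comp (continuous_subtype_val.subtype_mk _)⟩
    ⟨fun x => b ⟨x, le_trans zero_le_one (show 1 ≤ lam x from x.2)⟩,
      b.continuous.comp (continuous_subtype_val.subtype_mk _)⟩
    ⟨fun x => K (clampI (lam x), x), by fun_prop⟩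
    (fun x h1 h2 => by
      have h1 : lam x ≤ 0 := h1
      have h2 : 1 ≤ lam x := h2
      linarith)
    (fun x h1 h2 => by
      change a _ = K (clampI (lam x), _)
      rw [clampI_of_le_zero h1, hK0])
    (fun x h1 h2 => by
      change b _ = K (clampI (lam x), _)
      rw [clampI_of_one_le h1, hK1])
  refine ⟨z, ?_, ?_⟩
  · obtain ⟨F, hF1, hF2⟩ := exists_paste₂ (Y := Y)
      (P := {p : unitInterval × lowPart lam | lam p.2 ≤ 0})
      (N := {p : unitInterval × lowPart lam | 0 ≤ lam p.2})
      (isClosed_le (by fun_prop) continuous_const) (isClosed_le continuous_const (by fun_prop))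
      (fun x => le_total (lam x.2) 0)
      ⟨fun p => a p.1.2, by fun_prop⟩
      ⟨fun p => K (clampI ((p.1.1 : ℝ) * lam p.1.2),
        ⟨p.1.2, (show 0 ≤ lam p.1.2 from p.2), (show lam p.1.2 ≤ 1 from p.1.2.2)⟩), by fun_prop⟩
      (fun p h1 h2 => by
        have h0 : lam p.2 = 0 := le_antisymm (show lam p.2 ≤ 0 from h1) h2
        exact (hK0' _ p.2 _ (show (p.1 : ℝ) * lam p.2 ≤ 0 by rw [h0, mul_zero])).symm)
    refine ContinuousMap.Homotopic.symm ⟨⟨F, fun x => ?_, fun x => ?_⟩⟩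
    · rcases le_total (lam x) 0 with h | h
      · exact hF1 (0, x) h
      · refine (hF2 (0, x) h).trans ?_
        exact hK0' _ x _ (show (0 : ℝ) * lam x ≤ 0 by rw [zero_mul])
    · rcases le_total (lam x) 0 with h | h
      · exact (hF1 (1, x) h).trans (hz1 x h).symm
      · refine (hF2 (1, x) h).trans ?_
        change K (clampI ((1 : ℝ) * lam x), _) = z x
        rw [one_mul, hz3 x ⟨h, x.2⟩]
        rfl
  · obtain ⟨F, hF1, hF2⟩ := exists_paste₂ (Y := Y)
      (P := {p : unitInterval × highPart lam | 1 ≤ lam p.2})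
      (N := {p : unitInterval × highPart lam | lam p.2 ≤ 1})
      (isClosed_le continuous_const (by fun_prop)) (isClosed_le (by fun_prop) continuous_const)
      (fun x => le_total 1 (lam x.2))
      ⟨fun p => b p.1.2, by fun_prop⟩
      ⟨fun p => K (clampI (1 - (p.1.1 : ℝ) * (1 - lam p.1.2)),
        ⟨p.1.2, (show 0 ≤ lam p.1.2 from p.1.2.2), (show lam p.1.2 ≤ 1 from p.2)⟩), by fun_prop⟩
      (fun p h1 h2 => by
        have h0 : lam p.2 = 1 := le_antisymm (show lam p.2 ≤ 1 from h2) h1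
        exact (hK1' _ p.2 _ (show 1 ≤ 1 - (p.1 : ℝ) * (1 - lam p.2) by
          rw [h0, sub_self, mul_zero, sub_zero])).symm)
    refine ContinuousMap.Homotopic.symm ⟨⟨F, fun x => ?_, fun x => ?_⟩⟩
    · rcases le_total 1 (lam x) with h | h
      · exact hF1 (0, x) h
      · refine (hF2 (0, x) h).trans ?_
        exact hK1' _ x _ (show 1 ≤ 1 - (0 : ℝ) * (1 - lam x) by rw [zero_mul, sub_zero])
    · rcases le_total 1 (lam x) with h | h
      · exact (hF1 (1, x) h).trans (hz2 x h).symm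
      · refine (hF2 (1, x) h).trans ?_
        change K (clampI (1 - (1 : ℝ) * (1 - lam x)), _) = z x
        rw [one_mul, sub_sub_cancel, hz3 x ⟨x.2, h⟩]
        rfl

/-- `w` is obtained from the family of loops `γ` parametrized by the collar: `w x = γ (λ x) x` on
the collar, and `w` is constant outside. -/
def IsLoopMap (e : Y) (γ : C(unitInterval × collar lam, Y)) (w : C(Z, Y)) : Prop :=
  (∀ x (hx : x ∈ collar lam), w x = γ (clampI (lam x), ⟨x, hx⟩)) ∧ ∀ x, x ∉ collar lam → w x = e

/-- Over a collar point `x`, the two null-homotopies joined at w x form a loop at `e`: `HA` runs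
from `e` to w x, then `HB` returns to `e`. Sliding the value of `w` along these paths until it sits
at loop time λ deforms `w` to the loop map; outside the collar the value has then reached `e`. -/
theorem exists_homotopic_isLoopMap (e : Y) (w : C(Z, Y))
    (hA : (w.comp (inclC (lowPart lam))).Homotopic (ContinuousMap.const _ e))
    (hB : (w.comp (inclC (highPart lam))).Homotopic (ContinuousMap.const _ e)) :
    ∃ (γ : C(unitInterval × collar lam, Y)) (w' : C(Z, Y)), (∀ x, γ (0, x) = e) ∧
      (∀ x, γ (1, x) = e) ∧ IsLoopMap lam e γ w' ∧ w.Homotopic w' := by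
  obtain ⟨HA⟩ := hA.symm
  obtain ⟨HB⟩ := hB
  have hA0 : ∀ x, HA (0, x) = e := fun x => HA.apply_zero x
  have hA1 : ∀ x, HA (1, x) = w x := fun x => HA.apply_one x
  have hB0 : ∀ x, HB (0, x) = w x := fun x => HB.apply_zero x
  have hB1 : ∀ x, HB (1, x) = e := fun x => HB.apply_one x
  have hA1' : ∀ (t : ℝ) (x : Z) (hx : x ∈ lowPart lam), 1 ≤ t → HA (clampI t, ⟨x, hx⟩) = w x :=
    fun t x hx ht => by rw [clampI_of_one_le ht, hA1]
  have hB0' : ∀ (t : ℝ) (x : Z) (hx : x ∈ highPart lam), t ≤ 0 → HB (clampI t, ⟨x, hx⟩) = w x :=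
    fun t x hx ht => by rw [clampI_of_le_zero ht, hB0]
  obtain ⟨γ, hγ1, hγ2⟩ := exists_paste₂ (Y := Y)
    (P := {p : unitInterval × collar lam | (p.1 : ℝ) ≤ 1 / 2})
    (N := {p : unitInterval × collar lam | 1 / 2 ≤ (p.1 : ℝ)})
    (isClosed_le (by fun_prop) continuous_const) (isClosed_le continuous_const (by fun_prop))
    (fun x => le_total (x.1 : ℝ) (1 / 2))
    ⟨fun p => HA (clampI (2 * (p.1.1 : ℝ)), collarLow lam p.1.2), by fun_prop⟩
    ⟨fun p => HB (clampI (2 * (p.1.1 : ℝ) - 1), collarHigh lam p.1.2), by fun_prop⟩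
    (fun p h1 h2 => by
      change HA (clampI (2 * (p.1 : ℝ)), _) = HB (clampI (2 * (p.1 : ℝ) - 1), _)
      rw [le_antisymm (show (p.1 : ℝ) ≤ 1 / 2 from h1) h2, clampI_of_one_le (by norm_num),
        clampI_of_le_zero (by norm_num), hA1, hB0]
      rfl)
  obtain ⟨G, hG1, hG2⟩ := exists_paste₂ (Y := Y)
    (P := {p : unitInterval × Z | lam p.2 ≤ 1 / 2})
    (N := {p : unitInterval × Z | 1 / 2 ≤ lam p.2})
    (isClosed_le (by fun_prop) continuous_const) (isClosed_le continuous_const (by fun_prop))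
    (fun x => le_total (lam x.2) (1 / 2))
    -- The time runs from 1, where `HA` is `w`, to 2λ, where it is the first half of the loop. On
    -- the other side the time of `HB` runs from 0 to 2λ − 1; the two formulas both give `w` at λ =
    -- 1/2.
    ⟨fun p => HA (clampI (1 - (p.1.1 : ℝ) + p.1.1 * (2 * lam p.1.2)),
      ⟨p.1.2, le_trans (show lam p.1.2 ≤ 1 / 2 from p.2) (by norm_num)⟩),
      HA.continuous.comp ((clampI.continuous.comp (by fun_prop)).prodMk
        (Continuous.subtype_mk (by fun_prop) _))⟩
    ⟨fun p => HB (clampI ((p.1.1 : ℝ) * (2 * lam p.1.2 - 1)),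
      ⟨p.1.2, le_trans (by norm_num) (show 1 / 2 ≤ lam p.1.2 from p.2)⟩),
      HB.continuous.comp ((clampI.continuous.comp (by fun_prop)).prodMk
        (Continuous.subtype_mk (by fun_prop) _))⟩
    (fun p h1 h2 => by
      have h0 : lam p.2 = 1 / 2 := le_antisymm (show lam p.2 ≤ 1 / 2 from h1) h2
      exact (hA1' _ p.2 _ (show 1 ≤ 1 - (p.1 : ℝ) + p.1 * (2 * lam p.2) by rw [h0]; linarith)).trans
        (hB0' _ p.2 _ (show (p.1 : ℝ) * (2 * lam p.2 - 1) ≤ 0 by rw [h0]; linarith)).symm)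
  have hG1' : ∀ x (h : lam x ≤ 1 / 2), G (1, x) = HA (clampI (2 * lam x),
      ⟨x, h.trans (by norm_num)⟩) := by
    intro x h
    refine (hG1 (1, x) h).trans ?_
    change HA (clampI (1 - (1 : ℝ) + 1 * (2 * lam x)), _) = _
    rw [sub_self, zero_add, one_mul]
  have hG2' : ∀ x (h : 1 / 2 ≤ lam x), G (1, x) = HB (clampI (2 * lam x - 1),
      ⟨x, le_trans (by norm_num) h⟩) := by
    intro x h
    refine (hG2 (1, x) h).trans ?_
    change HB (clampI ((1 : ℝ) * (2 * lam x - 1)), _) = _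
    rw [one_mul]
  refine ⟨γ, ⟨fun x => G (1, x), by fun_prop⟩, fun x => ?_, fun x => ?_, ⟨fun x hx => ?_,
    fun x hx => ?_⟩, ⟨⟨G, fun x => ?_, fun x => rfl⟩⟩⟩
  · refine (hγ1 (0, x) (by simp)).trans ?_
    change HA (clampI (2 * (0 : ℝ)), _) = e
    rw [mul_zero, clampI_of_le_zero le_rfl, hA0]
  · refine (hγ2 (1, x) (by simp; norm_num)).trans ?_
    change HB (clampI (2 * (1 : ℝ) - 1), _) = e
    rw [clampI_of_one_le (by norm_num), hB1]
  · change G (1, x) = _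
    have hcl : ((clampI (lam x) : unitInterval) : ℝ) = lam x := by
      have := Set.projIcc_of_mem (zero_le_one (α := ℝ)) hx
      exact congrArg Subtype.val this
    rcases le_total (lam x) (1 / 2) with h | h
    · rw [hG1' x h, hγ1 (clampI (lam x), ⟨x, hx⟩) (by simpa [hcl] using h)]
      exact congrArg (fun t : ℝ => HA (clampI (2 * t), ⟨x, hx.2⟩)) hcl.symm
    · rw [hG2' x h, hγ2 (clampI (lam x), ⟨x, hx⟩) (by simpa [hcl] using h)]
      exact congrArg (fun t : ℝ => HB (clampI (2 * t - 1), ⟨x, hx.1⟩)) hcl.symm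
  · change G (1, x) = e
    rcases le_total (lam x) (1 / 2) with h | h
    · have h0 : lam x ≤ 0 := by
        by_contra h0
        exact hx ⟨(not_le.1 h0).le, by linarith⟩
      rw [hG1' x h, clampI_of_le_zero (by linarith), hA0]
    · have h0 : 1 ≤ lam x := by
        by_contra h0
        exact hx ⟨by linarith, (not_le.1 h0).le⟩
      rw [hG2' x h, clampI_of_one_le (by linarith), hB1]
  · change G (0, x) = w x
    rcases le_total (lam x) (1 / 2) with h | h
    · refine (hG1 (0, x) h).trans ?_
      change HA (clampI (1 - (0 : ℝ) + 0 * (2 * lam x)), _) = _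
      rw [zero_mul, sub_zero, add_zero, clampI_of_one_le le_rfl, hA1]
    · refine (hG2 (0, x) h).trans ?_
      change HB (clampI ((0 : ℝ) * (2 * lam x - 1)), _) = _
      rw [zero_mul, clampI_of_le_zero le_rfl, hB0]

theorem exists_extend_collar (e : Y) (g : C(collar lam, Y))
    (h : ∀ x : collar lam, lam x = 0 ∨ lam x = 1 → g x = e) :
    ∃ w : C(Z, Y), (∀ x (hx : x ∈ collar lam), w x = g ⟨x, hx⟩) ∧ ∀ x, x ∉ collar lam → w x = e := by
  obtain ⟨z, hz1, hz2, hz3⟩ := exists_paste₃ (Y := Y) (P := {x | lam x ≤ 0}) (N := {x | 1 ≤ lam x})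
    (R := collar lam) (isClosed_le lam.continuous continuous_const)
    (isClosed_le continuous_const lam.continuous) (isClosed_collar lam)
    (fun x => by
      rcases le_total (lam x) 0 with h | h
      · exact Or.inl h
      · rcases le_total (lam x) 1 with h' | h'
        · exact Or.inr (Or.inr ⟨h, h'⟩)
        · exact Or.inr (Or.inl h'))
    (ContinuousMap.const _ e) (ContinuousMap.const _ e) g
    (fun x _ _ => rfl)
    (fun x h1 h2 => (h ⟨x, h2⟩ (Or.inl (le_antisymm h1 h2.1))).symm)
    (fun x h1 h2 => (h ⟨x, h2⟩ (Or.inr (le_antisymm h2.2 h1))).symm)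
  refine ⟨z, hz3, fun x hx => ?_⟩
  rcases le_total (lam x) 0 with h | h
  · exact hz1 x h
  · refine hz2 x (show 1 ≤ lam x from ?_)
    by_contra h'
    exact hx ⟨h, (not_le.1 h').le⟩

theorem exists_isLoopMap (e : Y) (γ : C(unitInterval × collar lam, Y)) (h0 : ∀ x, γ (0, x) = e)
    (h1 : ∀ x, γ (1, x) = e) : ∃ w, IsLoopMap lam e γ w := by
  refine exists_extend_collar lam e ⟨fun x => γ (clampI (lam x), x), by fun_prop⟩ fun x hx => ?_
  change γ (clampI (lam x), x) = e
  rcases hx with hx | hx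
  · rw [clampI_of_le_zero hx.le, h0]
  · rw [clampI_of_one_le hx.ge, h1]

theorem homotopic_of_eq_collar (e : Y) (F : C(unitInterval × collar lam, Y))
    (h : ∀ t (x : collar lam), lam x = 0 ∨ lam x = 1 → F (t, x) = e) {z₀ z₁ : C(Z, Y)}
    (hz₀ : ∀ x (hx : x ∈ collar lam), z₀ x = F (0, ⟨x, hx⟩)) (hz₀' : ∀ x, x ∉ collar lam → z₀ x = e)
    (hz₁ : ∀ x (hx : x ∈ collar lam), z₁ x = F (1, ⟨x, hx⟩))
    (hz₁' : ∀ x, x ∉ collar lam → z₁ x = e) : z₀.Homotopic z₁ := by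
  obtain ⟨G, hG1, hG2, hG3⟩ := exists_paste₃ (Y := Y)
    (P := {p : unitInterval × Z | lam p.2 ≤ 0}) (N := {p : unitInterval × Z | 1 ≤ lam p.2})
    (R := {p : unitInterval × Z | p.2 ∈ collar lam})
    (isClosed_le (by fun_prop) continuous_const)
    (isClosed_le continuous_const (by fun_prop)) ((isClosed_collar lam).preimage continuous_snd)
    (fun x => by
      rcases le_total (lam x.2) 0 with h | h
      · exact Or.inl h
      · rcases le_total (lam x.2) 1 with h' | h'
        · exact Or.inr (Or.inr ⟨h, h'⟩)
        · exact Or.inr (Or.inl h'))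
    (ContinuousMap.const _ e) (ContinuousMap.const _ e)
    ⟨fun p => F (p.1.1, ⟨p.1.2, p.2⟩), by fun_prop⟩
    (fun x _ _ => rfl)
    (fun x h1 h2 => (h x.1 ⟨x.2, h2⟩ (Or.inl (le_antisymm h1 h2.1))).symm)
    (fun x h1 h2 => (h x.1 ⟨x.2, h2⟩ (Or.inr (le_antisymm h2.2 h1))).symm)
  have hG4 : ∀ t x, x ∉ collar lam → G (t, x) = e := by
    intro t x hx
    rcases le_total (lam x) 0 with h | h
    · exact hG1 (t, x) h
    · refine hG2 (t, x) (show 1 ≤ lam x from ?_)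
      by_contra h'
      exact hx ⟨h, (not_le.1 h').le⟩
  refine ⟨⟨G, fun x => ?_, fun x => ?_⟩⟩
  · by_cases hx : x ∈ collar lam
    · exact (hG3 (0, x) hx).trans (hz₀ x hx).symm
    · exact (hG4 0 x hx).trans (hz₀' x hx).symm
  · by_cases hx : x ∈ collar lam
    · exact (hG3 (1, x) hx).trans (hz₁ x hx).symm
    · exact (hG4 1 x hx).trans (hz₁' x hx).symm

/-- If `b` is, up to based homotopies, a two-sided unit for a product `E × E → B`, then the loop
map of the reversed loops is an inverse of the loop map. -/
theorem loopMap_mul_symm_homotopic {E B : Type*} [TopologicalSpace E] [TopologicalSpace B]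
    (e : E) (b : B) (mul : C(E × E, B)) (i : C(E, B)) (hi : i e = b)
    (L : C(unitInterval × E, B)) (hL0 : ∀ y, L (0, y) = mul (e, y)) (hL1 : ∀ y, L (1, y) = i y)
    (hL : ∀ t, L (t, e) = b) (R : C(unitInterval × E, B)) (hR0 : ∀ y, R (0, y) = mul (y, e))
    (hR1 : ∀ y, R (1, y) = i y) (hR : ∀ t, R (t, e) = b)
    (γ γ' : C(unitInterval × collar lam, E)) (h0 : ∀ x, γ (0, x) = e) (h1 : ∀ x, γ (1, x) = e)
    (hγ' : ∀ t x, γ' (t, x) = γ (unitInterval.symm t, x)) (w w' : C(Z, E))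
    (hw : IsLoopMap lam e γ w) (hw' : IsLoopMap lam e γ' w') :
    (mul.comp (w.prodMk w')).Homotopic (ContinuousMap.const Z b) := by
  have hee : mul (e, e) = b := (hL0 e).symm.trans (hL 0)
  have hsymm : ∀ t, unitInterval.symm (clampI t) = clampI (1 - t) := by
    intro t
    apply Subtype.ext
    change 1 - max 0 (min 1 t) = max 0 (min 1 (1 - t))
    rcases le_total t 0 with h | h
    · rw [min_eq_right (h.trans zero_le_one), max_eq_left h, min_eq_left (by linarith),
        max_eq_right zero_le_one, sub_zero]
    · rcases le_total t 1 with h' | h'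
      · rw [min_eq_right h', max_eq_right h, min_eq_right (by linarith),
          max_eq_right (by linarith)]
      · rw [min_eq_left h', max_eq_right zero_le_one, min_eq_right (by linarith),
          max_eq_left (by linarith), sub_self]
  -- On the collar the product is γ(λ) · γ(1 − λ). Both times are lowered equally until the smaller
  -- one reaches 0, so that one factor becomes `e`.
  let F₁ : C(unitInterval × collar lam, B) :=
    ⟨fun p => mul (γ (clampI (lam p.2 - (p.1 : ℝ) * min (lam p.2) (1 - lam p.2)), p.2),
      γ (clampI (1 - lam p.2 - (p.1 : ℝ) * min (lam p.2) (1 - lam p.2)), p.2)), by fun_prop⟩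
  have hF₁1 : ∀ x : collar lam, F₁ (1, x) =
      mul (γ (clampI (2 * lam x - 1), x), γ (clampI (1 - 2 * lam x), x)) := by
    intro x
    change mul (γ (clampI (lam x - (1 : ℝ) * min (lam x) (1 - lam x)), x),
      γ (clampI (1 - lam x - (1 : ℝ) * min (lam x) (1 - lam x)), x)) = _
    rcases le_total (lam x) (1 / 2) with h | h
    · rw [min_eq_left (by linarith), clampI_of_le_zero (t := lam x - 1 * lam x) (by linarith),
        clampI_of_le_zero (t := 2 * lam x - 1) (by linarith)]
      ring_nf
    · rw [min_eq_right (by linarith),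
        clampI_of_le_zero (t := 1 - lam x - 1 * (1 - lam x)) (by linarith),
        clampI_of_le_zero (t := 1 - 2 * lam x) (by linarith)]
      ring_nf
  -- One factor is now `e`, and the unit homotopies `L` and `R` turn the product into i(γ(|2λ −
  -- 1|)). They match at λ = 1/2, where both factors are `e`, because both fix `e`.
  obtain ⟨F₂, hF₂l, hF₂r⟩ := exists_paste₂ (Y := B)
    (P := {p : unitInterval × collar lam | lam p.2 ≤ 1 / 2})
    (N := {p : unitInterval × collar lam | 1 / 2 ≤ lam p.2})
    (isClosed_le (by fun_prop) continuous_const) (isClosed_le continuous_const (by fun_prop))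
    (fun x => le_total (lam x.2) (1 / 2))
    ⟨fun p => L (p.1.1, γ (clampI (1 - 2 * lam p.1.2), p.1.2)), by fun_prop⟩
    ⟨fun p => R (p.1.1, γ (clampI (2 * lam p.1.2 - 1), p.1.2)), by fun_prop⟩
    (fun p h₁ h₂ => by
      change L (p.1, γ (clampI (1 - 2 * lam p.2), p.2)) = R (p.1, γ (clampI (2 * lam p.2 - 1), p.2))
      have h₁ : lam p.2 ≤ 1 / 2 := h₁
      have h₂ : 1 / 2 ≤ lam p.2 := h₂
      rw [clampI_of_le_zero (by linarith), clampI_of_le_zero (by linarith), h0, hL, hR])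
  -- The loop time |2λ − 1| is raised to 1, where every loop is back at `e`.
  let F₃ : C(unitInterval × collar lam, B) :=
    ⟨fun p => i (γ (clampI (max |2 * lam p.2 - 1| (p.1 : ℝ)), p.2)), by fun_prop⟩
  have hF₂0 : ∀ x : collar lam, F₂ (0, x) =
      mul (γ (clampI (2 * lam x - 1), x), γ (clampI (1 - 2 * lam x), x)) := by
    intro x
    rcases le_total (lam x) (1 / 2) with h | h
    · refine (hF₂l (0, x) h).trans ((hL0 _).trans ?_)
      rw [clampI_of_le_zero (t := 2 * lam x - 1) (by linarith), h0]
    · refine (hF₂r (0, x) h).trans ((hR0 _).trans ?_)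
      rw [clampI_of_le_zero (t := 1 - 2 * lam x) (by linarith), h0]
  have hF₂1 : ∀ x : collar lam, F₂ (1, x) = F₃ (0, x) := by
    intro x
    change _ = i (γ (clampI (max |2 * lam x - 1| (0 : ℝ)), x))
    rw [max_eq_left (abs_nonneg _)]
    rcases le_total (lam x) (1 / 2) with h | h
    · refine (hF₂l (1, x) h).trans ((hL1 _).trans ?_)
      rw [abs_of_nonpos (by linarith), neg_sub]
    · refine (hF₂r (1, x) h).trans ((hR1 _).trans ?_)
      rw [abs_of_nonneg (by linarith)]
  have hF₁b : ∀ t (x : collar lam), lam x = 0 ∨ lam x = 1 → F₁ (t, x) = b := by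
    intro t x hx
    change mul (γ (clampI (lam x - (t : ℝ) * min (lam x) (1 - lam x)), x),
      γ (clampI (1 - lam x - (t : ℝ) * min (lam x) (1 - lam x)), x)) = _
    rcases hx with hx | hx
    · rw [hx, min_eq_left (by norm_num), clampI_of_le_zero (by simp), clampI_of_one_le (by simp),
        h0, h1, hee]
    · rw [hx, min_eq_right (by norm_num), clampI_of_one_le (by simp), clampI_of_le_zero (by simp),
        h0, h1, hee]
  have hF₂b : ∀ t (x : collar lam), lam x = 0 ∨ lam x = 1 → F₂ (t, x) = b := by
    intro t x hx
    rcases hx with hx | hx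
    · refine (hF₂l (t, x) (show lam x ≤ 1 / 2 by rw [hx]; norm_num)).trans ?_
      change L (t, γ (clampI (1 - 2 * lam x), x)) = b
      rw [clampI_of_one_le (by rw [hx]; norm_num), h1, hL]
    · refine (hF₂r (t, x) (show 1 / 2 ≤ lam x by rw [hx]; norm_num)).trans ?_
      change R (t, γ (clampI (2 * lam x - 1), x)) = b
      rw [clampI_of_one_le (by rw [hx]; norm_num), h1, hR]
  have hF₃b : ∀ t (x : collar lam), lam x = 0 ∨ lam x = 1 → F₃ (t, x) = b := by
    intro t x hx
    change i (γ (clampI (max |2 * lam x - 1| (t : ℝ)), x)) = b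
    have : |2 * lam x - 1| = 1 := by
      rcases hx with hx | hx <;> rw [hx] <;> norm_num
    rw [clampI_of_one_le (by rw [this]; exact le_max_left _ _), h1, hi]
  obtain ⟨z₁, hz₁, hz₁'⟩ := exists_extend_collar lam b ⟨fun x => F₁ (1, x), by fun_prop⟩ (hF₁b 1)
  obtain ⟨z₂, hz₂, hz₂'⟩ := exists_extend_collar lam b ⟨fun x => F₂ (1, x), by fun_prop⟩ (hF₂b 1)
  refine (homotopic_of_eq_collar lam b F₁ hF₁b (z₁ := z₁) (fun x hx => ?_) (fun x hx => ?_) hz₁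
    hz₁').trans ((homotopic_of_eq_collar lam b F₂ hF₂b (z₁ := z₂) (fun x hx => ?_) hz₁' hz₂
    hz₂').trans (homotopic_of_eq_collar lam b F₃ hF₃b (fun x hx => ?_) hz₂' (fun x hx => ?_)
    (fun x hx => rfl)))
  · change mul (w x, w' x) = mul (γ (clampI (lam x - (0 : ℝ) * min (lam x) (1 - lam x)), ⟨x, hx⟩),
      γ (clampI (1 - lam x - (0 : ℝ) * min (lam x) (1 - lam x)), ⟨x, hx⟩))
    rw [hw.1 x hx, hw'.1 x hx, hγ', hsymm, zero_mul, sub_zero, sub_zero]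
  · change mul (w x, w' x) = b
    rw [hw.2 x hx, hw'.2 x hx, hee]
  · rw [hz₁ x hx]
    exact (hF₁1 ⟨x, hx⟩).trans (hF₂0 ⟨x, hx⟩).symm
  · exact (hz₂ x hx).trans (hF₂1 ⟨x, hx⟩)
  · change b = i (γ (clampI (max |2 * lam x - 1| (1 : ℝ)), ⟨x, hx⟩))
    rw [clampI_of_one_le (le_max_right _ _), h1, hi]

end Collar

open FinHilb

/-! ### Homotopy classes of maps into a homotopy commutative monoid -/

section HtpyMonoid

variable {X Y Z : Type*} [TopologicalSpace X] [TopologicalSpace Y] [TopologicalSpace Z]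

theorem HtpyClasses.mk_eq_iff {f g : C(X, Y)} :
    HtpyClasses.mk f = HtpyClasses.mk g ↔ f.Homotopic g :=
  Quotient.eq (r := homotopySetoid X Y)

theorem HtpyClasses.exists_rep (a : HtpyClasses X Y) : ∃ f : C(X, Y), HtpyClasses.mk f = a :=
  Quotient.exists_rep (s := homotopySetoid X Y) a

theorem ContinuousMap.Homotopic.comp_right {f g : C(Y, Z)} (h : f.Homotopic g) (k : C(X, Y)) :
    (f.comp k).Homotopic (g.comp k) :=
  h.comp (ContinuousMap.Homotopic.refl k)

theorem ContinuousMap.Homotopic.comp_left {f g : C(X, Y)} (h : f.Homotopic g) (k : C(Y, Z)) :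
    (k.comp f).Homotopic (k.comp g) :=
  (ContinuousMap.Homotopic.refl k).comp h

theorem ContinuousMap.Homotopic.prodMk_map {f f' : C(X, Y)} {g g' : C(X, Z)} (hf : f.Homotopic f')
    (hg : g.Homotopic g') : (f.prodMk g).Homotopic (f'.prodMk g') := by
  obtain ⟨F⟩ := hf
  obtain ⟨G⟩ := hg
  exact ⟨⟨F.toContinuousMap.prodMk G.toContinuousMap,
    fun x => Prod.ext (F.apply_zero x) (G.apply_zero x),
    fun x => Prod.ext (F.apply_one x) (G.apply_one x)⟩⟩

/-- The commutative monoid of homotopy classes of maps into a homotopy commutative monoid. -/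
@[reducible] def htpyAddCommMonoid (μ : C(Y × Y, Y)) (e : Y)
    (hunit : (μ.comp ((ContinuousMap.id Y).prodMk (ContinuousMap.const Y e))).Homotopic
      (ContinuousMap.id Y))
    (hcomm : (μ.comp ContinuousMap.prodSwap).Homotopic μ)
    (hassoc : (μ.comp ((μ.comp ContinuousMap.fst).prodMk ContinuousMap.snd)).Homotopic
      (μ.comp ((ContinuousMap.fst.comp ContinuousMap.fst).prodMk
        (μ.comp ((ContinuousMap.snd.comp ContinuousMap.fst).prodMk ContinuousMap.snd))))) :
    AddCommMonoid (HtpyClasses X Y) :=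
  have hc : ∀ a b : HtpyClasses X Y,
      Quotient.map₂ (sa := homotopySetoid X Y) (sb := homotopySetoid X Y)
        (sc := homotopySetoid X Y) (fun f g => μ.comp (f.prodMk g))
        (fun _ _ h₁ _ _ h₂ => (h₁.prodMk_map h₂).comp_left μ) a b =
      Quotient.map₂ (sa := homotopySetoid X Y) (sb := homotopySetoid X Y)
        (sc := homotopySetoid X Y) (fun f g => μ.comp (f.prodMk g))
        (fun _ _ h₁ _ _ h₂ => (h₁.prodMk_map h₂).comp_left μ) b a := by
    intro a b
    obtain ⟨f, rfl⟩ := a.exists_rep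
    obtain ⟨g, rfl⟩ := b.exists_rep
    exact HtpyClasses.mk_eq_iff.2 (hcomm.comp_right (g.prodMk f))
  have hu : ∀ a : HtpyClasses X Y,
      Quotient.map₂ (sa := homotopySetoid X Y) (sb := homotopySetoid X Y)
        (sc := homotopySetoid X Y) (fun f g => μ.comp (f.prodMk g))
        (fun _ _ h₁ _ _ h₂ => (h₁.prodMk_map h₂).comp_left μ) a
          (HtpyClasses.mk (ContinuousMap.const X e)) = a := by
    intro a
    obtain ⟨f, rfl⟩ := a.exists_rep
    exact HtpyClasses.mk_eq_iff.2 (hunit.comp_right f)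
  { add := Quotient.map₂ (sa := homotopySetoid X Y) (sb := homotopySetoid X Y)
      (sc := homotopySetoid X Y) (fun f g => μ.comp (f.prodMk g))
      (fun _ _ h₁ _ _ h₂ => (h₁.prodMk_map h₂).comp_left μ)
    zero := HtpyClasses.mk (ContinuousMap.const X e)
    nsmul := @nsmulRec _ ⟨HtpyClasses.mk (ContinuousMap.const X e)⟩
      ⟨Quotient.map₂ (sa := homotopySetoid X Y) (sb := homotopySetoid X Y)
        (sc := homotopySetoid X Y) (fun f g => μ.comp (f.prodMk g))
        (fun _ _ h₁ _ _ h₂ => (h₁.prodMk_map h₂).comp_left μ)⟩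
    add_comm := hc
    add_zero := hu
    zero_add := fun a => (hc _ a).trans (hu a)
    add_assoc := by
      intro a b c
      obtain ⟨f, rfl⟩ := a.exists_rep
      obtain ⟨g, rfl⟩ := b.exists_rep
      obtain ⟨h, rfl⟩ := c.exists_rep
      exact HtpyClasses.mk_eq_iff.2 (hassoc.comp_right ((f.prodMk g).prodMk h)) }

theorem htpyAddCommMonoid_add_nsmul (μ : C(Y × Y, Y)) (e : Y)
    (hunit : (μ.comp ((ContinuousMap.id Y).prodMk (ContinuousMap.const Y e))).Homotopic
      (ContinuousMap.id Y))
    (hcomm : (μ.comp ContinuousMap.prodSwap).Homotopic μ)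
    (hassoc : (μ.comp ((μ.comp ContinuousMap.fst).prodMk ContinuousMap.snd)).Homotopic
      (μ.comp ((ContinuousMap.fst.comp ContinuousMap.fst).prodMk
        (μ.comp ((ContinuousMap.snd.comp ContinuousMap.fst).prodMk ContinuousMap.snd)))))
    (e₁ : Y) (S : C(Y, Y))
    (hS : (μ.comp ((ContinuousMap.id Y).prodMk (ContinuousMap.const Y e₁))).Homotopic S)
    (f : C(X, Y)) (n : ℕ) :
    letI := htpyAddCommMonoid (X := X) μ e hunit hcomm hassoc
    HtpyClasses.mk f + n • HtpyClasses.mk (ContinuousMap.const X e₁) =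
      HtpyClasses.mk ((⟨S^[n], S.continuous.iterate n⟩ : C(Y, Y)).comp f) := by
  let := htpyAddCommMonoid (X := X) μ e hunit hcomm hassoc
  change HtpyClasses.mk f + n • HtpyClasses.mk (ContinuousMap.const X e₁) = _
  induction n with
  | zero => rw [zero_nsmul, add_zero]; rfl
  | succ n ih =>
    rw [succ_nsmul, ← add_assoc, ih]
    refine HtpyClasses.mk_eq_iff.2 ?_
    have h : (⟨S^[n + 1], S.continuous.iterate (n + 1)⟩ : C(Y, Y)).comp f =
        S.comp ((⟨S^[n], S.continuous.iterate n⟩ : C(Y, Y)).comp f) := by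
      ext1 x
      exact Function.iterate_succ_apply' _ _ _
    rw [h]
    exact hS.comp_right ((⟨S^[n], S.continuous.iterate n⟩ : C(Y, Y)).comp f)

end HtpyMonoid

namespace QuantumStateType

variable {Γ : Type*} (Q : QuantumStateType Γ) (m : VacuumModel)

/-! ### The topological monoid `𝒬_Γ^⊔(H)` -/

/-- Inclusion of a component. -/
def sysMk (i : ℕ) (ω : Q.carrier (m.H.tpow i)) : Q.Systems m := ⟨i, ω⟩

theorem isOpenEmbedding_sysMk (i : ℕ) : Topology.IsOpenEmbedding (Q.sysMk m i) :=
  Topology.IsOpenEmbedding.sigmaMk (σ := fun i => Q.carrier (m.H.tpow i))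

theorem continuous_sysMk (i : ℕ) : Continuous (Q.sysMk m i) :=
  (Q.isOpenEmbedding_sysMk m i).continuous

theorem sysMk_injective (i : ℕ) : Function.Injective (Q.sysMk m i) :=
  (Q.isOpenEmbedding_sysMk m i).injective

/-- The map `x ↦ x ⊗ ψ`. -/
def step : C(Q.Systems m, Q.Systems m) :=
  ⟨fun x => ⟨x.1 + 1, Q.push (m.Φ x.1) x.2⟩, continuous_sigma fun i =>
    (Q.continuous_sysMk m (i + 1)).comp (Q.pushC (m.Φ i)).continuous⟩

theorem step_iff {x y : Q.Systems m} : Q.Step m x y ↔ y = Q.step m x := by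
  constructor
  · intro h
    cases h with
    | mk i ω ω' h =>
      exact congrArg (Q.sysMk m (i + 1)) (Q.push_eq h).symm
  · intro h
    rw [h]
    exact Step.mk x.1 x.2 _ (Q.push_isPush _ _)

theorem step_injective : Function.Injective (Q.step m) := by
  intro x y h
  have h1 : x.1 = y.1 := Nat.succ_injective (congrArg Sigma.fst h)
  cases x with
  | mk i ω =>
    cases y with
    | mk k τ =>
      have h1 : i = k := h1
      subst h1
      exact congrArg (Q.sysMk m i) ((Q.isClosedEmbedding_push (m.Φ i)).injective
        (Q.sysMk_injective m (i + 1) h))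

/-- The image misses degree 0, and in degree i + 1 it is the image of degree `i` under a closed
embedding; this is where that axiom of a state type enters. -/
theorem isClosedEmbedding_step : Topology.IsClosedEmbedding (Q.step m) := by
  refine Topology.IsClosedEmbedding.of_continuous_injective_isClosedMap (Q.step m).continuous
    (Q.step_injective m) fun F hF => isClosed_sigma_iff.2 fun i => ?_
  cases i with
  | zero =>
    convert isClosed_empty
    refine Set.eq_empty_iff_forall_notMem.2 fun ω hω => ?_
    obtain ⟨x, _, hx⟩ := hω
    exact Nat.succ_ne_zero _ (congrArg Sigma.fst hx)
  | succ i =>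
    have h := (Q.isClosedEmbedding_push (m.Φ i)).isClosedMap _
      (hF.preimage (Q.continuous_sysMk m i))
    refine (congrArg IsClosed ?_).mpr h
    ext ω
    constructor
    · rintro ⟨x, hxF, hx⟩
      cases x with
      | mk k τ =>
        have h1 : k = i := Nat.succ_injective (congrArg Sigma.fst hx)
        subst h1
        exact ⟨τ, hxF, Q.sysMk_injective m (k + 1) hx⟩
    · rintro ⟨τ, hτ, rfl⟩
      exact ⟨⟨i, τ⟩, hτ, rfl⟩

/-- Inclusion of a component, as a continuous map. -/
def inS (i : ℕ) : C(Q.carrier (m.H.tpow i), Q.Systems m) := ⟨Q.sysMk m i, Q.continuous_sysMk m i⟩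

theorem isOpenEmbedding_inS (i : ℕ) : Topology.IsOpenEmbedding (Q.inS m i) :=
  Q.isOpenEmbedding_sysMk m i

theorem isOpenEmbedding_inS_prod (p : ℕ × ℕ) :
    Topology.IsOpenEmbedding (Prod.map (Q.inS m p.1) (Q.inS m p.2)) :=
  (Q.isOpenEmbedding_inS m p.1).prodMap (Q.isOpenEmbedding_inS m p.2)

/-- Stacking of systems. -/
def stack : C(Q.Systems m × Q.Systems m, Q.Systems m) :=
  ⟨fun p => ⟨p.1.1 + p.2.1, Q.push (m.H.concat p.1.1 p.2.1) (Q.tens p.1.2 p.2.2)⟩,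
    continuous_of_sigma_cover (Q.isOpenEmbedding_inS_prod m)
      (fun x => ⟨(x.1.1, x.2.1), (x.1.2, x.2.2), rfl⟩) fun p => (Q.continuous_sysMk m (p.1 + p.2)).comp
        ((Q.pushC (m.H.concat p.1 p.2)).comp
          (Q.tensC (m.H.tpow p.1) (m.H.tpow p.2))).continuous⟩

theorem stack_iff {x y z : Q.Systems m} : Q.Stack m x y z ↔ z = Q.stack m (x, y) := by
  constructor
  · intro h
    cases h with
    | mk i j ω τ σ ρ h₁ h₂ =>
      refine congrArg (Q.sysMk m (i + j)) (Q.push_eq ?_).symm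
      rw [Q.tens_eq h₁]
      exact h₂
  · intro h
    rw [h]
    exact Stack.mk x.1 y.1 x.2 y.2 _ _ (Q.tens_isTensor x.2 y.2) (Q.push_isPush _ _)

/-- Allowing the two exponents to be merely provably equal absorbs reindexings such as i + (k + l) =
(i + k) + l. -/
theorem inS_pushC_homotopic {H : FinHilb} {i k : ℕ} (h : i = k) (f : H →ₗᵢ[ℂ] m.H.tpow i)
    (g : H →ₗᵢ[ℂ] m.H.tpow k) :
    ((Q.inS m i).comp (Q.pushC f)).Homotopic ((Q.inS m k).comp (Q.pushC g)) := by
  subst h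
  exact (Q.pushC_homotopic f g).comp_left _

theorem bijective_inS : Function.Bijective fun p : Σ i, Q.carrier (m.H.tpow i) => Q.inS m p.1 p.2 :=
  Function.bijective_id

theorem bijective_inS_prod : Function.Bijective
    fun p : Σ i : ℕ × ℕ, Q.carrier (m.H.tpow i.1) × Q.carrier (m.H.tpow i.2) =>
      Prod.map (Q.inS m p.1.1) (Q.inS m p.1.2) p.2 := by
  refine ⟨fun p q h => ?_, fun x => ⟨⟨(x.1.1, x.2.1), (x.1.2, x.2.2)⟩, rfl⟩⟩
  have h' := congrArg (fun x : Q.Systems m × Q.Systems m =>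
    (⟨(x.1.1, x.2.1), (x.1.2, x.2.2)⟩ :
      Σ i : ℕ × ℕ, Q.carrier (m.H.tpow i.1) × Q.carrier (m.H.tpow i.2))) h
  exact h'

theorem isOpenEmbedding_inS_prod_prod (p : (ℕ × ℕ) × ℕ) :
    Topology.IsOpenEmbedding
      (Prod.map (Prod.map (Q.inS m p.1.1) (Q.inS m p.1.2)) (Q.inS m p.2)) :=
  (Q.isOpenEmbedding_inS_prod m p.1).prodMap (Q.isOpenEmbedding_inS m p.2)

theorem bijective_inS_prod_prod : Function.Bijective
    fun p : Σ i : (ℕ × ℕ) × ℕ, (Q.carrier (m.H.tpow i.1.1) × Q.carrier (m.H.tpow i.1.2)) ×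
      Q.carrier (m.H.tpow i.2) =>
      Prod.map (Prod.map (Q.inS m p.1.1.1) (Q.inS m p.1.1.2)) (Q.inS m p.1.2) p.2 := by
  refine ⟨fun p q h => ?_,
    fun x => ⟨⟨((x.1.1.1, x.1.2.1), x.2.1), ((x.1.1.2, x.1.2.2), x.2.2)⟩, rfl⟩⟩
  have h' := congrArg (fun x : (Q.Systems m × Q.Systems m) × Q.Systems m =>
    (⟨((x.1.1.1, x.1.2.1), x.2.1), ((x.1.1.2, x.1.2.2), x.2.2)⟩ :
      Σ i : (ℕ × ℕ) × ℕ, (Q.carrier (m.H.tpow i.1.1) × Q.carrier (m.H.tpow i.1.2)) ×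
        Q.carrier (m.H.tpow i.2))) h
  exact h'

/-- All monoid laws reduce to this: on each component, both sides are pushes of one stacked state `t
x` along two isometries, whose precise form is irrelevant. -/
theorem homotopic_of_isometries {X : Type*} [TopologicalSpace X] {H : FinHilb} {i k : ℕ}
    (h : i = k) (f : H →ₗᵢ[ℂ] m.H.tpow i) (g : H →ₗᵢ[ℂ] m.H.tpow k) (t : C(X, Q.carrier H))
    {F G : C(X, Q.Systems m)} (hF : ∀ x, F x = Q.sysMk m i (Q.push f (t x)))
    (hG : ∀ x, G x = Q.sysMk m k (Q.push g (t x))) : F.Homotopic G := by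
  have h1 := (Q.inS_pushC_homotopic m h f g).comp_right t
  have hF' : F = ((Q.inS m i).comp (Q.pushC f)).comp t := ContinuousMap.ext hF
  have hG' : G = ((Q.inS m k).comp (Q.pushC g)).comp t := ContinuousMap.ext hG
  rw [hF', hG']
  exact h1

theorem stack_apply {i k : ℕ} (ω : Q.carrier (m.H.tpow i)) (τ : Q.carrier (m.H.tpow k)) :
    Q.stack m (Q.sysMk m i ω, Q.sysMk m k τ) =
      Q.sysMk m (i + k) (Q.push (m.H.concat i k) (Q.tens ω τ)) := rfl

theorem stack_apply_swap {i k : ℕ} (ω : Q.carrier (m.H.tpow i)) (τ : Q.carrier (m.H.tpow k)) :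
    Q.stack m (Q.sysMk m k τ, Q.sysMk m i ω) =
      Q.sysMk m (k + i) (Q.push ((m.H.concat k i).comp (commIso (m.H.tpow i) (m.H.tpow k)))
        (Q.tens ω τ)) := by
  rw [stack_apply, push_comp, push_commIso_tens]

theorem stack_apply_left {i k l : ℕ} (ω : Q.carrier (m.H.tpow i)) (τ : Q.carrier (m.H.tpow k))
    (υ : Q.carrier (m.H.tpow l)) :
    Q.stack m (Q.stack m (Q.sysMk m i ω, Q.sysMk m k τ), Q.sysMk m l υ) =
      Q.sysMk m (i + k + l) (Q.push ((m.H.concat (i + k) l).comp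
        (mapIso (m.H.concat i k) LinearIsometry.id)) (Q.tens (Q.tens ω τ) υ)) := by
  rw [stack_apply, stack_apply, push_comp, push_mapIso_tens, push_id]

theorem stack_apply_right {i k l : ℕ} (ω : Q.carrier (m.H.tpow i)) (τ : Q.carrier (m.H.tpow k))
    (υ : Q.carrier (m.H.tpow l)) :
    Q.stack m (Q.sysMk m i ω, Q.stack m (Q.sysMk m k τ, Q.sysMk m l υ)) =
      Q.sysMk m (i + (k + l)) (Q.push (((m.H.concat i (k + l)).comp
        (mapIso LinearIsometry.id (m.H.concat k l))).comp (assocIso _ _ _))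
          (Q.tens (Q.tens ω τ) υ)) := by
  rw [stack_apply, stack_apply, push_comp, push_assocIso_tens, push_comp, push_mapIso_tens, push_id]

theorem stack_apply_trivial {i : ℕ} (ω : Q.carrier (m.H.tpow i)) (k : ℕ) :
    Q.stack m (Q.sysMk m i ω, Q.trivialSystem m k) =
      Q.sysMk m (i + k) (Q.push ((m.H.concat i k).comp
        (tmulRight (m.vec k) (m.norm_vec k) _)) ω) := by
  rw [push_comp, ← tens_fact_right]
  rfl

theorem stack_unit_homotopic :
    ((Q.stack m).comp ((ContinuousMap.id _).prodMk
      (ContinuousMap.const _ (Q.trivialSystem m 0)))).Homotopic (ContinuousMap.id _) := by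
  refine homotopic_of_sigma_cover (Q.isOpenEmbedding_inS m) (Q.bijective_inS m) fun i => ?_
  refine Q.homotopic_of_isometries m (Nat.add_zero i)
    ((m.H.concat i 0).comp (tmulRight (m.vec 0) (m.norm_vec 0) _)) LinearIsometry.id
    (ContinuousMap.id _) (fun ω => Q.stack_apply_trivial m ω 0)
    fun ω => congrArg (Q.sysMk m i) (Q.push_id ω).symm

theorem stack_comm_homotopic :
    ((Q.stack m).comp ContinuousMap.prodSwap).Homotopic (Q.stack m) := by
  refine homotopic_of_sigma_cover (Q.isOpenEmbedding_inS_prod m) (Q.bijective_inS_prod m)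
    fun p => ?_
  exact Q.homotopic_of_isometries m (Nat.add_comm p.2 p.1) _ _ (Q.tensC _ _)
    (fun ω => Q.stack_apply_swap m ω.1 ω.2) fun ω => Q.stack_apply m ω.1 ω.2

/-- Stacking of three states. -/
def tensC₃ (H K L : FinHilb) :
    C((Q.carrier H × Q.carrier K) × Q.carrier L, Q.carrier ((H.tensor K).tensor L)) :=
  ⟨fun p => Q.tens (Q.tens p.1.1 p.1.2) p.2, Q.continuous_tens.comp
    ((Q.continuous_tens.comp continuous_fst).prodMk continuous_snd)⟩

theorem stack_assoc_homotopic :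
    ((Q.stack m).comp (((Q.stack m).comp ContinuousMap.fst).prodMk ContinuousMap.snd)).Homotopic
      ((Q.stack m).comp ((ContinuousMap.fst.comp ContinuousMap.fst).prodMk
        ((Q.stack m).comp
          ((ContinuousMap.snd.comp ContinuousMap.fst).prodMk ContinuousMap.snd)))) := by
  refine homotopic_of_sigma_cover (Z := fun i : (ℕ × ℕ) × ℕ =>
      (Q.carrier (m.H.tpow i.1.1) × Q.carrier (m.H.tpow i.1.2)) × Q.carrier (m.H.tpow i.2))
    (Q.isOpenEmbedding_inS_prod_prod m) (Q.bijective_inS_prod_prod m) fun p => ?_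
  exact Q.homotopic_of_isometries m (Nat.add_assoc p.1.1 p.1.2 p.2) _ _ (Q.tensC₃ _ _ _)
    (fun ω => Q.stack_apply_left m ω.1.1 ω.1.2 ω.2)
    fun ω => Q.stack_apply_right m ω.1.1 ω.1.2 ω.2

theorem stack_one_homotopic :
    ((Q.stack m).comp ((ContinuousMap.id _).prodMk
      (ContinuousMap.const _ (Q.trivialSystem m 1)))).Homotopic (Q.step m) := by
  refine homotopic_of_sigma_cover (Q.isOpenEmbedding_inS m) (Q.bijective_inS m) fun i => ?_
  exact Q.homotopic_of_isometries m rfl _ (m.Φ i) (ContinuousMap.id _)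
    (fun ω => Q.stack_apply_trivial m ω 1) fun ω => rfl

section

variable (X : Type*) [TopologicalSpace X]

/-- The commutative monoid `[X, 𝒬_Γ^⊔(H)]`. -/
@[reducible] def systemsMonoid : AddCommMonoid (HtpyClasses X (Q.Systems m)) :=
  htpyAddCommMonoid (Q.stack m) (Q.trivialSystem m 0) (Q.stack_unit_homotopic m)
    (Q.stack_comm_homotopic m) (Q.stack_assoc_homotopic m)

theorem isPointwise_systemsMonoid :
    IsPointwise (Q.Stack m) (Q.trivialSystem m 0) (Q.systemsMonoid m X) :=
  ⟨fun f g => ⟨(Q.stack m).comp (f.prodMk g), fun _ => (Q.stack_iff m).2 rfl, rfl⟩, rfl⟩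

/-- The iterates of `x ↦ x ⊗ ψ`. -/
def stepN (n : ℕ) : C(Q.Systems m, Q.Systems m) :=
  ⟨(Q.step m)^[n], (Q.step m).continuous.iterate n⟩

theorem mk_add_nsmul (f : C(X, Q.Systems m)) (n : ℕ) :
    letI := Q.systemsMonoid m X
    HtpyClasses.mk f + n • HtpyClasses.mk (ContinuousMap.const X (Q.trivialSystem m 1)) =
      HtpyClasses.mk ((Q.stepN m n).comp f) :=
  htpyAddCommMonoid_add_nsmul (Q.stack m) _ _ _ _ _ (Q.step m) (Q.stack_one_homotopic m) f n

end

end QuantumStateType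

open FinHilb

section

variable {X X' Y : Type*} [TopologicalSpace X] [TopologicalSpace X'] [TopologicalSpace Y]

/-- Precomposition on homotopy classes. -/
def HtpyClasses.precomp (p : C(X', X)) : HtpyClasses X Y → HtpyClasses X' Y :=
  Quotient.lift (fun f => HtpyClasses.mk (f.comp p)) fun _ _ h =>
    HtpyClasses.mk_eq_iff.2 (ContinuousMap.Homotopic.comp_right h p)

theorem HtpyClasses.precomp_mk (p : C(X', X)) (f : C(X, Y)) :
    HtpyClasses.precomp p (HtpyClasses.mk f) = HtpyClasses.mk (f.comp p) := rfl

end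

namespace QuantumStateType

variable {Γ : Type*} (Q : QuantumStateType Γ) (m : VacuumModel)

/-! ### Stages of the stable space -/

theorem continuous_degree : Continuous (Sigma.fst : Q.Systems m → ℕ) :=
  continuous_sigma fun _ => continuous_const

instance instT2SpaceCarrier (H : FinHilb) : T2Space (Q.carrier H) :=
  inferInstanceAs (T2Space {ω : PureState Γ H // ω ∈ Q.carrier H})

instance instT2SpaceSystems : T2Space (Q.Systems m) := inferInstance

instance instT1SpaceSystems : T1Space (Q.Systems m) := T2Space.t1Space

/-- The map from the `n`-th stage. -/
def jn (n : ℕ) : C(Q.carrier (m.H.tpow n), Q.Stable m) := (Q.j m).comp (Q.inS m n)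

theorem jn_injective (n : ℕ) : Function.Injective (Q.jn m n) := by
  intro ω τ h
  exact Q.sysMk_injective m n ((quot_mk_eq_iff_of_degree_eq (x := Q.sysMk m n ω)
    (y := Q.sysMk m n τ) (S := Q.step m) (r := Q.Step m) (d := Sigma.fst)
    (fun _ _ => Q.step_iff m) (Q.step_injective m) (fun _ => rfl) 0 rfl).1 h)

theorem jn_push_Φ (n : ℕ) (ω : Q.carrier (m.H.tpow n)) :
    Q.jn m (n + 1) (Q.push (m.Φ n) ω) = Q.jn m n ω :=
  (Quot.sound ((Q.step_iff m (x := Q.sysMk m n ω)).2 rfl)).symm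

theorem exists_stage_map {a n : ℕ} (h : a ≤ n) : ∃ p : m.H.tpow a →ₗᵢ[ℂ] m.H.tpow n,
    (∀ ω, Q.jn m n (Q.push p ω) = Q.jn m a ω) ∧ p (m.vec a) = m.vec n := by
  induction n, h using Nat.le_induction with
  | base => exact ⟨LinearIsometry.id, fun ω => by rw [push_id], rfl⟩
  | succ n _ ih =>
    refine ih.elim fun p hp => ⟨(m.Φ n).comp p, fun ω => ?_, ?_⟩
    · rw [push_comp, jn_push_Φ, hp.1]
    · exact congrArg (m.Φ n) hp.2

/-- Stage maps carry both isometries to a common tensor power without changing the points of the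
colimit, and there any two isometries induce homotopic maps. -/
theorem jn_pushC_homotopic {H : FinHilb} {i k : ℕ} (f : H →ₗᵢ[ℂ] m.H.tpow i)
    (g : H →ₗᵢ[ℂ] m.H.tpow k) :
    ((Q.jn m i).comp (Q.pushC f)).Homotopic ((Q.jn m k).comp (Q.pushC g)) := by
  refine (Q.exists_stage_map m (Nat.le_max_left i k)).elim fun p hp => ?_
  refine (Q.exists_stage_map m (Nat.le_max_right i k)).elim fun q hq => ?_
  have h := (Q.pushC_homotopic (p.comp f) (q.comp g)).comp_left (Q.jn m (max i k))
  have h1 : (Q.jn m (max i k)).comp (Q.pushC (p.comp f)) = (Q.jn m i).comp (Q.pushC f) :=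
    ContinuousMap.ext fun ω => (congrArg (Q.jn m (max i k)) (Q.push_comp p f ω)).trans (hp.1 _)
  have h2 : (Q.jn m (max i k)).comp (Q.pushC (q.comp g)) = (Q.jn m k).comp (Q.pushC g) :=
    ContinuousMap.ext fun ω => (congrArg (Q.jn m (max i k)) (Q.push_comp q g ω)).trans (hq.1 _)
  rw [h1, h2] at h
  exact h

section Compact

variable {X : Type*} [TopologicalSpace X]

theorem exists_lift_sysMk {n : ℕ} (g : C(X, Q.Systems m)) (hg : ∀ x, (g x).1 = n) :
    ∃ f : C(X, Q.carrier (m.H.tpow n)), ∀ x, Q.sysMk m n (f x) = g x := by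
  refine exists_lift_of_isEmbedding (Q.isOpenEmbedding_sysMk m n).isEmbedding g fun x => ?_
  have h := hg x
  generalize g x = y at h
  subst h
  exact ⟨y.2, rfl⟩

variable [CompactSpace X]

theorem exists_lift_jn (f : C(X, Q.Stable m)) : ∃ N : ℕ, ∀ n, N ≤ n →
    ∃ g : C(X, Q.carrier (m.H.tpow n)), ∀ x, Q.jn m n (g x) = f x := by
  have h := exists_lift_quot_of_compact (T := Q.Systems m) (S := Q.step m) (r := Q.Step m) (d := Sigma.fst)
    (fun _ _ => Q.step_iff m) (Q.isClosedEmbedding_step m) (Q.continuous_degree m)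
    (fun _ => rfl) f
  refine h.elim fun N hN => ⟨N, fun n hn => ?_⟩
  refine (hN n hn).elim fun g hg => ?_
  refine (Q.exists_lift_sysMk m g hg.1).elim fun f' hf' => ⟨f', fun x => ?_⟩
  exact (congrArg (Q.j m) (hf' x)).trans (hg.2 x)

/-- A homotopy is a map from the compact space I × X, so it lifts to a finite stage; injectivity of
the stages in the colimit identifies its two ends. -/
theorem exists_stage_homotopic {a a' : ℕ} {f : C(X, Q.carrier (m.H.tpow a))}
    {f' : C(X, Q.carrier (m.H.tpow a'))}
    (hf : ((Q.jn m a).comp f).Homotopic ((Q.jn m a').comp f')) :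
    ∃ N : ℕ, ∀ n, N ≤ n → ∃ (p : m.H.tpow a →ₗᵢ[ℂ] m.H.tpow n)
      (p' : m.H.tpow a' →ₗᵢ[ℂ] m.H.tpow n),
      (∀ ω, Q.jn m n (Q.push p ω) = Q.jn m a ω) ∧ (∀ ω, Q.jn m n (Q.push p' ω) = Q.jn m a' ω) ∧
      ((Q.pushC p).comp f).Homotopic ((Q.pushC p').comp f') := by
  refine hf.elim fun F => ?_
  refine (Q.exists_lift_jn m F.toContinuousMap).elim fun N hN =>
    ⟨max N (max a a'), fun n hn => ?_⟩
  refine (hN n ((le_max_left _ _).trans hn)).elim fun G hG => ?_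
  refine (Q.exists_stage_map m (((le_max_left a a').trans (le_max_right N _)).trans hn)).elim
    fun p hp => ?_
  refine (Q.exists_stage_map m (((le_max_right a a').trans (le_max_right N _)).trans hn)).elim
    fun p' hp' => ?_
  refine ⟨p, p', hp.1, hp'.1, ⟨⟨G, fun x => ?_, fun x => ?_⟩⟩⟩
  · exact Q.jn_injective m n ((hG (0, x)).trans ((F.apply_zero x).trans (hp.1 (f x)).symm))
  · exact Q.jn_injective m n ((hG (1, x)).trans ((F.apply_one x).trans (hp'.1 (f' x)).symm))


end Compact

section

variable {X : Type*} [TopologicalSpace X]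

/-- The stacking of two families through an isometry. -/
def stackVia {a b k : ℕ} (φ : (m.H.tpow a).tensor (m.H.tpow b) →ₗᵢ[ℂ] m.H.tpow k)
    (f : C(X, Q.carrier (m.H.tpow a))) (g : C(X, Q.carrier (m.H.tpow b))) : C(X, Q.Stable m) :=
  ((Q.jn m k).comp (Q.pushC φ)).comp ((Q.tensC _ _).comp (f.prodMk g))

theorem stackVia_homotopic_of_homotopic {a b k : ℕ}
    (φ : (m.H.tpow a).tensor (m.H.tpow b) →ₗᵢ[ℂ] m.H.tpow k)
    {f f' : C(X, Q.carrier (m.H.tpow a))} {g g' : C(X, Q.carrier (m.H.tpow b))}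
    (hf : f.Homotopic f') (hg : g.Homotopic g') :
    (Q.stackVia m φ f g).Homotopic (Q.stackVia m φ f' g') :=
  ((hf.prodMk_map hg).comp_left _).comp_left _

theorem stackVia_homotopic_stage {a b k n n' k' : ℕ}
    (φ : (m.H.tpow a).tensor (m.H.tpow b) →ₗᵢ[ℂ] m.H.tpow k)
    (p : m.H.tpow a →ₗᵢ[ℂ] m.H.tpow n) (q : m.H.tpow b →ₗᵢ[ℂ] m.H.tpow n')
    (φ' : (m.H.tpow n).tensor (m.H.tpow n') →ₗᵢ[ℂ] m.H.tpow k')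
    (f : C(X, Q.carrier (m.H.tpow a))) (g : C(X, Q.carrier (m.H.tpow b))) :
    (Q.stackVia m φ f g).Homotopic
      (Q.stackVia m φ' ((Q.pushC p).comp f) ((Q.pushC q).comp g)) := by
  have h := (Q.jn_pushC_homotopic m φ (φ'.comp (mapIso p q))).comp_right
    ((Q.tensC _ _).comp (f.prodMk g))
  have h1 : ((Q.jn m k').comp (Q.pushC (φ'.comp (mapIso p q)))).comp
      ((Q.tensC _ _).comp (f.prodMk g)) =
      Q.stackVia m φ' ((Q.pushC p).comp f) ((Q.pushC q).comp g) :=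
    ContinuousMap.ext fun x => congrArg (Q.jn m k') ((Q.push_comp _ _ _).trans
      (congrArg (Q.push φ') (Q.push_mapIso_tens p q (f x) (g x))))
  exact h1 ▸ h

/-- The class of the stacked family depends on neither the stages, nor the representatives, nor the
isometry used. This makes the sum well defined and lets concatenation and interleaving be exchanged
freely. -/
theorem stackVia_homotopic [CompactSpace X] {a b k a' b' k' : ℕ}
    (φ : (m.H.tpow a).tensor (m.H.tpow b) →ₗᵢ[ℂ] m.H.tpow k)
    (φ' : (m.H.tpow a').tensor (m.H.tpow b') →ₗᵢ[ℂ] m.H.tpow k')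
    {f : C(X, Q.carrier (m.H.tpow a))} {g : C(X, Q.carrier (m.H.tpow b))}
    {f' : C(X, Q.carrier (m.H.tpow a'))} {g' : C(X, Q.carrier (m.H.tpow b'))}
    (hf : ((Q.jn m a).comp f).Homotopic ((Q.jn m a').comp f'))
    (hg : ((Q.jn m b).comp g).Homotopic ((Q.jn m b').comp g')) :
    (Q.stackVia m φ f g).Homotopic (Q.stackVia m φ' f' g') := by
  refine (Q.exists_stage_homotopic m hf).elim fun M hM => ?_
  refine (Q.exists_stage_homotopic m hg).elim fun N hN => ?_
  refine (hM (max M N) (le_max_left _ _)).elim fun p hp => hp.elim fun p' hp' => ?_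
  refine (hN (max M N) (le_max_right _ _)).elim fun q hq => hq.elim fun q' hq' => ?_
  refine (Q.stackVia_homotopic_stage m φ p q (m.H.concat _ _) f g).trans ?_
  exact (Q.stackVia_homotopic_of_homotopic m _ hp'.2.2 hq'.2.2).trans
    (Q.stackVia_homotopic_stage m φ' p' q' (m.H.concat _ _) f' g').symm

/-! ### The monoid of homotopy classes of maps to the stable space -/

/-- `γ` is the sum of `α` and `β`. -/
def IsStableSum (α β γ : HtpyClasses X (Q.Stable m)) : Prop :=
  ∃ (a b k : ℕ) (f : C(X, Q.carrier (m.H.tpow a))) (g : C(X, Q.carrier (m.H.tpow b)))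
    (φ : (m.H.tpow a).tensor (m.H.tpow b) →ₗᵢ[ℂ] m.H.tpow k),
    HtpyClasses.mk ((Q.jn m a).comp f) = α ∧ HtpyClasses.mk ((Q.jn m b).comp g) = β ∧
      HtpyClasses.mk (Q.stackVia m φ f g) = γ

variable {m} in
theorem IsStableSum.precomp {X' : Type*} [TopologicalSpace X'] (p : C(X', X))
    {α β γ : HtpyClasses X (Q.Stable m)} (h : Q.IsStableSum m α β γ) :
    Q.IsStableSum m (HtpyClasses.precomp p α) (HtpyClasses.precomp p β)
      (HtpyClasses.precomp p γ) := by
  obtain ⟨a, b, k, f, g, φ, rfl, rfl, rfl⟩ := h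
  exact ⟨a, b, k, f.comp p, g.comp p, φ, rfl, rfl, rfl⟩

variable [CompactSpace X]

theorem exists_rep_jn (α : HtpyClasses X (Q.Stable m)) : ∃ N : ℕ, ∀ n, N ≤ n →
    ∃ f : C(X, Q.carrier (m.H.tpow n)), HtpyClasses.mk ((Q.jn m n).comp f) = α := by
  obtain ⟨f, rfl⟩ := α.exists_rep
  obtain ⟨N, hN⟩ := Q.exists_lift_jn m f
  refine ⟨N, fun n hn => ?_⟩
  obtain ⟨g, hg⟩ := hN n hn
  exact ⟨g, congrArg HtpyClasses.mk (ContinuousMap.ext hg)⟩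

variable {m} in
theorem IsStableSum.unique {α β γ γ' : HtpyClasses X (Q.Stable m)}
    (h : Q.IsStableSum m α β γ) (h' : Q.IsStableSum m α β γ') : γ = γ' := by
  obtain ⟨a, b, k, f, g, φ, rfl, rfl, rfl⟩ := h
  obtain ⟨a', b', k', f', g', φ', hf, hg, rfl⟩ := h'
  exact HtpyClasses.mk_eq_iff.2 (Q.stackVia_homotopic m φ φ' (HtpyClasses.mk_eq_iff.1 hf.symm)
    (HtpyClasses.mk_eq_iff.1 hg.symm))

theorem exists_isStableSum (α β : HtpyClasses X (Q.Stable m)) : ∃ γ, Q.IsStableSum m α β γ := by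
  obtain ⟨M, hM⟩ := Q.exists_rep_jn m α
  obtain ⟨N, hN⟩ := Q.exists_rep_jn m β
  obtain ⟨f, hf⟩ := hM M le_rfl
  obtain ⟨g, hg⟩ := hN N le_rfl
  exact ⟨_, M, N, M + N, f, g, m.H.concat M N, hf, hg, rfl⟩

/-- The sum of two homotopy classes. -/
def stableAdd (α β : HtpyClasses X (Q.Stable m)) : HtpyClasses X (Q.Stable m) :=
  (Q.exists_isStableSum m α β).choose

variable {m} in
theorem stableAdd_eq_iff {α β γ : HtpyClasses X (Q.Stable m)} :
    Q.stableAdd m α β = γ ↔ Q.IsStableSum m α β γ := by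
  have h := (Q.exists_isStableSum m α β).choose_spec
  constructor
  · rintro rfl
    exact h
  · exact h.unique

theorem mk_stableAdd_mk {a b k : ℕ} (f : C(X, Q.carrier (m.H.tpow a)))
    (g : C(X, Q.carrier (m.H.tpow b)))
    (φ : (m.H.tpow a).tensor (m.H.tpow b) →ₗᵢ[ℂ] m.H.tpow k) :
    Q.stableAdd m (HtpyClasses.mk ((Q.jn m a).comp f)) (HtpyClasses.mk ((Q.jn m b).comp g)) =
      HtpyClasses.mk (Q.stackVia m φ f g) :=
  Q.stableAdd_eq_iff.2 ⟨a, b, k, f, g, φ, rfl, rfl, rfl⟩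

theorem stableAdd_comm (α β : HtpyClasses X (Q.Stable m)) :
    Q.stableAdd m α β = Q.stableAdd m β α := by
  obtain ⟨M, hM⟩ := Q.exists_rep_jn m α
  obtain ⟨N, hN⟩ := Q.exists_rep_jn m β
  obtain ⟨f, rfl⟩ := hM M le_rfl
  obtain ⟨g, rfl⟩ := hN N le_rfl
  rw [Q.mk_stableAdd_mk m g f (m.H.concat N M),
    Q.mk_stableAdd_mk m f g ((m.H.concat N M).comp (commIso _ _))]
  refine congrArg HtpyClasses.mk (ContinuousMap.ext fun x => congrArg (Q.jn m (N + M)) ?_)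
  exact (Q.push_comp _ _ _).trans (congrArg (Q.push _) (Q.push_commIso_tens (f x) (g x)))

theorem stableAdd_assoc (α β γ : HtpyClasses X (Q.Stable m)) :
    Q.stableAdd m (Q.stableAdd m α β) γ = Q.stableAdd m α (Q.stableAdd m β γ) := by
  obtain ⟨a, ha⟩ := Q.exists_rep_jn m α
  obtain ⟨b, hb⟩ := Q.exists_rep_jn m β
  obtain ⟨c, hc⟩ := Q.exists_rep_jn m γ
  obtain ⟨f, rfl⟩ := ha a le_rfl
  obtain ⟨g, rfl⟩ := hb b le_rfl
  obtain ⟨h, rfl⟩ := hc c le_rfl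
  rw [Q.mk_stableAdd_mk m f g (m.H.concat a b), Q.mk_stableAdd_mk m g h (m.H.concat b c)]
  refine (Q.mk_stableAdd_mk m ((Q.pushC (m.H.concat a b)).comp ((Q.tensC _ _).comp (f.prodMk g)))
    h (m.H.concat (a + b) c)).trans (Eq.trans ?_ (Q.mk_stableAdd_mk m f
      ((Q.pushC (m.H.concat b c)).comp ((Q.tensC _ _).comp (g.prodMk h)))
      (m.H.concat a (b + c))).symm)
  have hL : ∀ x, Q.push ((m.H.concat (a + b) c).comp (mapIso (m.H.concat a b) LinearIsometry.id))
      (Q.tens (Q.tens (f x) (g x)) (h x)) = Q.push (m.H.concat (a + b) c)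
        (Q.tens (Q.push (m.H.concat a b) (Q.tens (f x) (g x))) (h x)) := by
    intro x
    rw [push_comp, push_mapIso_tens, push_id]
  have hR : ∀ x, Q.push (((m.H.concat a (b + c)).comp
      (mapIso LinearIsometry.id (m.H.concat b c))).comp (assocIso _ _ _))
      (Q.tens (Q.tens (f x) (g x)) (h x)) = Q.push (m.H.concat a (b + c))
        (Q.tens (f x) (Q.push (m.H.concat b c) (Q.tens (g x) (h x)))) := by
    intro x
    rw [push_comp, push_assocIso_tens, push_comp, push_mapIso_tens, push_id]
  -- Both bracketings are pushes of the same triple stack, along two different isometries.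
  have key := (Q.jn_pushC_homotopic m
    ((m.H.concat (a + b) c).comp (mapIso (m.H.concat a b) LinearIsometry.id))
    (((m.H.concat a (b + c)).comp
      (mapIso LinearIsometry.id (m.H.concat b c))).comp (assocIso _ _ _))).comp_right
    ((Q.tensC₃ _ _ _).comp ((f.prodMk g).prodMk h))
  have h1 := ContinuousMap.ext (f := ((Q.jn m _).comp (Q.pushC ((m.H.concat (a + b) c).comp
    (mapIso (m.H.concat a b) LinearIsometry.id)))).comp ((Q.tensC₃ _ _ _).comp
      ((f.prodMk g).prodMk h))) (g := Q.stackVia m (m.H.concat (a + b) c)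
        ((Q.pushC (m.H.concat a b)).comp ((Q.tensC _ _).comp (f.prodMk g))) h)
    fun x => congrArg (Q.jn m _) (hL x)
  have h2 := ContinuousMap.ext (f := ((Q.jn m _).comp (Q.pushC (((m.H.concat a (b + c)).comp
      (mapIso LinearIsometry.id (m.H.concat b c))).comp (assocIso _ _ _)))).comp
        ((Q.tensC₃ _ _ _).comp ((f.prodMk g).prodMk h)))
      (g := Q.stackVia m (m.H.concat a (b + c)) f
        ((Q.pushC (m.H.concat b c)).comp ((Q.tensC _ _).comp (g.prodMk h))))
    fun x => congrArg (Q.jn m _) (hR x)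
  rw [h1, h2] at key
  exact HtpyClasses.mk_eq_iff.2 key

variable (X) in
/-- The class of the constant map at the base point. -/
def stableZero : HtpyClasses X (Q.Stable m) :=
  HtpyClasses.mk (ContinuousMap.const X (Q.stableBase m))

theorem jn_fact (n : ℕ) : Q.jn m n (Q.fact (m.vec n) (m.norm_vec n)) = Q.stableBase m := by
  refine (Q.exists_stage_map m (Nat.zero_le n)).elim fun p hp => ?_
  have h := hp.1 (Q.fact (m.vec 0) (m.norm_vec 0))
  have h2 : Q.push p (Q.fact (m.vec 0) (m.norm_vec 0)) = Q.fact (m.vec n) (m.norm_vec n) := by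
    rw [push_fact]
    simp only [hp.2]
  rw [h2] at h
  exact h

theorem stableAdd_zero (α : HtpyClasses X (Q.Stable m)) :
    Q.stableAdd m α (Q.stableZero m X) = α := by
  obtain ⟨a, ha⟩ := Q.exists_rep_jn m α
  obtain ⟨f, rfl⟩ := ha a le_rfl
  refine (Q.mk_stableAdd_mk m f (ContinuousMap.const X (Q.fact (m.vec 0) (m.norm_vec 0)))
    (m.H.concat a 0)).trans (HtpyClasses.mk_eq_iff.2 ?_)
  have h := (Q.jn_pushC_homotopic m ((m.H.concat a 0).comp (tmulRight (m.vec 0) (m.norm_vec 0) _))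
    LinearIsometry.id).comp_right f
  have h1 := ContinuousMap.ext (f := ((Q.jn m _).comp (Q.pushC ((m.H.concat a 0).comp
      (tmulRight (m.vec 0) (m.norm_vec 0) _)))).comp f)
    (g := Q.stackVia m (m.H.concat a 0) f
      (ContinuousMap.const X (Q.fact (m.vec 0) (m.norm_vec 0)))) fun x =>
        congrArg (Q.jn m _) ((Q.push_comp _ _ (f x)).trans
          (congrArg (Q.push _) (Q.tens_fact_right _ _ (f x)).symm))
  have h2 := ContinuousMap.ext (f := ((Q.jn m _).comp (Q.pushC LinearIsometry.id)).comp f)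
    (g := (Q.jn m a).comp f) fun x => congrArg (Q.jn m _) (Q.push_id (f x))
  rw [h1, h2] at h
  exact h

variable (X) in
/-- The commutative monoid `[X, 𝒬_Γ(H^{⊗ ∞})]` for a compact space `X`. -/
@[reducible] def stableMonoid : AddCommMonoid (HtpyClasses X (Q.Stable m)) where
  add := Q.stableAdd m
  zero := Q.stableZero m X
  add_assoc := Q.stableAdd_assoc m
  add_comm := Q.stableAdd_comm m
  add_zero := Q.stableAdd_zero m
  zero_add α := (Q.stableAdd_comm m _ α).trans (Q.stableAdd_zero m α)
  nsmul := @nsmulRec _ ⟨Q.stableZero m X⟩ ⟨Q.stableAdd m⟩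

/-- At a common stage the pointwise H-space product is the push along the interleaving isometry, and
the sum may be computed through that isometry as well. -/
theorem exists_stableMul_mk_eq (f g : C(X, Q.Stable m)) : ∃ h : C(X, Q.Stable m),
    (∀ x, Q.StableMul m (f x) (g x) (h x)) ∧
      Q.stableAdd m (HtpyClasses.mk f) (HtpyClasses.mk g) = HtpyClasses.mk h := by
  refine (Q.exists_lift_jn m f).elim fun M hM => ?_
  refine (Q.exists_lift_jn m g).elim fun N hN => ?_
  refine (hM (max M N) (le_max_left _ _)).elim fun f' hf => ?_
  refine (hN (max M N) (le_max_right _ _)).elim fun g' hg => ?_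
  refine ⟨Q.stackVia m (m.H.interleave _) f' g', fun x => ?_, ?_⟩
  · rw [← hf, ← hg]
    exact StableMul.mk _ (f' x) (g' x) _ _ (Q.tens_isTensor _ _) (Q.push_isPush _ _)
  · rw [← ContinuousMap.ext (f := (Q.jn m _).comp f') hf,
      ← ContinuousMap.ext (f := (Q.jn m _).comp g') hg]
    exact Q.mk_stableAdd_mk m f' g' _

theorem precomp_stableAdd {X' : Type*} [TopologicalSpace X'] [CompactSpace X'] (p : C(X', X))
    (α β : HtpyClasses X (Q.Stable m)) :
    HtpyClasses.precomp p (Q.stableAdd m α β) =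
      Q.stableAdd m (HtpyClasses.precomp p α) (HtpyClasses.precomp p β) :=
  (Q.stableAdd_eq_iff.2 ((Q.stableAdd_eq_iff.1 rfl).precomp Q p)).symm

end

end QuantumStateType

open FinHilb

namespace QuantumStateType

variable {Γ : Type*} (Q : QuantumStateType Γ) (m : VacuumModel)

/-! ### Existence of inverses -/

/-- Every family over `X` has an inverse up to homotopy. -/
def HasNeg (X : Type*) [TopologicalSpace X] [CompactSpace X] : Prop :=
  ∀ α : HtpyClasses X (Q.Stable m), ∃ β, Q.stableAdd m α β = Q.stableZero m X

section

variable {X X' : Type*} [TopologicalSpace X] [CompactSpace X] [TopologicalSpace X']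
  [CompactSpace X']

omit [CompactSpace X] [CompactSpace X'] in
theorem precomp_stableZero (p : C(X', X)) :
    HtpyClasses.precomp p (Q.stableZero m X) = Q.stableZero m X' := rfl

theorem neg_unique {α β β' : HtpyClasses X (Q.Stable m)}
    (h : Q.stableAdd m α β = Q.stableZero m X) (h' : Q.stableAdd m α β' = Q.stableZero m X) :
    β = β' := by
  rw [← Q.stableAdd_zero m β, ← h', ← stableAdd_assoc, Q.stableAdd_comm m β α, h,
    Q.stableAdd_comm m _ β', stableAdd_zero]

variable {m} in
-- Transfer the class to `X'`, invert it there and pull the inverse back; only p ∘ i ≃ id is needed,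
-- not a homotopy equivalence.
theorem HasNeg.of_dominated (h : Q.HasNeg m X') (i : C(X, X')) (p : C(X', X))
    (hpi : (p.comp i).Homotopic (ContinuousMap.id X)) : Q.HasNeg m X := by
  intro α
  obtain ⟨β, hβ⟩ := h (HtpyClasses.precomp p α)
  refine ⟨HtpyClasses.precomp i β, ?_⟩
  have h1 : HtpyClasses.precomp i (HtpyClasses.precomp p α) = α := by
    obtain ⟨f, rfl⟩ := α.exists_rep
    exact HtpyClasses.mk_eq_iff.2 (hpi.comp_left f)
  have h2 := congrArg (HtpyClasses.precomp i) hβ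
  rw [precomp_stableAdd, h1] at h2
  exact h2

theorem hasNeg_of_isEmpty [IsEmpty X] : Q.HasNeg m X := by
  intro α
  refine ⟨α, ?_⟩
  obtain ⟨f, hf⟩ := (Q.stableAdd m α α).exists_rep
  rw [← hf]
  exact congrArg HtpyClasses.mk (ContinuousMap.ext fun x => isEmptyElim x)

variable {m} in
-- Over a point, a class is a path component, and a path to the base point is a null-homotopy. This
-- is the only place where invertibility of π₀ is unpacked.
theorem Invertible.hasNeg_punit (hQ : Q.Invertible) : Q.HasNeg m PUnit := by
  intro α
  obtain ⟨f, rfl⟩ := α.exists_rep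
  obtain ⟨y, z, _, hmul, ⟨hz⟩, _⟩ := hQ m (f PUnit.unit)
  refine ⟨HtpyClasses.mk (ContinuousMap.const _ y), ?_⟩
  have hf : f = ContinuousMap.const _ (f PUnit.unit) := ContinuousMap.ext fun _ => rfl
  rw [hf]
  generalize f PUnit.unit = x at hmul
  have hadd : Q.stableAdd m (HtpyClasses.mk (ContinuousMap.const PUnit x))
      (HtpyClasses.mk (ContinuousMap.const PUnit y)) =
        HtpyClasses.mk (ContinuousMap.const PUnit z) := by
    cases hmul with
    | mk n ω τ σ ρ h₁ h₂ =>
      have hρ : ρ = Q.push (m.H.interleave n) (Q.tens ω τ) := by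
        refine (Q.push_eq ?_).symm
        rw [Q.tens_eq h₁]
        exact h₂
      rw [hρ]
      exact Q.mk_stableAdd_mk m (ContinuousMap.const PUnit ω) (ContinuousMap.const PUnit τ)
        (m.H.interleave n)
  rw [hadd]
  refine HtpyClasses.mk_eq_iff.2 ⟨⟨⟨fun p => hz p.1, by fun_prop⟩, fun _ => hz.source,
    fun _ => hz.target⟩⟩

/-- The factorized state with the vector `u^{⊗ n}` at every site. -/
def vac (n : ℕ) : Q.carrier (m.H.tpow n) := Q.fact (m.vec n) (m.norm_vec n)

/-- Stacking two states, as a map to a tensor power. -/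
def mulN (n : ℕ) : C(Q.carrier (m.H.tpow n) × Q.carrier (m.H.tpow n),
    Q.carrier (m.H.tpow (n + n))) :=
  (Q.pushC (m.H.concat n n)).comp (Q.tensC (m.H.tpow n) (m.H.tpow n))

/-- The isometry `x ↦ u^{⊗ n} ⊗ x`. -/
def leftIso (n : ℕ) : m.H.tpow n →ₗᵢ[ℂ] m.H.tpow (n + n) :=
  (m.H.concat n n).comp (tmulLeft (m.vec n) (m.norm_vec n) (m.H.tpow n))

/-- The isometry `x ↦ x ⊗ u^{⊗ n}`. -/
def rightIso (n : ℕ) : m.H.tpow n →ₗᵢ[ℂ] m.H.tpow (n + n) :=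
  (m.H.concat n n).comp (tmulRight (m.vec n) (m.norm_vec n) (m.H.tpow n))

theorem leftIso_vec (n : ℕ) : leftIso m n (m.vec n) = rightIso m n (m.vec n) := rfl

theorem mulN_left (n : ℕ) (ω : Q.carrier (m.H.tpow n)) :
    Q.mulN m n (Q.vac m n, ω) = Q.push (leftIso m n) ω :=
  (congrArg (Q.push _) (Q.tens_fact_left _ _ ω)).trans (Q.push_comp _ _ ω).symm

theorem mulN_right (n : ℕ) (ω : Q.carrier (m.H.tpow n)) :
    Q.mulN m n (ω, Q.vac m n) = Q.push (rightIso m n) ω :=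
  (congrArg (Q.push _) (Q.tens_fact_right _ _ ω)).trans (Q.push_comp _ _ ω).symm

omit [CompactSpace X] in
-- Stacking with the vacuum on the left or on the right is a push along `leftIso` or `rightIso`.
-- These agree on u^{⊗ n}, so the homotopy between them fixes the vacuum, as
-- `loopMap_mul_symm_homotopic` requires. The push along `leftIso` is taken as reference, so the
-- homotopy `L` can be constant.
theorem mulN_loopMap_homotopic (lam : C(X, ℝ)) (n : ℕ)
    (γ δ : C(unitInterval × collar lam, Q.carrier (m.H.tpow n)))
    (h0 : ∀ x, γ (0, x) = Q.vac m n)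
    (h1 : ∀ x, γ (1, x) = Q.vac m n)
    (hδ : ∀ t x, δ (t, x) = γ (unitInterval.symm t, x)) (v v' : C(X, Q.carrier (m.H.tpow n)))
    (hv : IsLoopMap lam (Q.vac m n) γ v)
    (hv' : IsLoopMap lam (Q.vac m n) δ v') :
    ((Q.mulN m n).comp (v.prodMk v')).Homotopic
      (ContinuousMap.const X (Q.push (leftIso m n) (Q.vac m n))) := by
  have hlr : Q.push (leftIso m n) (Q.vac m n) = Q.push (rightIso m n) (Q.vac m n) := by
    rw [vac, push_fact, push_fact]
    rfl
  refine (Q.exists_homotopy_push (rightIso m n) (leftIso m n)).elim fun R hR => ?_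
  have hR' := hR (m.vec n) (m.norm_vec n) (leftIso_vec m n).symm
  exact loopMap_mul_symm_homotopic lam (Q.vac m n) (Q.push (leftIso m n) (Q.vac m n)) (Q.mulN m n)
    (Q.pushC (leftIso m n)) rfl ((Q.pushC (leftIso m n)).comp ContinuousMap.snd)
    (fun ω => (Q.mulN_left m n ω).symm) (fun _ => rfl) (fun _ => rfl) R.toContinuousMap
    (fun ω => (R.apply_zero ω).trans (Q.mulN_right m n ω).symm) (fun ω => R.apply_one ω)
    (fun t => (hR' t).trans hlr.symm) γ δ h0 h1 hδ v v' hv hv'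

omit [CompactSpace X] in
theorem jn_push_leftIso_homotopic (n : ℕ) :
    ((Q.jn m (n + n)).comp (ContinuousMap.const X (Q.push (leftIso m n) (Q.vac m n)))).Homotopic
      (ContinuousMap.const X (Q.stableBase m)) := by
  have h3 := (Q.jn_pushC_homotopic m (leftIso m n) LinearIsometry.id).comp_right
    (ContinuousMap.const X (Q.vac m n))
  have h4 : ((Q.jn m n).comp (Q.pushC LinearIsometry.id)).comp (ContinuousMap.const X (Q.vac m n)) =
      ContinuousMap.const X (Q.stableBase m) :=
    ContinuousMap.ext fun _ => (congrArg (Q.jn m n) (Q.push_id _)).trans (Q.jn_fact m n)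
  rw [h4] at h3
  exact h3

variable {m} in
-- The parameter space of the loops is compact, so the family lifts to a stage, and by injectivity
-- the lifted loops are still based at the vacuum. There the reversed family provides the inverse.
theorem HasNeg.of_loopMap (lam : C(X, ℝ)) (γ : C(unitInterval × collar lam, Q.Stable m))
    (h0 : ∀ x, γ (0, x) = Q.stableBase m) (h1 : ∀ x, γ (1, x) = Q.stableBase m)
    (w : C(X, Q.Stable m)) (hw : IsLoopMap lam (Q.stableBase m) γ w) :
    ∃ β, Q.stableAdd m (HtpyClasses.mk w) β = Q.stableZero m X := by
  have : CompactSpace (collar lam) := isCompact_iff_compactSpace.1 (isClosed_collar lam).isCompact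
  refine (Q.exists_lift_jn m γ).elim fun n hn => (hn n le_rfl).elim fun γ' hγ' => ?_
  have hb := Q.jn_fact m n
  have h0' : ∀ x, γ' (0, x) = Q.vac m n := fun x =>
    Q.jn_injective m n ((hγ' _).trans ((h0 x).trans hb.symm))
  have h1' : ∀ x, γ' (1, x) = Q.vac m n := fun x =>
    Q.jn_injective m n ((hγ' _).trans ((h1 x).trans hb.symm))
  have hδ : ∃ δ : C(unitInterval × collar lam, Q.carrier (m.H.tpow n)),
      ∀ t x, δ (t, x) = γ' (unitInterval.symm t, x) :=
    ⟨⟨fun p => γ' (unitInterval.symm p.1, p.2), by fun_prop⟩, fun _ _ => rfl⟩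
  refine hδ.elim fun δ hδ => ?_
  refine (exists_isLoopMap lam (Q.vac m n) γ' h0' h1').elim fun v hv => ?_
  refine (exists_isLoopMap lam (Q.vac m n) δ (fun x => (hδ 0 x).trans ?_)
    fun x => (hδ 1 x).trans ?_).elim fun v' hv' => ?_
  · exact unitInterval.symm_zero.symm ▸ h1' x
  · exact unitInterval.symm_one.symm ▸ h0' x
  have hwv : w = (Q.jn m n).comp v := by
    ext1 x
    by_cases hx : x ∈ collar lam
    · exact (hw.1 x hx).trans ((hγ' _).symm.trans (congrArg (Q.jn m n) (hv.1 x hx).symm))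
    · exact (hw.2 x hx).trans (hb.symm.trans (congrArg (Q.jn m n) (hv.2 x hx).symm))
  have key := (Q.mulN_loopMap_homotopic m lam n γ' δ h0' h1' hδ v v' hv hv').comp_left
    (Q.jn m (n + n))
  refine ⟨HtpyClasses.mk ((Q.jn m n).comp v'), ?_⟩
  rw [hwv, Q.mk_stableAdd_mk m v v' (m.H.concat n n)]
  exact HtpyClasses.mk_eq_iff.2 (key.trans (Q.jn_push_leftIso_homotopic m n))

variable {m} in
-- A Mayer–Vietoris argument: inverses over the two parts glue to a class `z` that is an inverse of
-- α up to a class coming from loops over the collar, and that error is itself invertible.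
theorem HasNeg.of_cover (lam : C(X, ℝ)) [CompactSpace (lowPart lam)] [CompactSpace (highPart lam)]
    (hL : Q.HasNeg m (lowPart lam)) (hH : Q.HasNeg m (highPart lam)) : Q.HasNeg m X := by
  have : CompactSpace (collar lam) := isCompact_iff_compactSpace.1 (isClosed_collar lam).isCompact
  intro α
  obtain ⟨βL, hβL⟩ := hL (HtpyClasses.precomp (inclC _) α)
  obtain ⟨βH, hβH⟩ := hH (HtpyClasses.precomp (inclC _) α)
  have h1 := congrArg (HtpyClasses.precomp (collarLow lam)) hβL
  have h2 := congrArg (HtpyClasses.precomp (collarHigh lam)) hβH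
  rw [precomp_stableAdd, precomp_stableZero] at h1 h2
  have h3 : HtpyClasses.precomp (collarLow lam) (HtpyClasses.precomp (inclC _) α) =
      HtpyClasses.precomp (collarHigh lam) (HtpyClasses.precomp (inclC _) α) := by
    obtain ⟨f, rfl⟩ := α.exists_rep
    rfl
  rw [h3] at h1
  -- Over the collar both are inverses of the same restriction of α, so they are homotopic there.
  have h4 := Q.neg_unique m h1 h2
  obtain ⟨a, rfl⟩ := βL.exists_rep
  obtain ⟨b, rfl⟩ := βH.exists_rep
  obtain ⟨z, hza, hzb⟩ := exists_glue_of_homotopic lam a b (HtpyClasses.mk_eq_iff.1 h4)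
  obtain ⟨w, hw⟩ := (Q.stableAdd m α (HtpyClasses.mk z)).exists_rep
  have hwL := congrArg (HtpyClasses.precomp (inclC (lowPart lam))) hw
  have hwH := congrArg (HtpyClasses.precomp (inclC (highPart lam))) hw
  rw [precomp_stableAdd, HtpyClasses.precomp_mk _ z, HtpyClasses.mk_eq_iff.2 hza, hβL] at hwL
  rw [precomp_stableAdd, HtpyClasses.precomp_mk _ z, HtpyClasses.mk_eq_iff.2 hzb, hβH] at hwH
  obtain ⟨γ, w', h0, h1, hw', hww'⟩ := exists_homotopic_isLoopMap lam (Q.stableBase m) w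
    (HtpyClasses.mk_eq_iff.1 hwL) (HtpyClasses.mk_eq_iff.1 hwH)
  obtain ⟨β, hβ⟩ := HasNeg.of_loopMap Q lam γ h0 h1 w' hw'
  -- Since (α + z) + β = 0, the corrected inverse is z + β.
  refine ⟨Q.stableAdd m (HtpyClasses.mk z) β, ?_⟩
  rw [← stableAdd_assoc, ← hw, HtpyClasses.mk_eq_iff.2 hww', hβ]

end

end QuantumStateType

/-! ### Attaching a cell -/

section Attach

/-- A map from a compact space to a Hausdorff space is closed, so the preimage of a closed set is a
union of two closed sets, one in `A` and one coming from `D`. -/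
theorem continuous_of_closed_cover {P D Y : Type*} [TopologicalSpace P] [TopologicalSpace D]
    [TopologicalSpace Y] [T2Space P] [CompactSpace D] {A : Set P} (hA : IsClosed A) (Φ : C(D, P))
    (hcov : ∀ x, x ∈ A ∨ ∃ y, Φ y = x) {f : P → Y} (hfA : ContinuousOn f A)
    (hfΦ : Continuous fun y => f (Φ y)) : Continuous f := by
  refine continuous_iff_isClosed.2 fun C hC => ?_
  have h1 : IsClosed (A ∩ f ⁻¹' C) := hfA.preimage_isClosed_of_isClosed hA hC
  have h2 : IsClosed (Φ '' ((fun y => f (Φ y)) ⁻¹' C)) :=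
    Φ.continuous.isClosedMap _ (hC.preimage hfΦ)
  convert h1.union h2 using 1
  ext x
  constructor
  · intro hx
    rcases hcov x with h | ⟨y, rfl⟩
    · exact Or.inl ⟨h, hx⟩
    · exact Or.inr ⟨y, hx, rfl⟩
  · rintro (⟨_, hx⟩ | ⟨y, hy, rfl⟩)
    · exact hx
    · exact hy

variable {K E : Type*} [TopologicalSpace K] [T2Space K] [NormedAddCommGroup E] [NormedSpace ℝ E]
  [ProperSpace E]

/-- `K` is obtained from `A` by attaching a cell with characteristic map `Φ`, where `c` is the
inverse of `Φ` on the open cell. -/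
structure IsAttach (A : Set K) (Φ : C(E, K)) (c : K → E) : Prop where
  isClosed : IsClosed A
  norm_lt : ∀ x, x ∉ A → ‖c x‖ < 1
  apply_coord : ∀ x, x ∉ A → Φ (c x) = x
  notMem : ∀ y, ‖y‖ < 1 → Φ y ∉ A
  coord_apply : ∀ y, ‖y‖ < 1 → c (Φ y) = y
  mem : ∀ y, ‖y‖ = 1 → Φ y ∈ A

variable {A : Set K} {Φ : C(E, K)} {c : K → E}

namespace IsAttach

set_option linter.unusedSectionVars false in
theorem continuous_of (h : IsAttach A Φ c) {Y : Type*} [TopologicalSpace Y] {f : K → Y}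
    (hA : ContinuousOn f A) (hΦ : ContinuousOn (fun y => f (Φ y)) (Metric.closedBall 0 1)) :
    Continuous f := by
  have : CompactSpace (Metric.closedBall (0 : E) 1) :=
    isCompact_iff_compactSpace.1 (isCompact_closedBall 0 1)
  refine continuous_of_closed_cover h.isClosed
    (Φ.comp (inclC (Metric.closedBall (0 : E) 1))) (fun x => ?_) hA
    (continuousOn_iff_continuous_domRestrict.1 hΦ)
  by_cases hx : x ∈ A
  · exact Or.inl hx
  · exact Or.inr ⟨⟨c x, mem_closedBall_zero_iff.2 (h.norm_lt x hx).le⟩, h.apply_coord x hx⟩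

open Classical in
/-- The collar function of a cell. -/
def levelFun (A : Set K) (c : K → E) (x : K) : ℝ := if x ∈ A then -1 else 2 - 3 * ‖c x‖

omit [TopologicalSpace K] [T2Space K] [NormedSpace ℝ E] [ProperSpace E] in
theorem levelFun_of_mem {x : K} (hx : x ∈ A) : levelFun A c x = -1 := if_pos hx

omit [TopologicalSpace K] [T2Space K] [NormedSpace ℝ E] [ProperSpace E] in
theorem levelFun_of_notMem {x : K} (hx : x ∉ A) : levelFun A c x = 2 - 3 * ‖c x‖ := if_neg hx

omit [T2Space K] [NormedSpace ℝ E] [ProperSpace E] in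
-- The two branches agree on the boundary of the cell, as 2 − 3 = −1. The levels 0 and 1 are the
-- radii 2/3 and 1/3, so the collar is the shell between them.
theorem levelFun_apply (h : IsAttach A Φ c) {y : E} (hy : ‖y‖ ≤ 1) :
    levelFun A c (Φ y) = 2 - 3 * ‖y‖ := by
  rcases hy.lt_or_eq with hy | hy
  · rw [levelFun_of_notMem (h.notMem y hy), h.coord_apply y hy]
  · rw [levelFun_of_mem (h.mem y hy), hy]
    norm_num

theorem continuous_levelFun (h : IsAttach A Φ c) : Continuous (levelFun A c) := by
  refine h.continuous_of (continuousOn_const.congr fun x hx => levelFun_of_mem hx) ?_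
  have : ContinuousOn (fun y : E => 2 - 3 * ‖y‖) (Metric.closedBall 0 1) := by fun_prop
  exact this.congr fun y hy => h.levelFun_apply (mem_closedBall_zero_iff.1 hy)

/-- The collar function of a cell as a continuous map. -/
def level (h : IsAttach A Φ c) : C(K, ℝ) := ⟨levelFun A c, h.continuous_levelFun⟩

theorem notMem_of_mem_highPart (h : IsAttach A Φ c) {x : K} (hx : x ∈ highPart h.level) :
    x ∉ A ∧ ‖c x‖ ≤ 2 / 3 := by
  have hx : 0 ≤ levelFun A c x := hx
  have h1 : x ∉ A := fun h1 => by
    rw [levelFun_of_mem h1] at hx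
    norm_num at hx
  rw [levelFun_of_notMem h1] at hx
  exact ⟨h1, by linarith⟩

theorem apply_mem_highPart (h : IsAttach A Φ c) {y : E} (hy : ‖y‖ ≤ 2 / 3) :
    Φ y ∈ highPart h.level := by
  change 0 ≤ levelFun A c (Φ y)
  rw [h.levelFun_apply (by linarith)]
  linarith

theorem apply_mem_lowPart (h : IsAttach A Φ c) {y : E} (hy : 1 / 3 ≤ ‖y‖) (hy' : ‖y‖ ≤ 1) :
    Φ y ∈ lowPart h.level := by
  change levelFun A c (Φ y) ≤ 1
  rw [h.levelFun_apply hy']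
  linarith

theorem mem_lowPart (h : IsAttach A Φ c) {x : K} (hx : x ∈ A) : x ∈ lowPart h.level := by
  change levelFun A c x ≤ 1
  rw [levelFun_of_mem hx]
  norm_num

theorem le_norm_of_mem_lowPart (h : IsAttach A Φ c) {x : K} (hx : x ∈ lowPart h.level)
    (hA : x ∉ A) : 1 / 3 ≤ ‖c x‖ := by
  have hx : levelFun A c x ≤ 1 := hx
  rw [levelFun_of_notMem hA] at hx
  linarith

/-- The high part is the ball of radius 2/3 in the open cell, which contracts radially to its
centre. The coordinate `c` is continuous there because Φ maps the compact ball onto the high part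
with `c` as inverse. -/
theorem exists_homotopy_highPart (h : IsAttach A Φ c) : ∃ y : highPart h.level,
    (ContinuousMap.const (highPart h.level) y).Homotopic (ContinuousMap.id _) := by
  have : CompactSpace (Metric.closedBall (0 : E) (2 / 3)) :=
    isCompact_iff_compactSpace.1 (isCompact_closedBall 0 _)
  have hc : Continuous fun x : highPart h.level => c x := by
    refine continuous_of_closed_cover isClosed_empty
      (⟨fun y => ⟨Φ y, h.apply_mem_highPart (mem_closedBall_zero_iff.1 y.2)⟩,
        by fun_prop⟩ : C(Metric.closedBall (0 : E) (2 / 3), highPart h.level))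
      (fun x => Or.inr ?_) (continuousOn_empty _) ?_
    · have hx := h.notMem_of_mem_highPart x.2
      exact ⟨⟨c x, mem_closedBall_zero_iff.2 hx.2⟩, Subtype.ext (h.apply_coord x hx.1)⟩
    · refine (continuous_congr fun y => ?_).2 continuous_subtype_val
      exact h.coord_apply y (lt_of_le_of_lt (mem_closedBall_zero_iff.1 y.2) (by norm_num))
  refine ⟨⟨Φ 0, h.apply_mem_highPart (by rw [norm_zero]; norm_num)⟩,
    ⟨⟨⟨fun p => ⟨Φ ((p.1 : ℝ) • c p.2), h.apply_mem_highPart ?_⟩,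
      (Φ.continuous.comp ((continuous_subtype_val.comp continuous_fst).smul
        (hc.comp continuous_snd))).subtype_mk _⟩,
      fun x => Subtype.ext ?_, fun x => Subtype.ext ?_⟩⟩⟩
  · rw [norm_smul, Real.norm_of_nonneg p.1.2.1]
    exact (mul_le_of_le_one_left (norm_nonneg _) p.1.2.2).trans
      (h.notMem_of_mem_highPart p.2.2).2
  · change Φ ((0 : ℝ) • c x) = Φ 0
    rw [zero_smul]
  · change Φ ((1 : ℝ) • c x) = x
    rw [one_smul, h.apply_coord _ (h.notMem_of_mem_highPart x.2).1]

/-- Radial expansion. -/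
def expand (t : ℝ) (y : E) : E := (1 - t + t / ‖y‖) • y

omit [ProperSpace E] in
theorem norm_expand {t : ℝ} (h0 : 0 ≤ t) (h1 : t ≤ 1) {y : E} (hy : 0 < ‖y‖) :
    ‖expand t y‖ = (1 - t) * ‖y‖ + t := by
  have h2 : 0 ≤ 1 - t + t / ‖y‖ := by
    have : 0 ≤ t / ‖y‖ := div_nonneg h0 hy.le
    linarith
  rw [expand, norm_smul, Real.norm_of_nonneg h2, add_mul, div_mul_cancel₀ _ hy.ne']

omit [ProperSpace E] in
theorem continuousOn_expand :
    ContinuousOn (fun p : unitInterval × E => expand (p.1 : ℝ) p.2) {p | p.2 ≠ 0} := by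
  unfold expand
  refine ContinuousOn.smul (ContinuousOn.add (by fun_prop) (ContinuousOn.div (by fun_prop)
    (by fun_prop) fun p hp => norm_ne_zero_iff.2 hp)) (by fun_prop)

open Classical in
/-- The deformation of the complement of a small ball in the cell. -/
def deform (A : Set K) (Φ : C(E, K)) (c : K → E) (p : unitInterval × K) : K :=
  if p.2 ∈ A then p.2 else Φ (expand (p.1 : ℝ) (c p.2))

omit [T2Space K] [ProperSpace E] in
theorem deform_of_mem {t : unitInterval} {x : K} (hx : x ∈ A) : deform A Φ c (t, x) = x :=
  if_pos hx

omit [T2Space K] [ProperSpace E] in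
theorem deform_of_notMem {t : unitInterval} {x : K} (hx : x ∉ A) :
    deform A Φ c (t, x) = Φ (expand (t : ℝ) (c x)) :=
  if_neg hx

omit [T2Space K] [ProperSpace E] in
theorem deform_apply (h : IsAttach A Φ c) (t : unitInterval) {y : E} (hy : ‖y‖ ≤ 1) :
    deform A Φ c (t, Φ y) = Φ (expand (t : ℝ) y) := by
  rcases hy.lt_or_eq with hy | hy
  · rw [deform_of_notMem (h.notMem y hy), h.coord_apply y hy]
  · rw [deform_of_mem (h.mem y hy), expand, hy, div_one, sub_add_cancel, one_smul]

/-- Continuity is checked on the part in `A` and on the shell 1/3 ≤ ‖y‖ ≤ 1; the shell avoids the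
origin, where the radial expansion is not defined sensibly. -/
theorem continuous_deform (h : IsAttach A Φ c) :
    Continuous fun p : unitInterval × lowPart h.level => deform A Φ c (p.1, p.2) := by
  let D : Set E := {y | 1 / 3 ≤ ‖y‖ ∧ ‖y‖ ≤ 1}
  have hD : IsClosed D := (isClosed_le continuous_const continuous_norm).inter
    (isClosed_le continuous_norm continuous_const)
  have : CompactSpace D := isCompact_iff_compactSpace.1
    ((isCompact_closedBall (0 : E) 1).of_isClosed_subset hD
      fun y hy => mem_closedBall_zero_iff.2 hy.2)
  refine continuous_of_closed_cover
    (A := {p : unitInterval × lowPart h.level | (p.2 : K) ∈ A})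
    (h.isClosed.preimage (by fun_prop))
    (⟨fun p : unitInterval × D => (p.1, ⟨Φ p.2, h.apply_mem_lowPart p.2.2.1 p.2.2.2⟩), by fun_prop⟩ :
      C(unitInterval × D, unitInterval × lowPart h.level)) (fun p => ?_) ?_ ?_
  · by_cases hp : (p.2 : K) ∈ A
    · exact Or.inl hp
    · exact Or.inr ⟨(p.1, ⟨c p.2, h.le_norm_of_mem_lowPart p.2.2 hp, (h.norm_lt _ hp).le⟩),
        Prod.ext rfl (Subtype.ext (h.apply_coord _ hp))⟩
  · have : ContinuousOn (fun p : unitInterval × lowPart h.level => (p.2 : K))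
        {p : unitInterval × lowPart h.level | (p.2 : K) ∈ A} := by fun_prop
    exact this.congr fun p hp => deform_of_mem hp
  · have h1 : Continuous fun p : unitInterval × D => expand (p.1 : ℝ) (p.2 : E) :=
      continuousOn_expand.comp_continuous (f := fun p : unitInterval × D => (p.1, (p.2 : E)))
        (by fun_prop) fun p => norm_ne_zero_iff.1 (by have := p.2.2.1; linarith)
    exact (continuous_congr fun p : unitInterval × D => h.deform_apply p.1 p.2.2.2).2 (Φ.continuous.comp h1)

theorem deform_mem_lowPart (h : IsAttach A Φ c) (t : unitInterval) {x : K}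
    (hx : x ∈ lowPart h.level) : deform A Φ c (t, x) ∈ lowPart h.level := by
  by_cases hA : x ∈ A
  · rw [deform_of_mem hA]
    exact hx
  · rw [deform_of_notMem hA]
    have h1 := h.le_norm_of_mem_lowPart hx hA
    have h2 := h.norm_lt x hA
    have h3 := norm_expand t.2.1 t.2.2 (y := c x) (by linarith)
    have h4 := t.2.1
    have h5 := t.2.2
    refine h.apply_mem_lowPart ?_ ?_ <;> rw [h3] <;> nlinarith

theorem deform_one_mem (h : IsAttach A Φ c) {x : K} (hx : x ∈ lowPart h.level) :
    deform A Φ c (1, x) ∈ A := by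
  by_cases hA : x ∈ A
  · rw [deform_of_mem hA]
    exact hA
  · rw [deform_of_notMem hA]
    have h1 := h.le_norm_of_mem_lowPart hx hA
    refine h.mem _ ?_
    have h2 := norm_expand (t := 1) zero_le_one le_rfl (y := c x) (by linarith)
    exact h2.trans (by ring)

omit [T2Space K] [ProperSpace E] in
theorem deform_zero (h : IsAttach A Φ c) (x : K) : deform A Φ c (0, x) = x := by
  by_cases hA : x ∈ A
  · rw [deform_of_mem hA]
  · rw [deform_of_notMem hA]
    have h2 : expand ((0 : unitInterval) : ℝ) (c x) = c x := by
      simp [expand]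
    rw [h2, h.apply_coord x hA]

/-- With the centre of the cell removed, radial expansion pushes the rest of the cell onto its
boundary, inside `A`. This shows that the low part is dominated by `A`. -/
theorem exists_retract_lowPart (h : IsAttach A Φ c) :
    ∃ (i : C(lowPart h.level, A)) (p : C(A, lowPart h.level)),
      (p.comp i).Homotopic (ContinuousMap.id _) := by
  have hc := h.continuous_deform
  refine ⟨⟨fun x => ⟨deform A Φ c (1, x), h.deform_one_mem x.2⟩,
    (hc.comp (Continuous.prodMk_right (1 : unitInterval))).subtype_mk _⟩,
    ⟨fun x => ⟨x, h.mem_lowPart x.2⟩, by fun_prop⟩, ContinuousMap.Homotopic.symm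
    ⟨⟨⟨fun p => ⟨deform A Φ c (p.1, p.2), h.deform_mem_lowPart p.1 p.2.2⟩, hc.subtype_mk _⟩,
      fun x => Subtype.ext (h.deform_zero x), fun x => rfl⟩⟩⟩

end IsAttach

end Attach

namespace QuantumStateType

variable {Γ : Type*} (Q : QuantumStateType Γ) {m : VacuumModel}

/-- The low part is dominated by `A` and the high part by a point, so both parts of the cover have
inverses. -/
theorem HasNeg.of_isAttach {K E : Type*} [TopologicalSpace K] [T2Space K] [CompactSpace K]
    [NormedAddCommGroup E] [NormedSpace ℝ E] [ProperSpace E] {A : Set K} {Φ : C(E, K)} {c : K → E}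
    [CompactSpace A] (hQ : Q.Invertible) (h : IsAttach A Φ c) (hA : Q.HasNeg m A) :
    Q.HasNeg m K := by
  have : CompactSpace (lowPart h.level) :=
    isCompact_iff_compactSpace.1 (isClosed_lowPart h.level).isCompact
  have : CompactSpace (highPart h.level) :=
    isCompact_iff_compactSpace.1 (isClosed_highPart h.level).isCompact
  obtain ⟨i, p, hpi⟩ := h.exists_retract_lowPart
  obtain ⟨y, hy⟩ := h.exists_homotopy_highPart
  exact HasNeg.of_cover Q h.level (hA.of_dominated Q i p hpi)
    ((Invertible.hasNeg_punit.{_, 0} Q hQ).of_dominated Q (ContinuousMap.const _ PUnit.unit)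
      (ContinuousMap.const _ y) hy)

end QuantumStateType

/-! ### Finite families of cells -/

section Cells

open Topology Topology.RelCWComplex

variable (Z : Type*) [TopologicalSpace Z] [Topology.CWComplex (Set.univ : Set Z)]

/-- The cells of a CW complex. -/
abbrev CWCells := Σ n : ℕ, Topology.RelCWComplex.cell (Set.univ : Set Z) n

variable {Z}

/-- The union of the open cells of a family. -/
def cellSet (F : Finset (CWCells Z)) : Set Z := {x | ∃ c ∈ F, x ∈ openCell c.1 c.2}

/-- The boundary of each cell of the family is covered by cells of smaller dimension of the
family. -/
def IsClosedFamily (F : Finset (CWCells Z)) : Prop :=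
  ∀ c ∈ F, ∀ x ∈ cellFrontier c.1 c.2, ∃ d ∈ F, d.1 < c.1 ∧ x ∈ openCell d.1 d.2

theorem eq_of_mem_openCell {c d : CWCells Z} {x : Z} (hc : x ∈ openCell c.1 c.2)
    (hd : x ∈ openCell d.1 d.2) : c = d :=
  eq_of_not_disjoint_openCell (Set.not_disjoint_iff.2 ⟨x, hc, hd⟩)

theorem cellSet_mono {F G : Finset (CWCells Z)} (h : F ⊆ G) : cellSet F ⊆ cellSet G :=
  fun _ ⟨c, hc, hx⟩ => ⟨c, h hc, hx⟩

theorem IsClosedFamily.closedCell_subset {F : Finset (CWCells Z)} (hF : IsClosedFamily F)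
    {c : CWCells Z} (hc : c ∈ F) : closedCell c.1 c.2 ⊆ cellSet F := by
  intro x hx
  rw [← cellFrontier_union_openCell_eq_closedCell] at hx
  rcases hx with hx | hx
  · obtain ⟨d, hd, _, hxd⟩ := hF c hc x hx
    exact ⟨d, hd, hxd⟩
  · exact ⟨c, hc, hx⟩

theorem IsClosedFamily.isCompact {F : Finset (CWCells Z)} (hF : IsClosedFamily F) :
    IsCompact (cellSet F) := by
  have h : cellSet F = ⋃ c ∈ F, closedCell c.1 c.2 := by
    refine Set.Subset.antisymm ?_ (Set.iUnion₂_subset fun c hc => hF.closedCell_subset hc)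
    rintro x ⟨c, hc, hx⟩
    exact Set.mem_iUnion₂.2 ⟨c, hc, openCell_subset_closedCell _ _ hx⟩
  rw [h]
  exact F.isCompact_biUnion fun c _ => isCompact_closedCell

open Classical in
theorem exists_isClosedFamily_biUnion (S : Finset (CWCells Z))
    (h : ∀ c ∈ S, ∃ F : Finset (CWCells Z), IsClosedFamily F ∧ c ∈ F) :
    ∃ F : Finset (CWCells Z), IsClosedFamily F ∧ S ⊆ F := by
  induction S using Finset.induction_on with
  | empty => exact ⟨∅, fun c hc => absurd hc (Finset.notMem_empty c), Finset.Subset.refl _⟩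
  | insert c S _ ih =>
    obtain ⟨F, hF, hSF⟩ := ih fun d hd => h d (Finset.mem_insert_of_mem hd)
    obtain ⟨G, hG, hcG⟩ := h c (Finset.mem_insert_self c S)
    refine ⟨F ∪ G, fun d hd x hx => ?_, Finset.insert_subset (Finset.mem_union_right _ hcG)
      (hSF.trans Finset.subset_union_left)⟩
    rcases Finset.mem_union.1 hd with hd | hd
    · obtain ⟨e, he, h'⟩ := hF d hd x hx
      exact ⟨e, Finset.mem_union_left _ he, h'⟩
    · obtain ⟨e, he, h'⟩ := hG d hd x hx
      exact ⟨e, Finset.mem_union_right _ he, h'⟩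

open Classical in
-- Closure finiteness and induction on the dimension: the boundary of a cell lies in finitely many
-- open cells of smaller dimension.
theorem exists_isClosedFamily (c : CWCells Z) :
    ∃ F : Finset (CWCells Z), IsClosedFamily F ∧ c ∈ F := by
  obtain ⟨n, i⟩ := c
  induction n using Nat.strong_induction_on with
  | _ n ih =>
    obtain ⟨I, hI⟩ := CWComplex.cellFrontier_subset_finite_openCell n i
    obtain ⟨F, hF, hIF⟩ := exists_isClosedFamily_biUnion ((Finset.range n).sigma I)
      fun d hd => ih d.1 (Finset.mem_range.1 (Finset.mem_sigma.1 hd).1) d.2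
    refine ⟨insert ⟨n, i⟩ F, fun d hd x hx => ?_, Finset.mem_insert_self _ _⟩
    rcases Finset.mem_insert.1 hd with rfl | hd
    · obtain ⟨k, hk⟩ := Set.mem_iUnion.1 (hI hx)
      obtain ⟨hkn, hk⟩ := Set.mem_iUnion.1 hk
      obtain ⟨l, hl⟩ := Set.mem_iUnion.1 hk
      obtain ⟨hlI, hxl⟩ := Set.mem_iUnion.1 hl
      exact ⟨⟨k, l⟩, Finset.mem_insert_of_mem
        (hIF (Finset.mem_sigma.2 ⟨Finset.mem_range.2 hkn, hlI⟩)), hkn, hxl⟩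
    · obtain ⟨e, he, h'⟩ := hF d hd x hx
      exact ⟨e, Finset.mem_insert_of_mem he, h'⟩

/-- Choose a point of `K` in each open cell that `K` meets. Any set of chosen points meets a closed
cell in a finite set, hence is closed; so the chosen points form a compact discrete set, which is
finite. -/
theorem finite_cells_of_isCompact [T2Space Z] {K : Set Z} (hK : IsCompact K) :
    {c : CWCells Z | (K ∩ openCell c.1 c.2).Nonempty}.Finite := by
  let S := {c : CWCells Z | (K ∩ openCell c.1 c.2).Nonempty}
  have hS : ∀ c : S, ∃ x, x ∈ K ∧ x ∈ openCell c.1.1 c.1.2 := fun c => c.2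
  choose x hxK hx using hS
  have hinj : Function.Injective x := fun c d hcd =>
    Subtype.ext (eq_of_mem_openCell (hx c) (hcd ▸ hx d))
  have hclosed : ∀ T : Set Z, T ⊆ Set.range x → IsClosed T := by
    intro T hT
    refine (CWComplex.closed Set.univ T (Set.subset_univ T)).2 fun n j => Set.Finite.isClosed ?_
    obtain ⟨F, hF, hc⟩ := exists_isClosedFamily (⟨n, j⟩ : CWCells Z)
    have hfin : (x '' {c : S | c.1 ∈ F}).Finite := by
      refine Set.Finite.image _ (Set.Finite.of_finite_image (f := Subtype.val) ?_
        Subtype.val_injective.injOn)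
      exact F.finite_toSet.subset (Set.image_subset_iff.2 fun c hc => hc)
    refine hfin.subset ?_
    rintro y ⟨hyT, hy⟩
    obtain ⟨c, rfl⟩ := hT hyT
    obtain ⟨d, hd, hxd⟩ := hF.closedCell_subset hc hy
    exact ⟨c, by rwa [← eq_of_mem_openCell (hx c) hxd] at hd, rfl⟩
  have hcomp : IsCompact (Set.range x) :=
    hK.of_isClosed_subset (hclosed _ Set.Subset.rfl) (Set.range_subset_iff.2 hxK)
  have hdisc : IsDiscrete (Set.range x) := by
    refine isDiscrete_iff_forall_mem_exists_isOpen.2 fun y hy => ?_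
    refine ⟨(Set.range x \ {y})ᶜ, (hclosed _ Set.sdiff_subset).isOpen_compl, ?_⟩
    ext z
    simp only [Set.mem_inter_iff, Set.mem_compl_iff, Set.mem_sdiff, Set.mem_singleton_iff, not_and,
      not_not]
    constructor
    · rintro ⟨h1, h2⟩
      exact h1 h2
    · rintro rfl
      exact ⟨fun _ => rfl, hy⟩
  have hfin := hcomp.finite hdisc
  have : Finite S := by
    have := hfin.to_subtype
    exact Finite.of_injective _ (Set.rangeFactorization_injective.2 hinj)
  exact Set.toFinite S

theorem exists_isClosedFamily_of_isCompact [T2Space Z] {K : Set Z} (hK : IsCompact K) :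
    ∃ F : Finset (CWCells Z), IsClosedFamily F ∧ K ⊆ cellSet F := by
  obtain ⟨F, hF, hKF⟩ := exists_isClosedFamily_biUnion (finite_cells_of_isCompact hK).toFinset
    fun c _ => exists_isClosedFamily c
  refine ⟨F, hF, fun x hx => ?_⟩
  have h := (CWComplex.iUnion_openCell_eq_complex (C := (Set.univ : Set Z))).symm ▸ Set.mem_univ x
  obtain ⟨n, hn⟩ := Set.mem_iUnion.1 h
  obtain ⟨j, hj⟩ := Set.mem_iUnion.1 hn
  exact ⟨⟨n, j⟩, hKF ((Set.Finite.mem_toFinset _).2 ⟨x, hx, hj⟩), hj⟩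

/-- The radial retraction onto the unit ball. -/
def radial {E : Type*} [NormedAddCommGroup E] [NormedSpace ℝ E] (y : E) : E := (max 1 ‖y‖)⁻¹ • y

theorem radial_of_norm_le {E : Type*} [NormedAddCommGroup E] [NormedSpace ℝ E] {y : E}
    (hy : ‖y‖ ≤ 1) : radial y = y := by
  rw [radial, max_eq_left hy, inv_one, one_smul]

theorem norm_radial_le {E : Type*} [NormedAddCommGroup E] [NormedSpace ℝ E] (y : E) :
    ‖radial y‖ ≤ 1 := by
  have h : 0 < max 1 ‖y‖ := lt_max_of_lt_left zero_lt_one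
  rw [radial, norm_smul, norm_inv, Real.norm_of_nonneg h.le, inv_mul_le_iff₀ h, mul_one]
  exact le_max_right _ _

theorem continuous_radial {E : Type*} [NormedAddCommGroup E] [NormedSpace ℝ E] :
    Continuous (radial : E → E) := by
  unfold radial
  exact Continuous.smul (Continuous.inv₀ (by fun_prop) fun y =>
    (lt_max_of_lt_left zero_lt_one).ne') continuous_id

open Classical in
-- A cell of maximal dimension is needed for no other boundary, so removing it leaves a closed
-- family. Its characteristic map is continuous only on the closed ball; composing with `radial`
-- makes it a continuous map on the whole space without changing it on the ball.
theorem IsClosedFamily.exists_isAttach [T2Space Z] {F : Finset (CWCells Z)} (hF : IsClosedFamily F)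
    (hne : F.Nonempty) : ∃ c ∈ F, IsClosedFamily (F.erase c) ∧
      ∃ (Φ : C(Fin c.1 → ℝ, cellSet F)) (k : cellSet F → (Fin c.1 → ℝ)),
        IsAttach {x : cellSet F | (x : Z) ∈ cellSet (F.erase c)} Φ k := by
  obtain ⟨c, hc, hmax⟩ := F.exists_max_image Sigma.fst hne
  have herase : IsClosedFamily (F.erase c) := by
    intro d hd x hx
    obtain ⟨e, he, hed, hxe⟩ := hF d (Finset.mem_of_mem_erase hd) x hx
    refine ⟨e, Finset.mem_erase.2 ⟨?_, he⟩, hed, hxe⟩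
    rintro rfl
    exact absurd (hmax d (Finset.mem_of_mem_erase hd)) (not_le.2 hed)
  have hmem : ∀ y : Fin c.1 → ℝ, RelCWComplex.map c.1 c.2 (radial y) ∈ cellSet F := fun y =>
    hF.closedCell_subset hc ⟨radial y, mem_closedBall_zero_iff.2 (norm_radial_le y), rfl⟩
  have hsymm : ∀ y : Fin c.1 → ℝ, ‖y‖ < 1 →
      (RelCWComplex.map c.1 c.2).symm (RelCWComplex.map c.1 c.2 y) = y := fun y hy =>
    (RelCWComplex.map c.1 c.2).left_inv (by
      rw [RelCWComplex.source_eq]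
      exact mem_ball_zero_iff.2 hy)
  have hopen : ∀ x : cellSet F, (x : Z) ∉ cellSet (F.erase c) →
      ∃ y, ‖y‖ < 1 ∧ RelCWComplex.map c.1 c.2 y = x := by
    intro x hx
    obtain ⟨d, hd, hxd⟩ := x.2
    by_cases hdc : d = c
    · subst hdc
      obtain ⟨y, hy, hyx⟩ := hxd
      exact ⟨y, mem_ball_zero_iff.1 hy, hyx⟩
    · exact absurd ⟨d, Finset.mem_erase.2 ⟨hdc, hd⟩, hxd⟩ hx
  refine ⟨c, hc, herase, ⟨fun y => ⟨RelCWComplex.map c.1 c.2 (radial y), hmem y⟩, ?_⟩,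
    fun x => (RelCWComplex.map c.1 c.2).symm x, ?_, ?_, ?_, ?_, ?_, ?_⟩
  · refine Continuous.subtype_mk ?_ _
    exact (RelCWComplex.continuousOn c.1 c.2).comp_continuous continuous_radial
      fun y => mem_closedBall_zero_iff.2 (norm_radial_le y)
  · exact herase.isCompact.isClosed.preimage continuous_subtype_val
  · intro x hx
    obtain ⟨y, hy, hyx⟩ := hopen x hx
    rw [← hyx, hsymm y hy]
    exact hy
  · intro x hx
    obtain ⟨y, hy, hyx⟩ := hopen x hx
    refine Subtype.ext ?_
    change RelCWComplex.map c.1 c.2 (radial ((RelCWComplex.map c.1 c.2).symm x)) = x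
    rw [← hyx, hsymm y hy, radial_of_norm_le hy.le]
  · rintro y hy ⟨d, hd, hxd⟩
    change RelCWComplex.map c.1 c.2 (radial y) ∈ openCell d.1 d.2 at hxd
    rw [radial_of_norm_le hy.le] at hxd
    exact (Finset.mem_erase.1 hd).1 (eq_of_mem_openCell hxd ⟨y, mem_ball_zero_iff.2 hy, rfl⟩)
  · intro y hy
    change (RelCWComplex.map c.1 c.2).symm (RelCWComplex.map c.1 c.2 (radial y)) = y
    rw [radial_of_norm_le hy.le, hsymm y hy]
  · intro y hy
    change RelCWComplex.map c.1 c.2 (radial y) ∈ cellSet (F.erase c)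
    rw [radial_of_norm_le hy.le]
    obtain ⟨d, hd, hdc, hxd⟩ := hF c hc _ ⟨y, mem_sphere_zero_iff_norm.2 hy, rfl⟩
    refine ⟨d, Finset.mem_erase.2 ⟨?_, hd⟩, hxd⟩
    rintro rfl
    exact lt_irrefl _ hdc

end Cells

namespace QuantumStateType

variable {Γ : Type*} (Q : QuantumStateType Γ) {m : VacuumModel}

open Classical in
theorem HasNeg.cellSet {Z : Type*} [TopologicalSpace Z] [T2Space Z]
    [Topology.CWComplex (Set.univ : Set Z)] (hQ : Q.Invertible) (k : ℕ) :
    ∀ (F : Finset (CWCells Z)) [CompactSpace (cellSet F)], F.card = k → IsClosedFamily F →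
      Q.HasNeg m (cellSet F) := by
  induction k with
  | zero =>
    intro F _ hcard _
    rw [Finset.card_eq_zero] at hcard
    have : IsEmpty (_root_.cellSet F) := by
      refine ⟨fun x => ?_⟩
      obtain ⟨c, hc, _⟩ := x.2
      rw [hcard] at hc
      exact Finset.notMem_empty c hc
    exact Q.hasNeg_of_isEmpty m
  | succ k ih =>
    intro F _ hcard hF
    obtain ⟨c, hc, herase, Φ, κ, h⟩ := hF.exists_isAttach (Finset.card_pos.1 (by omega))
    have : CompactSpace (_root_.cellSet (F.erase c)) := isCompact_iff_compactSpace.1 herase.isCompact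
    have : CompactSpace {x : _root_.cellSet F | (x : Z) ∈ _root_.cellSet (F.erase c)} :=
      isCompact_iff_compactSpace.1 h.isClosed.isCompact
    have h1 := ih (F.erase c) (by rw [Finset.card_erase_of_mem hc, hcard]; rfl) herase
    refine HasNeg.of_isAttach Q hQ h (h1.of_dominated Q ⟨fun x => ⟨x.1.1, x.2⟩, by fun_prop⟩
      ⟨fun x => ⟨⟨x.1, cellSet_mono (Finset.erase_subset c F) x.2⟩, x.2⟩, by fun_prop⟩ ?_)
    exact ContinuousMap.Homotopic.refl _

/-- The image of `X` in the CW complex is compact, so it lies in a finite subcomplex, and the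
homotopy inverse restricted to that subcomplex exhibits `X` as dominated by it. -/
theorem hasNeg_of_isParameterSpace (hQ : Q.Invertible) {X : Type*} [TopologicalSpace X]
    [CompactSpace X] (hX : IsParameterSpace X) : Q.HasNeg m X := by
  obtain ⟨_, _, Z, _, _, _, ⟨e⟩⟩ := hX
  obtain ⟨F, hF, hXF⟩ := exists_isClosedFamily_of_isCompact (isCompact_range e.toFun.continuous)
  have : CompactSpace (cellSet F) := isCompact_iff_compactSpace.1 hF.isCompact
  refine (HasNeg.cellSet Q hQ _ F rfl hF).of_dominated Q
    ⟨fun x => ⟨e.toFun x, hXF ⟨x, rfl⟩⟩, by fun_prop⟩ (e.invFun.comp (inclC _)) ?_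
  exact e.left_inv

end QuantumStateType

/-! ### Localization and group completion of commutative monoids -/

section Completion

/-- In the group `L` one has ι k a = g a − k · g ψ, which forces the value φ a − k · φ ψ of the
extension. This is well defined because the n extra copies of ψ in the relation cancel in the group
`A`. -/
theorem isGroupCompletion_of_localization.{p} {M L : Type*} [AddCommMonoid M] [AddCommGroup L]
    (ψ : M) (ι : ℕ → M → L) (hs : ∀ z, ∃ k a, ι k a = z)
    (hiff : ∀ k l a b, ι k a = ι l b ↔ ∃ n : ℕ, a + (l + n) • ψ = b + (k + n) • ψ)
    (hadd : ∀ k l a b, ι k a + ι l b = ι (k + l) (a + b)) (g : M →+ L)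
    (hg : ∀ a, g a = ι 0 a) : IsGroupCompletion.{p} g := by
  intro A _ φ
  have hι : ∀ k a, ι k a = g a - k • g ψ := by
    intro k a
    rw [eq_sub_iff_add_eq, ← map_nsmul, hg, hadd, hg, hiff]
    refine ⟨0, ?_⟩
    simp only [add_zero, zero_smul]
  have hwd : ∀ k l a b, ι k a = ι l b → φ a - k • φ ψ = φ b - l • φ ψ := by
    intro k l a b h
    obtain ⟨n, hn⟩ := (hiff k l a b).1 h
    have h1 := congrArg φ hn
    rw [map_add, map_add, map_nsmul, map_nsmul, add_nsmul, add_nsmul, ← add_assoc, ← add_assoc]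
      at h1
    rw [sub_eq_sub_iff_add_eq_add]
    exact add_right_cancel h1
  choose k a hka using hs
  have hval : ∀ l b, φ (a (ι l b)) - k (ι l b) • φ ψ = φ b - l • φ ψ := fun l b =>
    hwd _ _ _ _ (hka (ι l b))
  refine ⟨AddMonoidHom.mk' (fun z => φ (a z) - k z • φ ψ) fun y z => ?_, ?_, ?_⟩
  · rw [show φ (a (y + z)) - k (y + z) • φ ψ = φ (a y + a z) - (k y + k z) • φ ψ from
      hwd _ _ _ _ (by rw [hka, ← hadd, hka, hka]), map_add, add_nsmul]
    abel
  · ext b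
    change φ (a (g b)) - k (g b) • φ ψ = φ b
    rw [hg, hval, zero_smul, sub_zero]
  · intro Φ hΦ
    ext z
    change Φ z = φ (a z) - k z • φ ψ
    have h : ∀ b, Φ (g b) = φ b := fun b => DFunLike.congr_fun hΦ b
    rw [← h, ← h, ← map_nsmul, ← map_sub, ← hι, hka]

/-- Two objects with the same universal property are isomorphic. The property is needed in two
universes, once tested on the Grothendieck group and once on `L` itself. -/
theorem exists_grothendieck_equiv.{a, b} {M : Type a} {L : Type b} [AddCommMonoid M]
    [AddCommGroup L] (g : M →+ L) (h₁ : IsGroupCompletion.{a} g) (h₂ : IsGroupCompletion.{b} g) :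
    ∃ e : Algebra.GrothendieckAddGroup M ≃+ L,
      ∀ a, e (Algebra.GrothendieckAddGroup.of a) = g a := by
  obtain ⟨Φ, hΦ, -⟩ := h₁ (Algebra.GrothendieckAddGroup M) Algebra.GrothendieckAddGroup.of
  have hlift : (Algebra.GrothendieckAddGroup.lift g).comp Algebra.GrothendieckAddGroup.of = g :=
    Algebra.GrothendieckAddGroup.lift.symm_apply_apply g
  have h : (Algebra.GrothendieckAddGroup.lift g).comp Φ = AddMonoidHom.id L := by
    refine (h₂ L g).unique ?_ (AddMonoidHom.id_comp g)
    rw [AddMonoidHom.comp_assoc, hΦ, hlift]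
  have h' : Φ.comp (Algebra.GrothendieckAddGroup.lift g) = AddMonoidHom.id _ := by
    refine Algebra.GrothendieckAddGroup.lift.symm.injective ?_
    change (Φ.comp (Algebra.GrothendieckAddGroup.lift g)).comp Algebra.GrothendieckAddGroup.of =
      (AddMonoidHom.id _).comp Algebra.GrothendieckAddGroup.of
    rw [AddMonoidHom.comp_assoc, hlift, hΦ, AddMonoidHom.id_comp]
  exact ⟨AddMonoidHom.toAddEquiv _ Φ h' h, fun a => DFunLike.congr_fun hlift a⟩

/-- The group law on `L` is pulled back from the product along `e`; additivity of `e` on the images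
of the ι k then says exactly that it is the localization law. -/
theorem exists_localization_structure.{p} {M P W L : Type*} [AddCommMonoid M] [AddCommGroup P]
    [AddCommGroup W] (e : L ≃ P × W) (ψ : M) (ι : ℕ → M → L) (hs : ∀ z, ∃ k a, ι k a = z)
    (hiff : ∀ k l a b, ι k a = ι l b ↔ ∃ n : ℕ, a + (l + n) • ψ = b + (k + n) • ψ)
    (hadd : ∀ k l a b, e (ι k a) + e (ι l b) = e (ι (k + l) (a + b))) :
    ∃ _ : AddCommGroup L, (∀ k l a b, ι k a + ι l b = ι (k + l) (a + b)) ∧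
      (∃ g : M →+ L, (∀ a, g a = ι 0 a) ∧ IsGroupCompletion.{p} g) ∧
      (∃ e' : L ≃+ P × W, ∀ z, e' z = e z) ∧
      ∃ e' : Algebra.GrothendieckAddGroup M ≃+ P × W,
        ∀ a, e' (Algebra.GrothendieckAddGroup.of a) = e (ι 0 a) := by
  let _ : AddCommGroup L := e.addCommGroup
  have he : ∀ y z, e (y + z) = e y + e z := fun y z => e.apply_symm_apply _
  have hadd' : ∀ k l a b, ι k a + ι l b = ι (k + l) (a + b) := fun k l a b =>
    e.injective ((he _ _).trans (hadd k l a b))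
  let g : M →+ L :=
    { toFun := ι 0
      map_zero' := by
        have h := hadd' 0 0 0 0
        rw [add_zero, add_zero] at h
        exact add_eq_left.1 h
      map_add' := fun a b => (hadd' 0 0 a b).symm }
  have hg : ∀ a, g a = ι 0 a := fun _ => rfl
  let e' : L ≃+ P × W := { e with map_add' := he }
  obtain ⟨e'', he''⟩ := exists_grothendieck_equiv g
    (isGroupCompletion_of_localization ψ ι hs hiff hadd' g hg)
    (isGroupCompletion_of_localization ψ ι hs hiff hadd' g hg)
  exact ⟨inferInstance, hadd', ⟨g, hg, isGroupCompletion_of_localization ψ ι hs hiff hadd' g hg⟩,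
    ⟨e', fun _ => rfl⟩, e''.trans e', fun a => congrArg e (he'' a)⟩

end Completion

/-- A commutative monoid with inverses is an abelian group. -/
@[reducible] def AddCommMonoid.toGroupOfNeg {M : Type*} [AddCommMonoid M] (neg : M → M)
    (h : ∀ a, neg a + a = 0) : AddCommGroup M :=
  let _ : Neg M := ⟨neg⟩
  { (inferInstance : AddCommMonoid M) with
    neg := neg
    zsmul := zsmulRec
    neg_add_cancel := h }

theorem ContinuousMap.Homotopic.of_eq {X Y : Type*} [TopologicalSpace X] [TopologicalSpace Y]
    {f g : C(X, Y)} (h : f = g) : f.Homotopic g :=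
  h ▸ ContinuousMap.Homotopic.refl f

/-! ### The group `[X, ℤ]` -/

section Integers

variable (X : Type*) [TopologicalSpace X]

/-- The commutative monoid `[X, ℤ]`. -/
@[reducible] def htpyIntMonoid : AddCommMonoid (HtpyClasses X ℤ) :=
  htpyAddCommMonoid (⟨fun p : ℤ × ℤ => p.1 + p.2, continuous_add⟩ : C(ℤ × ℤ, ℤ)) 0
    (.of_eq (ContinuousMap.ext fun a => add_zero a))
    (.of_eq (ContinuousMap.ext fun a => add_comm a.2 a.1))
    (.of_eq (ContinuousMap.ext fun a => add_assoc a.1.1 a.1.2 a.2))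

/-- The abelian group `[X, ℤ]`. -/
@[reducible] def htpyIntGroup : AddCommGroup (HtpyClasses X ℤ) :=
  let _ := htpyIntMonoid X
  AddCommMonoid.toGroupOfNeg (HtpyClasses.map ⟨fun a : ℤ => -a, continuous_neg⟩) (by
    intro a
    obtain ⟨f, rfl⟩ := a.exists_rep
    exact congrArg HtpyClasses.mk (ContinuousMap.ext fun x => neg_add_cancel (f x)))

theorem isPointwise_htpyIntGroup :
    IsPointwise (fun a b c : ℤ => a + b = c) 0 (htpyIntGroup X).toAddCommMonoid :=
  ⟨fun f g => ⟨f + g, fun _ => rfl, rfl⟩, rfl⟩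

end Integers

section

variable {X : Type*} [TopologicalSpace X]

theorem ContinuousMap.Homotopic.eq_of_discrete {W : Type*} [TopologicalSpace W]
    [DiscreteTopology W] {f g : C(X, W)} (h : f.Homotopic g) : f = g := by
  obtain ⟨F⟩ := h
  ext1 x
  have h1 : Continuous fun t : unitInterval => F (t, x) := by fun_prop
  have h2 := PreconnectedSpace.constant (inferInstance : PreconnectedSpace unitInterval) h1
    (x := 0) (y := 1)
  exact (F.apply_zero x).symm.trans (h2.trans (F.apply_one x))

end

namespace QuantumStateType

variable {Γ : Type*} (Q : QuantumStateType Γ) (m : VacuumModel)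

/-! ### The group `[X, 𝒬_Γ(H^{⊗ ∞})]` -/

section

variable {m} {X : Type*} [TopologicalSpace X] [CompactSpace X]

/-- The abelian group `[X, 𝒬_Γ(H^{⊗ ∞})]`. -/
@[reducible] def stableGroup (h : Q.HasNeg m X) : AddCommGroup (HtpyClasses X (Q.Stable m)) :=
  let _ := Q.stableMonoid m X
  AddCommMonoid.toGroupOfNeg (fun α => (h α).choose) fun α =>
    (Q.stableAdd_comm m _ α).trans (h α).choose_spec

theorem isPointwise_stableGroup (h : Q.HasNeg m X) :
    IsPointwise (Q.StableMul m) (Q.stableBase m) (Q.stableGroup h).toAddCommMonoid :=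
  ⟨fun f g => Q.exists_stableMul_mk_eq m f g, rfl⟩

/-! ### Additivity of `ȷ` -/

/-- The degrees of `f` and `g` may jump over `X`, whereas the lifts f' and g' live at fixed stages.
On each clopen piece where both degrees are constant, the two sides are stackings of representatives
of the same stable families, and `stackVia_homotopic` applies. -/
theorem j_stack_homotopic {a b k : ℕ} (f g : C(X, Q.Systems m))
    (f' : C(X, Q.carrier (m.H.tpow a))) (g' : C(X, Q.carrier (m.H.tpow b)))
    (hf : ∀ x, Q.jn m a (f' x) = Q.j m (f x)) (hg : ∀ x, Q.jn m b (g' x) = Q.j m (g x))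
    (φ : (m.H.tpow a).tensor (m.H.tpow b) →ₗᵢ[ℂ] m.H.tpow k) :
    (Q.stackVia m φ f' g').Homotopic
      ((Q.j m).comp ((Q.stack m).comp (f.prodMk g))) := by
  let Y : ℕ × ℕ → Set X := fun p => {x | (f x).1 = p.1 ∧ (g x).1 = p.2}
  have hY : ∀ p, IsClopen (Y p) := fun p => by
    have h : Continuous fun x => ((f x).1, (g x).1) :=
      ((Q.continuous_degree m).comp f.continuous).prodMk
        ((Q.continuous_degree m).comp g.continuous)
    have h1 : Y p = (fun x => ((f x).1, (g x).1)) ⁻¹' {p} := by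
      ext x
      exact (Prod.ext_iff (x := ((f x).1, (g x).1)) (y := p)).symm
    rw [h1]
    exact (isClopen_discrete {p}).preimage h
  refine homotopic_of_sigma_cover (Z := fun p => Y p) (e := fun p x => x.1)
    (fun p => (hY p).isOpen.isOpenEmbedding_subtypeVal) ?_ fun p => ?_
  · refine ⟨?_, fun x => ⟨⟨((f x).1, (g x).1), x, rfl, rfl⟩, rfl⟩⟩
    rintro ⟨p, x, hx⟩ ⟨q, y, hy⟩ h
    have h : x = y := h
    subst h
    have h' : p = q := (Prod.ext hx.1.symm hx.2.symm : p = ((f x).1, (g x).1)).trans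
      (Prod.ext hy.1 hy.2)
    subst h'
    rfl
  · have : CompactSpace (Y p) := isCompact_iff_compactSpace.1 (hY p).isClosed.isCompact
    let i : C(Y p, X) := ⟨Subtype.val, continuous_subtype_val⟩
    refine (Q.exists_lift_sysMk m (f.comp i) fun x => x.2.1).elim fun f₁ hf₁ => ?_
    refine (Q.exists_lift_sysMk m (g.comp i) fun x => x.2.2).elim fun g₁ hg₁ => ?_
    have h := Q.stackVia_homotopic m φ (m.H.concat p.1 p.2) (f := f'.comp i) (g := g'.comp i)
      (f' := f₁) (g' := g₁)
      (.of_eq (ContinuousMap.ext fun x => (hf x).trans (congrArg (Q.j m) (hf₁ x).symm)))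
      (.of_eq (ContinuousMap.ext fun x => (hg x).trans (congrArg (Q.j m) (hg₁ x).symm)))
    refine h.trans (.of_eq (ContinuousMap.ext fun x => ?_))
    exact congrArg₂ (fun y z => Q.j m (Q.stack m (y, z))) (hf₁ x) (hg₁ x)

theorem stableAdd_j (f g : C(X, Q.Systems m)) :
    Q.stableAdd m (HtpyClasses.mk ((Q.j m).comp f)) (HtpyClasses.mk ((Q.j m).comp g)) =
      HtpyClasses.mk ((Q.j m).comp ((Q.stack m).comp (f.prodMk g))) := by
  refine (Q.exists_lift_jn m ((Q.j m).comp f)).elim fun a ha => ?_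
  refine (Q.exists_lift_jn m ((Q.j m).comp g)).elim fun b hb => ?_
  refine (ha a le_rfl).elim fun f' hf => ?_
  refine (hb b le_rfl).elim fun g' hg => ?_
  have hf' : (Q.jn m a).comp f' = (Q.j m).comp f := ContinuousMap.ext hf
  have hg' : (Q.jn m b).comp g' = (Q.j m).comp g := ContinuousMap.ext hg
  have h := Q.mk_stableAdd_mk m f' g' (m.H.concat a b)
  refine Eq.trans (congrArg₂ (Q.stableAdd m) (congrArg HtpyClasses.mk hf'.symm)
    (congrArg HtpyClasses.mk hg'.symm)) ?_
  exact h.trans (HtpyClasses.mk_eq_iff.2 (Q.j_stack_homotopic f g f' g' hf hg _))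

end

end QuantumStateType

namespace QuantumStateType

variable {Γ : Type*} (Q : QuantumStateType Γ) (m : VacuumModel)

/-! ### The localization `ψ⁻¹𝒬_Γ^⊔(H)` -/

/-- Inclusion of a term of the localization diagram. -/
def locMk (k : ℕ) (x : Q.Systems m) : Σ _ : ℕ, Q.Systems m := ⟨k, x⟩

theorem isOpenEmbedding_locMk (k : ℕ) : Topology.IsOpenEmbedding (Q.locMk m k) :=
  Topology.IsOpenEmbedding.sigmaMk (σ := fun _ : ℕ => Q.Systems m)

/-- The map of the localization diagram. -/
def locStep : C(Σ _ : ℕ, Q.Systems m, Σ _ : ℕ, Q.Systems m) :=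
  ⟨fun p => Q.locMk m (p.1 + 1) (Q.step m p.2), continuous_sigma fun k =>
    (Q.isOpenEmbedding_locMk m (k + 1)).continuous.comp (Q.step m).continuous⟩

theorem locStep_iff {p q : Σ _ : ℕ, Q.Systems m} : Q.LocStep m p q ↔ q = Q.locStep m p := by
  constructor
  · intro h
    cases h with
    | mk k x y h => exact congrArg (Q.locMk m (k + 1)) ((Q.step_iff m).1 h)
  · intro h
    rw [h]
    exact LocStep.mk p.1 p.2 _ ((Q.step_iff m).2 rfl)

theorem locStep_injective : Function.Injective (Q.locStep m) := by
  rintro ⟨k, x⟩ ⟨l, y⟩ h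
  have h1 : k = l := Nat.succ_injective (congrArg Sigma.fst h)
  subst h1
  exact congrArg (Q.locMk m k) (Q.step_injective m
    ((Q.isOpenEmbedding_locMk m (k + 1)).injective h))

theorem isClosedEmbedding_locStep : Topology.IsClosedEmbedding (Q.locStep m) := by
  refine Topology.IsClosedEmbedding.of_continuous_injective_isClosedMap (Q.locStep m).continuous
    (Q.locStep_injective m) fun F hF => isClosed_sigma_iff.2 fun i => ?_
  cases i with
  | zero =>
    convert isClosed_empty
    refine Set.eq_empty_iff_forall_notMem.2 fun y hy => ?_
    obtain ⟨p, _, hp⟩ := hy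
    exact Nat.succ_ne_zero _ (congrArg Sigma.fst hp)
  | succ i =>
    have h := (Q.isClosedEmbedding_step m).isClosedMap _
      (hF.preimage (Q.isOpenEmbedding_locMk m i).continuous)
    refine (congrArg IsClosed ?_).mpr h
    ext y
    constructor
    · rintro ⟨⟨k, x⟩, hxF, hx⟩
      have h1 : k = i := Nat.succ_injective (congrArg Sigma.fst hx)
      subst h1
      exact ⟨x, hxF, (Q.isOpenEmbedding_locMk m (k + 1)).injective hx⟩
    · rintro ⟨x, hx, rfl⟩
      exact ⟨⟨i, x⟩, hx, rfl⟩

theorem ι_injective (k : ℕ) : Function.Injective (Q.ι m k) := by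
  intro x y h
  exact (Q.isOpenEmbedding_locMk m k).injective
    ((quot_mk_eq_iff_of_degree_eq (x := Q.locMk m k x) (y := Q.locMk m k y) (S := Q.locStep m)
      (r := Q.LocStep m) (d := Sigma.fst) (fun _ _ => Q.locStep_iff m) (Q.locStep_injective m)
      (fun _ => rfl) 0 rfl).1 h)

theorem ι_stepN (k n : ℕ) (x : Q.Systems m) : Q.ι m (k + n) (Q.stepN m n x) = Q.ι m k x := by
  induction n with
  | zero => rfl
  | succ n ih =>
    refine Eq.trans ?_ ih
    refine (congrArg (Q.ι m (k + (n + 1))) (Function.iterate_succ_apply' (Q.step m) n x)).trans ?_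
    exact (Quot.sound ((Q.locStep_iff m (p := Q.locMk m (k + n) (Q.stepN m n x))).2 rfl)).symm

theorem ι_stepN_of_eq {k n l : ℕ} (h : k + n = l) (x : Q.Systems m) :
    Q.ι m l (Q.stepN m n x) = Q.ι m k x := by
  subst h
  exact Q.ι_stepN m k n x

theorem exists_ι (z : Q.Localized m) : ∃ k x, Q.ι m k x = z :=
  Quot.inductionOn z fun p => ⟨p.1, p.2, rfl⟩

theorem locC_ι (k : ℕ) (x : Q.Systems m) : Q.locC m (Q.ι m k x) = (x.1 : ℤ) - k := rfl

theorem degree_stepN (n : ℕ) (x : Q.Systems m) : (Q.stepN m n x).1 = x.1 + n :=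
  degree_iterate (S := Q.step m) (d := Sigma.fst) (fun _ => rfl) n x

theorem j_eq_iff {x y : Q.Systems m} :
    Q.j m x = Q.j m y ↔ ∃ a b, Q.stepN m a x = Q.stepN m b y :=
  quot_mk_eq_iff_of_graph (S := Q.step m) (r := Q.Step m) fun _ _ => Q.step_iff m

theorem add_eq_add_of_sub_eq_sub {a b i i' k l : ℕ} (h : i + a = i' + b)
    (h' : (i : ℤ) - k = i' - l) : l + b = k + a := by
  omega

/-- Equal stable classes mean that x and y coincide after `a` and `b` stackings with ψ. Comparing
degrees and integers gives k + a = l + b, so the coincidence happens within one term of the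
localization diagram. -/
theorem eq_of_locJ_of_locC {z w : Q.Localized m} (hJ : Q.locJ m z = Q.locJ m w)
    (hC : Q.locC m z = Q.locC m w) : z = w := by
  refine (Q.exists_ι m z).elim fun k hk => hk.elim fun x hx => ?_
  refine (Q.exists_ι m w).elim fun l hl => hl.elim fun y hy => ?_
  subst hx hy
  refine ((Q.j_eq_iff m).1 hJ).elim fun a ha => ha.elim fun b h => ?_
  have h1 := ((Q.degree_stepN m a x).symm.trans (congrArg Sigma.fst h)).trans
    (Q.degree_stepN m b y)
  exact (Q.ι_stepN m k a x).symm.trans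
    ((congrArg (Q.ι m (k + a)) h).trans (Q.ι_stepN_of_eq m (add_eq_add_of_sub_eq_sub h1 hC) y))

instance instT1SpaceSigmaSystems : T1Space (Σ _ : ℕ, Q.Systems m) :=
  have : T2Space (Σ _ : ℕ, Q.Systems m) := Sigma.t2Space
  T2Space.t1Space

section

variable {X : Type*} [TopologicalSpace X] [CompactSpace X]

theorem exists_lift_ι (f : C(X, Q.Localized m)) : ∃ N : ℕ, ∀ n, N ≤ n →
    ∃ g : C(X, Q.Systems m), ∀ x, Q.ι m n (g x) = f x := by
  have h := exists_lift_quot_of_compact (T := Σ _ : ℕ, Q.Systems m) (S := Q.locStep m)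
    (r := Q.LocStep m) (d := Sigma.fst) (fun _ _ => Q.locStep_iff m)
    (Q.isClosedEmbedding_locStep m) (continuous_sigma fun _ => continuous_const)
    (fun _ => rfl) f
  refine h.elim fun N hN => ⟨N, fun n hn => ?_⟩
  refine (hN n hn).elim fun g hg => ?_
  refine (exists_lift_of_isEmbedding (Q.isOpenEmbedding_locMk m n).isEmbedding g fun x => ?_).elim
    fun f' hf' => ⟨f', fun x => ?_⟩
  · have h := hg.1 x
    generalize g x = y at h
    subst h
    exact ⟨y.2, rfl⟩
  · exact (congrArg (Quot.mk (Q.LocStep m)) (hf' x)).trans (hg.2 x)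

/-- Lift `h` to one stage n and put the lift of `h x` into the term n − c x of the diagram, so that
its integer is c x. This term is locally constant in x, so the map is continuous. -/
theorem exists_localized_map (h : C(X, Q.Stable m)) (c : C(X, ℤ)) :
    ∃ F : C(X, Q.Localized m), (∀ x, Q.locJ m (F x) = h x) ∧ ∀ x, Q.locC m (F x) = c x := by
  refine (Q.exists_lift_jn m h).elim fun N hN => ?_
  obtain ⟨B, hB⟩ := (isCompact_range c.continuous).bddAbove
  refine (hN (max N B.toNat) (le_max_left _ _)).elim fun f hf => ?_
  have hcont : Continuous fun p : ℕ × Q.Systems m => Q.ι m p.1 p.2 :=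
    continuous_prod_of_discrete_left.2 fun k => (Q.ι m k).continuous
  have hdeg : Continuous fun x => (((max N B.toNat : ℕ) : ℤ) - c x).toNat :=
    (continuous_of_discreteTopology
      (f := fun t : ℤ => (((max N B.toNat : ℕ) : ℤ) - t).toNat)).comp c.continuous
  refine ⟨⟨fun x => Q.ι m (((max N B.toNat : ℕ) : ℤ) - c x).toNat (Q.sysMk m _ (f x)),
    hcont.comp (hdeg.prodMk ((Q.continuous_sysMk m _).comp f.continuous))⟩, hf, fun x => ?_⟩
  have hx : c x ≤ B := hB ⟨x, rfl⟩
  refine (Q.locC_ι m _ _).trans ?_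
  change ((max N B.toNat : ℕ) : ℤ) - _ = _
  omega

/-- `[X, ψ⁻¹ȷ] × [X, ψ⁻¹c]`. -/
def locMap (z : HtpyClasses X (Q.Localized m)) :
    HtpyClasses X (Q.Stable m) × HtpyClasses X ℤ :=
  (HtpyClasses.map (Q.locJ m) z, HtpyClasses.map (Q.locC m) z)

/-- Surjectivity is `exists_localized_map`. For injectivity the same lemma is applied over I × X to
a homotopy of the stable parts, with the integer part held constant in time: homotopic maps to ℤ are
equal. -/
theorem bijective_locMap : Function.Bijective (Q.locMap m (X := X)) := by
  constructor
  · intro z w h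
    obtain ⟨f, rfl⟩ := z.exists_rep
    obtain ⟨g, rfl⟩ := w.exists_rep
    have hC : (Q.locC m).comp f = (Q.locC m).comp g :=
      (HtpyClasses.mk_eq_iff.1 (congrArg Prod.snd h)).eq_of_discrete
    refine HtpyClasses.mk_eq_iff.2 ((HtpyClasses.mk_eq_iff.1 (congrArg Prod.fst h)).elim fun H => ?_)
    refine (Q.exists_localized_map m H.toContinuousMap
      (((Q.locC m).comp f).comp ContinuousMap.snd)).elim fun F hF => ⟨⟨F, fun x => ?_, fun x => ?_⟩⟩
    · exact Q.eq_of_locJ_of_locC m ((hF.1 _).trans (H.apply_zero x)) (hF.2 _)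
    · exact Q.eq_of_locJ_of_locC m ((hF.1 _).trans (H.apply_one x))
        ((hF.2 _).trans (DFunLike.congr_fun hC x))
  · rintro ⟨a, b⟩
    obtain ⟨h, rfl⟩ := a.exists_rep
    obtain ⟨c, rfl⟩ := b.exists_rep
    exact (Q.exists_localized_map m h c).elim fun F hF => ⟨HtpyClasses.mk F,
      Prod.ext (congrArg HtpyClasses.mk (ContinuousMap.ext hF.1))
        (congrArg HtpyClasses.mk (ContinuousMap.ext hF.2))⟩

theorem exists_map_ι_eq (z : HtpyClasses X (Q.Localized m)) :
    ∃ k a, HtpyClasses.map (Q.ι m k) a = z := by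
  obtain ⟨f, rfl⟩ := z.exists_rep
  exact (Q.exists_lift_ι m f).elim fun k hk => (hk k le_rfl).elim fun g hg =>
    ⟨k, HtpyClasses.mk g, congrArg HtpyClasses.mk (ContinuousMap.ext hg)⟩

/-- Both maps are moved to the common term k + l + n, where `f` needs l + n steps and `g` needs k +
n. A homotopy in the colimit lifts to such a term for large n, and its ends match because ι is
injective. -/
theorem ι_homotopic_iff (k l : ℕ) (f g : C(X, Q.Systems m)) :
    ((Q.ι m k).comp f).Homotopic ((Q.ι m l).comp g) ↔
      ∃ n, ((Q.stepN m (l + n)).comp f).Homotopic ((Q.stepN m (k + n)).comp g) := by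
  have hl : ∀ n x, Q.ι m (k + l + n) (Q.stepN m (l + n) (f x)) = Q.ι m k (f x) := fun n x =>
    Q.ι_stepN_of_eq m (Nat.add_assoc k l n).symm _
  have hr : ∀ n x, Q.ι m (k + l + n) (Q.stepN m (k + n) (g x)) = Q.ι m l (g x) := fun n x =>
    Q.ι_stepN_of_eq m (by omega) _
  constructor
  · rintro ⟨H⟩
    refine (Q.exists_lift_ι m H.toContinuousMap).elim fun N hN => ?_
    refine (hN (k + l + N) (Nat.le_add_left _ _)).elim fun G hG =>
      ⟨N, ⟨⟨G, fun x => ?_, fun x => ?_⟩⟩⟩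
    · exact Q.ι_injective m _ ((hG _).trans ((H.apply_zero x).trans (hl N x).symm))
    · exact Q.ι_injective m _ ((hG _).trans ((H.apply_one x).trans (hr N x).symm))
  · rintro ⟨n, h⟩
    have h1 := h.comp_left (Q.ι m (k + l + n))
    exact ((ContinuousMap.Homotopic.of_eq (ContinuousMap.ext fun x => (hl n x).symm)).trans
      h1).trans (.of_eq (ContinuousMap.ext (hr n)))

variable (X) in
theorem map_ι_eq_iff (k l : ℕ) (a b : HtpyClasses X (Q.Systems m)) :
    let _ := Q.systemsMonoid m X
    HtpyClasses.map (Q.ι m k) a = HtpyClasses.map (Q.ι m l) b ↔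
      ∃ n : ℕ, a + (l + n) • HtpyClasses.mk (ContinuousMap.const X (Q.trivialSystem m 1)) =
        b + (k + n) • HtpyClasses.mk (ContinuousMap.const X (Q.trivialSystem m 1)) := by
  intro _
  refine a.exists_rep.elim fun f hf => b.exists_rep.elim fun g hg => ?_
  subst hf hg
  refine (HtpyClasses.mk_eq_iff.trans (Q.ι_homotopic_iff m k l f g)).trans
    (exists_congr fun n => ?_)
  refine HtpyClasses.mk_eq_iff.symm.trans ?_
  exact Iff.of_eq (congrArg₂ Eq (Q.mk_add_nsmul m X f (l + n)).symm
    (Q.mk_add_nsmul m X g (k + n)).symm)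

variable {m} in
theorem locMap_ι_add (h : Q.HasNeg m X) (k l : ℕ) (a b : HtpyClasses X (Q.Systems m)) :
    let _ := Q.systemsMonoid m X
    let _ := Q.stableGroup h
    let _ := htpyIntGroup X
    Q.locMap m (HtpyClasses.map (Q.ι m k) a) + Q.locMap m (HtpyClasses.map (Q.ι m l) b) =
      Q.locMap m (HtpyClasses.map (Q.ι m (k + l)) (a + b)) := by
  intro _ _ _
  refine a.exists_rep.elim fun f hf => b.exists_rep.elim fun g hg => ?_
  subst hf hg
  refine Prod.ext (Q.stableAdd_j f g) (congrArg HtpyClasses.mk (ContinuousMap.ext fun x => ?_))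
  change ((f x).1 : ℤ) - k + ((g x).1 - l) = (((f x).1 + (g x).1 : ℕ) : ℤ) - ((k + l : ℕ) : ℤ)
  push_cast
  ring

end

end QuantumStateType

/-! ### Assembly of the group completion theorem. -/

theorem QuantumStateType.Invertible.exists_groupCompletion {Γ : Type*} (Q : QuantumStateType Γ)
    (hQ : Q.Invertible) (m : VacuumModel) (X : Type*) [TopologicalSpace X]
    (hX : IsParameterSpace X) :
    ∃ (iM : AddCommMonoid (HtpyClasses X (Q.Systems m)))
      (_iL : AddCommGroup (HtpyClasses X (Q.Localized m)))
      (iP : AddCommGroup (HtpyClasses X (Q.Stable m)))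
      (iZ : AddCommGroup (HtpyClasses X ℤ)),
      -- the algebraic structures are the canonical ones
      IsPointwise (Q.Stack m) (Q.trivialSystem m 0) iM ∧
      IsPointwise (Q.StableMul m) (Q.stableBase m) iP.toAddCommMonoid ∧
      IsPointwise (fun a b c : ℤ => a + b = c) 0 iZ.toAddCommMonoid ∧
      Q.IsLocalizationStructure m X ∧
      -- `[X, ι₀]` is the Grothendieck group completion
      (∃ g : HtpyClasses X (Q.Systems m) →+ HtpyClasses X (Q.Localized m),
        (∀ a, g a = HtpyClasses.map (Q.ι m 0) a) ∧ IsGroupCompletion.{v} g) ∧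
      -- `[X, ψ⁻¹ȷ] × [X, ψ⁻¹c]` is an isomorphism
      (∃ e : HtpyClasses X (Q.Localized m) ≃+ HtpyClasses X (Q.Stable m) × HtpyClasses X ℤ,
        ∀ z, e z = (HtpyClasses.map (Q.locJ m) z, HtpyClasses.map (Q.locC m) z)) ∧
      -- the induced isomorphism on `K₀`
      (∃ e : Algebra.GrothendieckAddGroup (HtpyClasses X (Q.Systems m)) ≃+
          HtpyClasses X (Q.Stable m) × HtpyClasses X ℤ,
        ∀ a, e (Algebra.GrothendieckAddGroup.of a) =
          (HtpyClasses.map (Q.locJ m) (HtpyClasses.map (Q.ι m 0) a),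
            HtpyClasses.map (Q.locC m) (HtpyClasses.map (Q.ι m 0) a))) := by
  have : CompactSpace X := hX.1
  have h := Q.hasNeg_of_isParameterSpace (m := m) hQ hX
  let iM := Q.systemsMonoid m X
  let iP := Q.stableGroup h
  let iZ := htpyIntGroup X
  obtain ⟨_, hadd, hg, he, hK⟩ := exists_localization_structure.{v}
    (Equiv.ofBijective _ (Q.bijective_locMap m))
    (HtpyClasses.mk (ContinuousMap.const X (Q.trivialSystem m 1)))
    (fun k => HtpyClasses.map (Q.ι m k)) (Q.exists_map_ι_eq m) (Q.map_ι_eq_iff m X)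
    (Q.locMap_ι_add h)
  exact ⟨iM, _, iP, iZ, Q.isPointwise_systemsMonoid m X, Q.isPointwise_stableGroup h,
    isPointwise_htpyIntGroup X, ⟨Q.exists_map_ι_eq m, Q.map_ι_eq_iff m X, hadd⟩, hg, he, hK⟩

end

theorem mainTheorem7 {Γ : Type*} [Countable Γ] (Q : QuantumStateType Γ)
    (hQ : Q.Invertible) (m : VacuumModel) (X : Type*) [TopologicalSpace X]
    (hX : IsParameterSpace X) :
    ∃ (iM : AddCommMonoid (HtpyClasses X (Q.Systems m)))
      (iL : AddCommGroup (HtpyClasses X (Q.Localized m)))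
      (iP : AddCommGroup (HtpyClasses X (Q.Stable m)))
      (iZ : AddCommGroup (HtpyClasses X ℤ)),
      -- the algebraic structures are the canonical ones
      IsPointwise (Q.Stack m) (Q.trivialSystem m 0) iM ∧
      IsPointwise (Q.StableMul m) (Q.stableBase m) iP.toAddCommMonoid ∧
      IsPointwise (fun a b c : ℤ => a + b = c) 0 iZ.toAddCommMonoid ∧
      Q.IsLocalizationStructure m X ∧
      -- `[X, ι₀]` is the Grothendieck group completion
      (∃ g : HtpyClasses X (Q.Systems m) →+ HtpyClasses X (Q.Localized m),
        (∀ a, g a = HtpyClasses.map (Q.ι m 0) a) ∧ IsGroupCompletion.{v} g) ∧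
      -- `[X, ψ⁻¹ȷ] × [X, ψ⁻¹c]` is an isomorphism
      (∃ e : HtpyClasses X (Q.Localized m) ≃+ HtpyClasses X (Q.Stable m) × HtpyClasses X ℤ,
        ∀ z, e z = (HtpyClasses.map (Q.locJ m) z, HtpyClasses.map (Q.locC m) z)) ∧
      -- the induced isomorphism on `K₀`
      (∃ e : Algebra.GrothendieckAddGroup (HtpyClasses X (Q.Systems m)) ≃+
          HtpyClasses X (Q.Stable m) × HtpyClasses X ℤ,
        ∀ a, e (Algebra.GrothendieckAddGroup.of a) =
          (HtpyClasses.map (Q.locJ m) (HtpyClasses.map (Q.ι m 0) a),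
            HtpyClasses.map (Q.locC m) (HtpyClasses.map (Q.ι m 0) a))) :=
  hQ.exists_groupCompletion Q m X hX
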